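/- **Theorem (the cross-ratio map for open linkages is a stable mapping with folds only).** For positive $a,b,c$ let $A=A(a,b,c)$ be the planar robot $3$-arm with side-lengths $a,b,c$. Its moduli space $M(A)$ is the set of all $(v_1,v_2,v_3,v_4)\in\mathbb C^4$ with $|v_2-v_1|=a$, $|v_3-v_2|=b$, $|v_4-v_3|=c$, modulo orientation-preserving isometries of the plane $\mathbb C$. It is identified with the torus $S^1\times S^1$ by sending $(e^{i\phi},e^{i\eta})$ to the class of $(0,\ a,\ a+be^{i\phi},\ a+be^{i\phi}+ce^{i\eta})$. Let $$Cr:M(A)\to\mathbb P^1(\mathbb C)=\mathbb C\cup\{\infty\},\qquad Cr[v_1,v_2,v_3,v_4]=\frac{v_3-v_1}{v_3-v_2}:\frac{v_4-v_1}{v_4-v_2}$$ be the cross-ratio map (with value $\infty$ where $v_4=v_1$). Call $A$ generic if $a,b,c$ are pairwise distinct and none of them is the sum of the other two. The generic arms form an open dense subset of the parameter space $\mathbb R_+^3$, and for every generic arm $A$ the following holds. 1. $Cr$ is a smooth map of (real) surfaces, and it is stable: there is a neighbourhood of $Cr$ in $C^\infty(M(A),\mathbb P^1(\mathbb C))$,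 with the $C^\infty$ (Whitney) topology, such that every $g$ in it satisfies $g\circ h=k\circ Cr$ for some smooth diffeomorphisms $h$ of $M(A)$ and $k$ of $\mathbb P^1(\mathbb C)$. 2. Every singular point of $Cr$ (a point where the real differential is not surjective) is a Whitney fold: in suitable smooth local coordinates centred at the point and at its image, the map is $(x,y)\mapsto(x,y^2)$. 3. $Cr$ has no cusps: at no point does it have the form $(x,y)\mapsto(x,y^3+xy)$ in suitable smooth local coordinates centred at the point and at its image. -/

import Mathlib

open scoped Manifold ContDiff Topology

noncomputable section

/-! ### The Riemann sphere as a smooth surface -/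

namespace RiemannSphere

/-- The inversion `z ↦ 1 / z` of the Riemann sphere, exchanging `0` and `∞`. -/
def inversionFun : OnePoint ℂ → OnePoint ℂ
  | none => ((0 : ℂ) : OnePoint ℂ)
  | some z => if z = 0 then OnePoint.infty else ((z⁻¹ : ℂ) : OnePoint ℂ)

theorem inversionFun_infty : inversionFun OnePoint.infty = ((0 : ℂ) : OnePoint ℂ) := rfl

theorem inversionFun_coe (z : ℂ) :
    inversionFun (z : OnePoint ℂ) = if z = 0 then OnePoint.infty else ((z⁻¹ : ℂ) : OnePoint ℂ) :=
  rfl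

theorem inversionFun_involutive : Function.Involutive inversionFun := by
  intro x
  induction x using OnePoint.rec with
  | infty => rw [inversionFun_infty, inversionFun_coe, if_pos rfl]
  | coe z =>
    by_cases hz : z = 0
    · rw [inversionFun_coe, if_pos hz, inversionFun_infty, hz]
    · rw [inversionFun_coe, if_neg hz, inversionFun_coe, if_neg (inv_ne_zero hz), inv_inv]

theorem continuous_inversionFun : Continuous inversionFun := by
  rw [OnePoint.continuous_iff, Filter.coclosedCompact_eq_cocompact,
    ← Metric.cobounded_eq_cocompact]
  constructor
  · rw [inversionFun_infty]
    have h : Filter.Tendsto (fun z : ℂ => ((z⁻¹ : ℂ) : OnePoint ℂ)) (Bornology.cobounded ℂ)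
        (𝓝 ((0 : ℂ) : OnePoint ℂ)) :=
      (OnePoint.continuous_coe.tendsto (0 : ℂ)).comp Filter.tendsto_inv₀_cobounded
    refine h.congr' ?_
    have h0 : ({0}ᶜ : Set ℂ) ∈ Bornology.cobounded ℂ :=
      Bornology.isBounded_def.1 Bornology.isBounded_singleton
    filter_upwards [h0] with z hz
    have hz' : z ≠ 0 := hz
    rw [inversionFun_coe, if_neg hz']
  · rw [continuous_iff_continuousAt]
    intro z
    by_cases hz : z = 0
    · subst hz
      rw [continuousAt_iff_punctured_nhds]
      have h : Filter.Tendsto (fun z : ℂ => ((z⁻¹ : ℂ) : OnePoint ℂ)) (𝓝[≠] 0)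
          (𝓝 (OnePoint.infty : OnePoint ℂ)) := by
        have h1 := OnePoint.tendsto_coe_infty (X := ℂ)
        rw [Filter.coclosedCompact_eq_cocompact, ← Metric.cobounded_eq_cocompact] at h1
        exact h1.comp Filter.tendsto_inv₀_nhdsNE_zero
      rw [inversionFun_coe, if_pos rfl]
      refine h.congr' ?_
      filter_upwards [self_mem_nhdsWithin] with w hw
      have hw' : w ≠ 0 := hw
      rw [inversionFun_coe, if_neg hw']
    · have h : ContinuousAt (fun z : ℂ => ((z⁻¹ : ℂ) : OnePoint ℂ)) z :=
        OnePoint.continuous_coe.continuousAt.comp (continuousAt_inv₀ hz)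
      refine h.congr ?_
      filter_upwards [isOpen_ne.mem_nhds hz] with w hw
      rw [inversionFun_coe, if_neg hw]

/-- The inversion as a homeomorphism. -/
def inversion : OnePoint ℂ ≃ₜ OnePoint ℂ where
  toFun := inversionFun
  invFun := inversionFun
  left_inv := inversionFun_involutive
  right_inv := inversionFun_involutive
  continuous_toFun := continuous_inversionFun
  continuous_invFun := continuous_inversionFun

/-- The affine chart `z ↦ z`, defined off `∞`. -/
def affineChart : OpenPartialHomeomorph (OnePoint ℂ) ℂ :=
  ((OnePoint.isOpenEmbedding_coe (X := ℂ)).toOpenPartialHomeomorph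
    ((↑) : ℂ → OnePoint ℂ)).symm

/-- The chart `z ↦ 1 / z` around `∞`, defined off `0`. -/
def infinityChart : OpenPartialHomeomorph (OnePoint ℂ) ℂ :=
  inversion.toOpenPartialHomeomorph.trans affineChart

open Classical in
/-- The Riemann sphere `ℂ ∪ {∞}` with its two standard charts. -/
instance : ChartedSpace ℂ (OnePoint ℂ) where
  atlas := {affineChart, infinityChart}
  chartAt x := if x = OnePoint.infty then infinityChart else affineChart
  mem_chart_source x := by
    induction x using OnePoint.rec with
    | infty =>
      rw [if_pos rfl]
      simp only [infinityChart, affineChart, OpenPartialHomeomorph.trans_source,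
        Homeomorph.toOpenPartialHomeomorph_source, Set.univ_inter, Set.mem_preimage,
        OpenPartialHomeomorph.symm_source]
      exact ⟨0, by simp, rfl⟩
    | coe z =>
      rw [if_neg (OnePoint.coe_ne_infty z)]
      exact ⟨z, by simp, rfl⟩
  chart_mem_atlas x := by
    split_ifs
    · exact Or.inr rfl
    · exact Or.inl rfl

theorem affineChart_coe (z : ℂ) : affineChart (z : OnePoint ℂ) = z :=
  ((OnePoint.isOpenEmbedding_coe (X := ℂ)).toOpenPartialHomeomorph
    ((↑) : ℂ → OnePoint ℂ)).left_inv (by simp)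

theorem affineChart_source : affineChart.source = Set.range ((↑) : ℂ → OnePoint ℂ) := by
  simp [affineChart]

theorem affineChart_symm (z : ℂ) : affineChart.symm z = (z : OnePoint ℂ) := rfl

theorem infinityChart_coe {z : ℂ} (hz : z ≠ 0) : infinityChart (z : OnePoint ℂ) = z⁻¹ := by
  change affineChart (inversionFun z) = z⁻¹
  rw [inversionFun_coe, if_neg hz, affineChart_coe]

theorem infinityChart_symm {z : ℂ} (hz : z ≠ 0) :
    infinityChart.symm z = ((z⁻¹ : ℂ) : OnePoint ℂ) := by
  change inversionFun (z : OnePoint ℂ) = _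
  rw [inversionFun_coe, if_neg hz]

theorem infinityChart_symm_zero : infinityChart.symm 0 = OnePoint.infty := by
  change inversionFun ((0 : ℂ) : OnePoint ℂ) = _
  rw [inversionFun_coe, if_pos rfl]

theorem infty_notMem_affineChart_source : OnePoint.infty ∉ affineChart.source := by
  rw [affineChart_source]
  rintro ⟨z, hz⟩
  exact OnePoint.coe_ne_infty z hz

theorem coe_zero_notMem_infinityChart_source :
    ((0 : ℂ) : OnePoint ℂ) ∉ infinityChart.source := by
  intro h
  have h' : inversionFun ((0 : ℂ) : OnePoint ℂ) ∈ affineChart.source := h.2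
  rw [inversionFun_coe, if_pos rfl] at h'
  exact infty_notMem_affineChart_source h'

theorem contDiffOn_inv_compl_zero : ContDiffOn ℝ ∞ (fun z : ℂ => z⁻¹) {0}ᶜ :=
  fun _ hz => ((contDiffAt_inv ℂ hz).restrict_scalars ℝ).contDiffWithinAt

instance : IsManifold 𝓘(ℝ, ℂ) ∞ (OnePoint ℂ) := by
  refine isManifold_of_contDiffOn _ _ _ ?_
  rintro e e' (rfl | rfl) (rfl | rfl)
  · refine contDiffOn_id.congr fun z _ => ?_
    exact affineChart_coe z
  · have key : ∀ z : ℂ, z ∈ (affineChart.symm.trans infinityChart).source → z ≠ 0 := by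
      rintro z hz rfl
      exact coe_zero_notMem_infinityChart_source hz.2
    refine (contDiffOn_inv_compl_zero.mono fun z hz => key z hz.1).congr fun z hz => ?_
    exact infinityChart_coe (key z hz.1)
  · have key : ∀ z : ℂ, z ∈ (infinityChart.symm.trans affineChart).source → z ≠ 0 := by
      rintro z hz rfl
      have h : infinityChart.symm 0 ∈ affineChart.source := hz.2
      rw [infinityChart_symm_zero] at h
      exact infty_notMem_affineChart_source h
    refine (contDiffOn_inv_compl_zero.mono fun z hz => key z hz.1).congr fun z hz => ?_
    change affineChart (infinityChart.symm z) = z⁻¹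
    rw [infinityChart_symm (key z hz.1), affineChart_coe]
  · refine contDiffOn_id.congr fun z hz => ?_
    exact infinityChart.right_inv hz.1.1

end RiemannSphere

/-! ### Stability, folds and cusps of smooth maps -/

section SmoothMaps

variable {E H E' H' : Type*}
  [NormedAddCommGroup E] [NormedSpace ℝ E] [TopologicalSpace H]
  [NormedAddCommGroup E'] [NormedSpace ℝ E'] [TopologicalSpace H']
  (I : ModelWithCorners ℝ E H) (I' : ModelWithCorners ℝ E' H')
  {M N : Type*} [TopologicalSpace M] [ChartedSpace H M] [TopologicalSpace N] [ChartedSpace H' N]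

/-- The basic set of smooth maps `g` that map the compact set `K` (in the domain of the
chart `φ`) into the domain of the chart `ψ`, and whose derivatives of order at most `r`, read in
these charts, are `ε`-close to those of `f` on `K`. -/
def smoothMapNbhd [I.Boundaryless] (f : C^∞⟮I, M; I', N⟯) (φ : OpenPartialHomeomorph M H)
    (ψ : OpenPartialHomeomorph N H') (K : Set M) (r : ℕ) (ε : ℝ) : Set C^∞⟮I, M; I', N⟯ :=
  {g | Set.MapsTo g K ψ.source ∧ ∀ k ≤ r, ∀ p ∈ K,
    ‖iteratedFDeriv ℝ k (ψ.extend I' ∘ g ∘ (φ.extend I).symm) (φ.extend I p) -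
      iteratedFDeriv ℝ k (ψ.extend I' ∘ f ∘ (φ.extend I).symm) (φ.extend I p)‖ < ε}

/-- The `C^∞` topology on the space of smooth maps between manifolds without boundary (uniform
convergence of all derivatives in charts on compact sets). For a compact source this is the
Whitney topology. -/
abbrev smoothMapTopology [I.Boundaryless] : TopologicalSpace C^∞⟮I, M; I', N⟯ :=
  TopologicalSpace.generateFrom
    {U | ∃ (f : C^∞⟮I, M; I', N⟯) (φ : OpenPartialHomeomorph M H)
      (ψ : OpenPartialHomeomorph N H') (K : Set M) (r : ℕ) (ε : ℝ),
      φ ∈ IsManifold.maximalAtlas I ∞ M ∧ ψ ∈ IsManifold.maximalAtlas I' ∞ N ∧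
      IsCompact K ∧ K ⊆ φ.source ∧ Set.MapsTo f K ψ.source ∧ 0 < ε ∧
      U = smoothMapNbhd I I' f φ ψ K r ε}

/-- Two maps are right-left equivalent if they differ by smooth diffeomorphisms of the source and
of the target. -/
def RightLeftEquivalent (f g : M → N) : Prop :=
  ∃ (h : M ≃ₘ⟮I, I⟯ M) (k : N ≃ₘ⟮I', I'⟯ N), ∀ p, k (f p) = g (h p)

/-- A smooth map from a compact manifold is stable if all smooth maps in some `C^∞`-neighbourhood
of it are right-left equivalent to it. -/
def IsStableMap [I.Boundaryless] [CompactSpace M] (f : C^∞⟮I, M; I', N⟯) : Prop :=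
  ∃ U : Set C^∞⟮I, M; I', N⟯, IsOpen[smoothMapTopology I I'] U ∧ f ∈ U ∧
    ∀ g ∈ U, RightLeftEquivalent I I' f g

/-- A singular point of a map between manifolds: the differential is not onto. -/
def IsSingularAt (f : M → N) (p : M) : Prop :=
  ¬ Function.Surjective (mfderiv I I' f p)

/-- Smooth local coordinates with values in `ℝ²`. -/
def IsSmoothPlaneChart (φ : OpenPartialHomeomorph M (ℝ × ℝ)) : Prop :=
  ContMDiffOn I 𝓘(ℝ, ℝ × ℝ) ∞ φ φ.source ∧ ContMDiffOn 𝓘(ℝ, ℝ × ℝ) I ∞ φ.symm φ.target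

/-- In suitable smooth local coordinates centred at `p` and at `f p`, the map `f` of surfaces is
given by `F : ℝ² → ℝ²`. -/
def HasNormalFormAt (f : M → N) (p : M) (F : ℝ × ℝ → ℝ × ℝ) : Prop :=
  ∃ (φ : OpenPartialHomeomorph M (ℝ × ℝ)) (ψ : OpenPartialHomeomorph N (ℝ × ℝ)),
    IsSmoothPlaneChart I φ ∧ IsSmoothPlaneChart I' ψ ∧
    p ∈ φ.source ∧ φ p = 0 ∧ f p ∈ ψ.source ∧ ψ (f p) = 0 ∧
    ∀ q ∈ φ.source, f q ∈ ψ.source ∧ ψ (f q) = F (φ q)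

/-- Whitney fold: `(x, y) ↦ (x, y²)` in suitable local coordinates. -/
def IsFoldAt (f : M → N) (p : M) : Prop :=
  HasNormalFormAt I I' f p fun v => (v.1, v.2 ^ 2)

/-- Whitney cusp: `(x, y) ↦ (x, y³ + x y)` in suitable local coordinates. -/
def IsCuspAt (f : M → N) (p : M) : Prop :=
  HasNormalFormAt I I' f p fun v => (v.1, v.2 ^ 3 + v.1 * v.2)

end SmoothMaps

/-! ### Planar robot 3-arms, their moduli spaces and the cross-ratio -/

/-- A planar robot 3-arm: the triple `(a, b, c)` of its positive side-lengths. The space of all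
3-arms carries the topology of the open octant of `ℝ³`. -/
abbrev RobotArm : Type := {l : Fin 3 → ℝ // ∀ i, 0 < l i}

namespace RobotArm

/-- The genericity condition on the side-lengths: they are pairwise distinct, and
none of them is the sum of the other two. -/
def IsGeneric (A : RobotArm) : Prop :=
  A.1 0 ≠ A.1 1 ∧ A.1 1 ≠ A.1 2 ∧ A.1 0 ≠ A.1 2 ∧
    A.1 0 ≠ A.1 1 + A.1 2 ∧ A.1 1 ≠ A.1 0 + A.1 2 ∧ A.1 2 ≠ A.1 0 + A.1 1

/-- The planar realizations of the arm: vertices `v₁, v₂, v₃, v₄` (here `v 0, …, v 3`) in `ℂ` with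
the prescribed distances of consecutive vertices. -/
abbrev Config (A : RobotArm) : Type :=
  {v : Fin 4 → ℂ // ∀ i : Fin 3, ‖v i.succ - v i.castSucc‖ = A.1 i}

/-- Two realizations are identified if an orientation preserving isometry `z ↦ u z + w`, `|u| = 1`,
of the plane maps one to the other. -/
def configSetoid (A : RobotArm) : Setoid A.Config where
  r v v' := ∃ (u : Circle) (w : ℂ), ∀ i, v'.1 i = (u : ℂ) * v.1 i + w
  iseqv :=
    { refl := fun v => ⟨1, 0, fun i => by simp⟩
      symm := by
        rintro v v' ⟨u, w, h⟩
        refine ⟨u⁻¹, -((u⁻¹ : Circle) : ℂ) * w, fun i => ?_⟩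
        rw [h i, Circle.coe_inv]
        field_simp [Circle.coe_ne_zero u]
        ring
      trans := by
        rintro v v' v'' ⟨u, w, h⟩ ⟨u', w', h'⟩
        refine ⟨u' * u, (u' : ℂ) * w + w', fun i => ?_⟩
        rw [h' i, h i, Circle.coe_mul]
        ring }

/-- The planar moduli space `M(A)` of the arm, with the quotient topology. -/
def Moduli (A : RobotArm) : Type := Quotient A.configSetoid

instance (A : RobotArm) : TopologicalSpace A.Moduli :=
  inferInstanceAs (TopologicalSpace (Quotient A.configSetoid))

/-- The realization with vertices `0`, `a`, `a + b x`, `a + b x + c y`, where `x = e^{iφ}` and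
`y = e^{iη}`. -/
def torusConfig (A : RobotArm) (p : Circle × Circle) : A.Config :=
  ⟨![0, (A.1 0 : ℂ), A.1 0 + A.1 1 * (p.1 : ℂ), A.1 0 + A.1 1 * (p.1 : ℂ) + A.1 2 * (p.2 : ℂ)], by
    have h0 := A.2 0
    have h1 := A.2 1
    have h2 := A.2 2
    intro i
    fin_cases i
    · simp [abs_of_pos h0]
    · simp [abs_of_pos h1, Circle.norm_coe p.1]
    · simp [abs_of_pos h2, Circle.norm_coe p.2]⟩

/-- The direction of the `i`-th side of a realization, as a unit complex number. -/
def side (A : RobotArm) (v : A.Config) (i : Fin 3) : Circle :=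
  ⟨(v.1 i.succ - v.1 i.castSucc) / A.1 i, by
    rw [Submonoid.unitSphere, Submonoid.mem_mk]
    simp [v.2 i, abs_of_pos (A.2 i), (A.2 i).ne']⟩

theorem coe_side (A : RobotArm) (v : A.Config) (i : Fin 3) :
    (A.side v i : ℂ) = (v.1 i.succ - v.1 i.castSucc) / A.1 i := rfl

theorem continuous_side (A : RobotArm) (i : Fin 3) : Continuous fun v => A.side v i := by
  refine Continuous.subtype_mk (Continuous.div_const ?_ _) _
  exact ((continuous_apply _).comp continuous_subtype_val).sub
    ((continuous_apply _).comp continuous_subtype_val)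

/-- The moduli space of the arm is the torus: the angles `(e^{iφ}, e^{iη})` of the second and third
sides relative to the first one are global coordinates on it. -/
def torusHomeo (A : RobotArm) : Circle × Circle ≃ₜ A.Moduli where
  toFun p := Quotient.mk A.configSetoid (A.torusConfig p)
  invFun := Quotient.lift (s := A.configSetoid)
    (fun v => (A.side v 1 / A.side v 0, A.side v 2 / A.side v 0)) (by
      rintro v v' ⟨u, w, h⟩
      have key : ∀ i, A.side v' i = u * A.side v i := by
        intro i
        ext
        rw [Circle.coe_mul, coe_side, coe_side, h, h]
        ring
      simp only [key, mul_div_mul_left_eq_div])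
  left_inv p := by
    have h (i) : (A.1 i : ℂ) ≠ 0 := Complex.ofReal_ne_zero.2 (A.2 i).ne'
    have s0 : A.side (A.torusConfig p) 0 = 1 := by
      ext
      simp [coe_side, torusConfig, h]
    have s1 : A.side (A.torusConfig p) 1 = p.1 := by
      ext
      simp [coe_side, torusConfig, h]
    have s2 : A.side (A.torusConfig p) 2 = p.2 := by
      ext
      simp [coe_side, torusConfig, h]
    change (A.side (A.torusConfig p) 1 / A.side (A.torusConfig p) 0,
      A.side (A.torusConfig p) 2 / A.side (A.torusConfig p) 0) = p
    rw [s0, s1, s2, div_one, div_one]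
  right_inv x := by
    induction x using Quotient.inductionOn with
    | h v =>
      refine Quotient.sound (s := A.configSetoid) ⟨A.side v 0, v.1 0, fun i => ?_⟩
      have h (i) : (A.1 i : ℂ) ≠ 0 := Complex.ofReal_ne_zero.2 (A.2 i).ne'
      have e0 : (A.1 0 : ℂ) * A.side v 0 = v.1 1 - v.1 0 := mul_div_cancel₀ _ (h 0)
      have e1 : (A.1 1 : ℂ) * A.side v 1 = v.1 2 - v.1 1 := mul_div_cancel₀ _ (h 1)
      have e2 : (A.1 2 : ℂ) * A.side v 2 = v.1 3 - v.1 2 := mul_div_cancel₀ _ (h 2)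
      have hs := Circle.coe_ne_zero (A.side v 0)
      have d1 : (A.side v 0 : ℂ) * ((A.side v 1 / A.side v 0 : Circle) : ℂ) = A.side v 1 := by
        rw [Circle.coe_div]; field_simp
      have d2 : (A.side v 0 : ℂ) * ((A.side v 2 / A.side v 0 : Circle) : ℂ) = A.side v 2 := by
        rw [Circle.coe_div]; field_simp
      fin_cases i
      · simp [torusConfig]
      · simp [torusConfig]
        linear_combination -e0
      · simp [torusConfig, -Circle.coe_div]
        linear_combination -e0 - e1 - (A.1 1 : ℂ) * d1
      · simp [torusConfig, -Circle.coe_div]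
        linear_combination -e0 - e1 - e2 - (A.1 1 : ℂ) * d1 - (A.1 2 : ℂ) * d2
  continuous_toFun := by
    refine continuous_quotient_mk'.comp (Continuous.subtype_mk (continuous_pi fun i => ?_) _)
    fin_cases i
    · exact continuous_const
    · exact continuous_const
    · simp; fun_prop
    · simp; fun_prop
  continuous_invFun := by
    refine Continuous.quotient_lift ?_ _
    exact ((A.continuous_side 1).div' (A.continuous_side 0)).prodMk
      ((A.continuous_side 2).div' (A.continuous_side 0))

end RobotArm

open Classical in
/-- The cross-ratio `[p, q; z, w] = ((z - p) / (z - q)) : ((w - p) / (w - q))` of four points of the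
plane, no three of which coincide, as a point of the Riemann sphere. -/
def crossRatio (p q z w : ℂ) : OnePoint ℂ :=
  if (z - q) * (w - p) = 0 then OnePoint.infty
  else (((z - p) * (w - q) / ((z - q) * (w - p)) : ℂ) : OnePoint ℂ)

/-- The cross-ratio map `M(A) → ℂ ∪ {∞}`, `[v] ↦ [v₁, v₂; v₃, v₄]`. -/
def RobotArm.crossRatioMap (A : RobotArm) : A.Moduli → OnePoint ℂ :=
  Quotient.lift (s := A.configSetoid) (fun v => crossRatio (v.1 0) (v.1 1) (v.1 2) (v.1 3)) (by
    rintro v v' ⟨u, w, h⟩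
    have hu := Circle.coe_ne_zero u
    have key : ∀ i j, v'.1 i - v'.1 j = u * (v.1 i - v.1 j) := by
      intro i j
      rw [h, h]
      ring
    simp only [crossRatio, key]
    have e1 : (u : ℂ) * (v.1 2 - v.1 1) * (u * (v.1 3 - v.1 0)) =
        (u * u) * ((v.1 2 - v.1 1) * (v.1 3 - v.1 0)) := by ring
    have e2 : (u : ℂ) * (v.1 2 - v.1 0) * (u * (v.1 3 - v.1 1)) =
        (u * u) * ((v.1 2 - v.1 0) * (v.1 3 - v.1 1)) := by ring
    rw [e1, e2, mul_div_mul_left _ _ (mul_ne_zero hu hu)]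
    simp only [mul_eq_zero, hu, false_or, or_self])

/-- The cross-ratio map in the angle coordinates on the torus `M(A)`. -/
def RobotArm.torusCrossRatio (A : RobotArm) : Circle × Circle → OnePoint ℂ :=
  A.crossRatioMap ∘ A.torusHomeo

end

/-! Let x, y be the directions of the second and third sides and w = a + bx + cy the last vertex.
Then Cr − 1 = acy/(bxw), so Cr omits the value 1. In the coordinate (ac/b)/(ζ − 1), a chart from the
sphere minus 1 onto ℂ, it becomes the map (u, v) ↦ z = cu + av + buv with u = x, v = x/y.

Given z and u, the equation z − cu = v(a + bu) has a unimodular solution v exactly when |z − cu| =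
|a + bu|, that is, Re(uP) = K with P = ab + c z̄ and K = (|z|² + c² − a² − b²)/2. Since |uP| = |P|,
only the sign of h = Im(uP) stays free, and h² = |P|² − K² =: D(z). For pairwise distinct lengths, P
≠ 0 wherever D ≥ 0, a + bu never vanishes, and 0 is a regular value of D. Hence (z, h) embeds the
torus onto the surface S: h² = D(z) in ℂ × ℝ (`embed_retract`, `retract_embed`), and Cr is the
projection of S to the plane: the double of {D ≥ 0}, folded along D = 0. Using D as a coordinate
below and h as one above gives the folds (`isFoldAt`). Fibres have at most two points
(`IsGeneric.fibre`), while a cusp has nearby fibres with three.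

For stability, a map g near Cr is read in the chart as z + e on S. Extended by a retraction and a
cutoff, e is C²-small, Ψ(z, h) = (z + e, h) is a diffeomorphism of ℂ × ℝ, and g becomes the
projection of Ψ(S). The equation of Ψ(S) is F = h² − D + R = 0 with small R. As F is uniformly
convex in h, a Morse lemma with parameters turns it into Y² = D + R₁ with R₁ C¹-small and compactly
supported (`exists_sq_of_uniformly_convex`). Regularity of D then gives a compactly supported
diffeomorphism κ and ρ > 0 with D + R₁ = ρ · (D ∘ κ) (`exists_levelSet_equiv`). So Λ(z, h) = (κ z,
Y/√ρ) carries Ψ(S) to S over κ (`exists_fibred_equiv`), and Λ ∘ Ψ on S together with κ on the sphere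
gives the equivalence. -/

/-! ### Global diffeomorphisms close to the identity -/

section GlobalInverse

variable {E : Type*} [NormedAddCommGroup E] [NormedSpace ℝ E] [CompleteSpace E]

/-- A smooth bijection with invertible differentials has a smooth inverse. -/
theorem Equiv.contDiff_symm_of_hasFDerivAt (Φ : E ≃ E) (hΦ : ContDiff ℝ ∞ Φ)
    (h : ∀ x, ∃ A : E ≃L[ℝ] E, HasFDerivAt Φ (A : E →L[ℝ] E) x) : ContDiff ℝ ∞ Φ.symm := by
  choose A hA using h
  -- The inverse function theorem makes `Φ` open, so the set-theoretic inverse is continuous; only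
  -- then does smoothness of the inverse follow pointwise.
  have hopen : IsOpenMap Φ := by
    rw [isOpenMap_iff_nhds_le]
    intro x
    exact ((hΦ.contDiffAt.hasStrictFDerivAt' (hA x) (by simp)).map_nhds_eq_of_equiv).ge
  exact (Φ.toHomeomorphOfContinuousOpen hΦ.continuous hopen).contDiff_symm hA hΦ

/-- A map whose difference from the identity has small differential is a diffeomorphism. -/
theorem exists_equiv_add_of_fderiv_le {e : E → E} (he : ContDiff ℝ ∞ e)
    (hb : ∀ x, ‖fderiv ℝ e x‖ ≤ 1 / 2) :
    ∃ Φ : E ≃ E, ContDiff ℝ ∞ Φ ∧ ContDiff ℝ ∞ Φ.symm ∧ ∀ x, Φ x = x + e x := by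
  have hd : Differentiable ℝ e := he.differentiable (by simp)
  have hΦ : ContDiff ℝ ∞ (fun x => x + e x) := contDiff_id.add he
  -- The difference from the identity is 1/2-Lipschitz on the whole space, which yields a global
  -- bijection and not only a local one.
  have happ : ApproximatesLinearOn (fun x => x + e x)
      ((ContinuousLinearEquiv.refl ℝ E : E ≃L[ℝ] E) : E →L[ℝ] E) Set.univ (1 / 2) := by
    rw [ApproximatesLinearOn.approximatesLinearOn_iff_lipschitzOnWith, lipschitzOnWith_univ]
    have : (fun x => x + e x) - ⇑((ContinuousLinearEquiv.refl ℝ E : E ≃L[ℝ] E) : E →L[ℝ] E)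
        = e := by
      ext x; simp
    rw [this]
    refine lipschitzWith_of_nnnorm_fderiv_le hd fun x => ?_
    rw [← NNReal.coe_le_coe]
    simpa using hb x
  have hc : Subsingleton E ∨ (1 / 2 : NNReal) <
      ‖((ContinuousLinearEquiv.refl ℝ E).symm : E →L[ℝ] E)‖₊⁻¹ := by
    rcases subsingleton_or_nontrivial E with h | h
    · exact Or.inl h
    · right
      have : ‖((ContinuousLinearEquiv.refl ℝ E).symm : E →L[ℝ] E)‖₊ = 1 := by
        have : ((ContinuousLinearEquiv.refl ℝ E).symm : E →L[ℝ] E)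
          = ContinuousLinearMap.id ℝ E := rfl
        rw [this]
        simp
      rw [this, inv_one]
      exact NNReal.half_lt_self one_ne_zero
  let Φ : E ≃ E := (happ.toHomeomorph _ hc).toEquiv
  refine ⟨Φ, hΦ, Φ.contDiff_symm_of_hasFDerivAt hΦ fun x => ?_, fun x => rfl⟩
  have hlt : ‖-fderiv ℝ e x‖ < 1 := by
    rw [norm_neg]; exact (hb x).trans_lt (by norm_num)
  -- The differential 1 + e′ is invertible by the Neumann series.
  refine ⟨ContinuousLinearEquiv.unitsEquiv ℝ E (Units.oneSub (-fderiv ℝ e x) hlt), ?_⟩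
  refine ((hasFDerivAt_id x).add (hd x).hasFDerivAt).congr_fderiv ?_
  ext v
  simp [ContinuousLinearMap.one_def]

end GlobalInverse

/-! ### Diffeomorphisms of V × ℝ over the identity of V -/

section Triangular

variable {V : Type*} [NormedAddCommGroup V] [NormedSpace ℝ V]

theorem HasFDerivAt.hasDerivAt_snd {Y : V × ℝ → ℝ} {z : V} {y : ℝ} {A : V × ℝ →L[ℝ] ℝ}
    (h : HasFDerivAt Y A (z, y)) : HasDerivAt (fun t => Y (z, t)) (A (0, 1)) y :=
  h.comp_hasDerivAt y ((hasDerivAt_const y z).prodMk (hasDerivAt_id y))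

/-- If the derivative in the last variable is at least `c > 0`, the fibres are mapped onto `ℝ`. -/
theorem surjective_of_le_fderiv {Y : V × ℝ → ℝ} (hY : Differentiable ℝ Y) {c : ℝ} (hc : 0 < c)
    (hpos : ∀ x, c ≤ fderiv ℝ Y x (0, 1)) (z : V) : Function.Surjective fun y => Y (z, y) := by
  have hder : ∀ y, HasDerivAt (fun t => Y (z, t)) (fderiv ℝ Y (z, y) (0, 1)) y := fun y =>
    (hY (z, y)).hasFDerivAt.hasDerivAt_snd
  have hcont : Continuous fun y => Y (z, y) :=
    continuous_iff_continuousAt.2 fun y => (hder y).continuousAt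
  -- Subtracting c·y leaves a nondecreasing function, so `Y` grows at least linearly in both
  -- directions.
  have hmono : Monotone fun y => Y (z, y) - c * y := by
    refine monotone_of_deriv_nonneg
      (fun y => ((hder y).sub ((hasDerivAt_id y).const_mul c)).differentiableAt) fun y => ?_
    have h : HasDerivAt (fun y => Y (z, y) - c * y) (fderiv ℝ Y (z, y) (0, 1) - c * 1) y :=
      (hder y).fun_sub ((hasDerivAt_id' y).const_mul c)
    rw [h.deriv]
    linarith [hpos (z, y)]
  refine hcont.surjective ?_ ?_
  · refine Filter.tendsto_atTop_mono' _ ?_ (Filter.tendsto_atTop_add_const_left _ (Y (z, 0))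
      (Filter.tendsto_id.const_mul_atTop hc))
    filter_upwards [Filter.eventually_ge_atTop 0] with y hy
    have := hmono hy
    simp at this ⊢
    linarith
  · refine Filter.tendsto_atBot_mono' _ ?_ (Filter.tendsto_atBot_add_const_left _ (Y (z, 0))
      (Filter.tendsto_id.const_mul_atBot hc))
    filter_upwards [Filter.eventually_le_atBot 0] with y hy
    have := hmono hy
    simp at this ⊢
    linarith

variable [CompleteSpace V]

/-- A smooth function on `V × ℝ` which is an increasing bijection in the second variable
is the second component of a fibred diffeomorphism. -/
theorem exists_equiv_triangular {Y : V × ℝ → ℝ} (hY : ContDiff ℝ ∞ Y)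
    (hpos : ∀ x, 0 < fderiv ℝ Y x (0, 1)) (hsurj : ∀ z, Function.Surjective fun y => Y (z, y)) :
    ∃ Φ : V × ℝ ≃ V × ℝ, ContDiff ℝ ∞ Φ ∧ ContDiff ℝ ∞ Φ.symm ∧ ∀ x, Φ x = (x.1, Y x) := by
  have hd : Differentiable ℝ Y := hY.differentiable (by simp)
  have hmono : ∀ z, StrictMono fun y => Y (z, y) := fun z =>
    strictMono_of_deriv_pos fun y => by
      rw [((hd (z, y)).hasFDerivAt.hasDerivAt_snd).deriv]
      exact hpos _
  have hbij : Function.Bijective fun x : V × ℝ => (x.1, Y x) := by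
    constructor
    · rintro ⟨z, y⟩ ⟨z', y'⟩ h
      obtain ⟨rfl, h2⟩ := Prod.mk.inj h
      rw [(hmono z).injective h2]
    · rintro ⟨z, y⟩
      obtain ⟨y', h⟩ := hsurj z y
      exact ⟨(z, y'), Prod.ext rfl h⟩
  let Φ : V × ℝ ≃ V × ℝ := Equiv.ofBijective _ hbij
  have hΦ : ContDiff ℝ ∞ Φ := contDiff_fst.prodMk hY
  refine ⟨Φ, hΦ, Φ.contDiff_symm_of_hasFDerivAt hΦ fun x => ?_, fun x => rfl⟩
  set A := fderiv ℝ Y x with hA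
  have hne : A (0, 1) ≠ 0 := (hpos x).ne'
  have hAdd : ∀ (v : V) (t : ℝ), A (v, t) = A (v, 0) + t * A (0, 1) := fun v t => by
    have : ((v, t) : V × ℝ) = (v, 0) + t • (0, 1) := by simp
    rw [this, map_add, map_smul, smul_eq_mul]
  -- The differential (v, t) ↦ (v, A(v, t)) is triangular, with inverse (v, t) ↦ (v, (t − A(v, 0)) /
  -- A(0, 1)).
  let B : (V × ℝ) ≃L[ℝ] (V × ℝ) := ContinuousLinearEquiv.equivOfInverse
    ((ContinuousLinearMap.fst ℝ V ℝ).prod A)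
    ((ContinuousLinearMap.fst ℝ V ℝ).prod ((A (0, 1))⁻¹ • (ContinuousLinearMap.snd ℝ V ℝ -
      A.comp ((ContinuousLinearMap.inl ℝ V ℝ).comp (ContinuousLinearMap.fst ℝ V ℝ)))))
    (by
      rintro ⟨v, t⟩
      simp only [ContinuousLinearMap.prod_apply, ContinuousLinearMap.coe_fst', Prod.mk.injEq,
        true_and, smul_apply, sub_apply,
        ContinuousLinearMap.coe_snd', ContinuousLinearMap.comp_apply,
        ContinuousLinearMap.inl_apply, smul_eq_mul, hAdd v t]
      field_simp
      ring)
    (by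
      rintro ⟨v, t⟩
      simp only [ContinuousLinearMap.prod_apply, ContinuousLinearMap.coe_fst', Prod.mk.injEq,
        true_and, smul_apply, sub_apply,
        ContinuousLinearMap.coe_snd', ContinuousLinearMap.comp_apply,
        ContinuousLinearMap.inl_apply, smul_eq_mul, hAdd v (_ * _)]
      field_simp
      ring)
  exact ⟨B, hasFDerivAt_fst.prodMk (hd x).hasFDerivAt⟩

end Triangular

/-! ### Hadamard's lemma with parameters -/

section Hadamard

variable {E : Type*} [NormedAddCommGroup E] [NormedSpace ℝ E] [FiniteDimensional ℝ E]

theorem hasFDerivAt_intervalIntegral_of_contDiff {H : E × ℝ → ℝ} (hH : ContDiff ℝ 1 H) (z : E) :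
    HasFDerivAt (fun z => ∫ t in (0 : ℝ)..1, H (z, t))
      (∫ t in (0 : ℝ)..1, (fderiv ℝ H (z, t)).comp (ContinuousLinearMap.inl ℝ E ℝ)) z := by
  have := FiniteDimensional.proper ℝ E
  have hcH : Continuous H := hH.continuous
  have hcd : Continuous fun x : E × ℝ =>
      (fderiv ℝ H x).comp (ContinuousLinearMap.inl ℝ E ℝ) :=
    (hH.continuous_fderiv (by simp)).clm_comp continuous_const
  obtain ⟨C, hC⟩ := ((isCompact_closedBall z 1).prod (isCompact_Icc (a := (0 : ℝ)) (b := 1))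
    ).exists_bound_of_continuousOn hcd.continuousOn
  refine intervalIntegral.hasFDerivAt_integral_of_dominated_of_fderiv_le
    (F := fun z t => H (z, t)) (bound := fun _ => C)
    (F' := fun z t => (fderiv ℝ H (z, t)).comp (ContinuousLinearMap.inl ℝ E ℝ))
    (Metric.ball_mem_nhds z one_pos) ?_ ?_ ?_ ?_ ?_ ?_
  · exact Filter.Eventually.of_forall fun w =>
      (hcH.comp (continuous_const.prodMk continuous_id)).aestronglyMeasurable
  · exact (hcH.comp (continuous_const.prodMk continuous_id)).intervalIntegrable _ _
  · exact (hcd.comp (continuous_const.prodMk continuous_id)).aestronglyMeasurable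
  · refine Filter.Eventually.of_forall fun t ht w hw => hC (w, t) ⟨Metric.ball_subset_closedBall hw, ?_⟩
    rw [Set.uIoc_of_le zero_le_one] at ht
    exact Set.Ioc_subset_Icc_self ht
  · exact intervalIntegrable_const
  · refine Filter.Eventually.of_forall fun t ht w hw => ?_
    have h1 := (hH.differentiable (by simp) (w, t)).hasFDerivAt
    exact h1.comp w ((hasFDerivAt_id w).prodMk (hasFDerivAt_const t w))

/-- Induction on the order of differentiability: a directional derivative of the integral is an
integral of the same form. Testing on fixed vectors, which suffices in finite dimension, keeps the
integrands scalar. -/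
theorem ContDiff.intervalIntegral_right {H : E × ℝ → ℝ} (hH : ContDiff ℝ ∞ H) :
    ContDiff ℝ ∞ fun z => ∫ t in (0 : ℝ)..1, H (z, t) := by
  rw [contDiff_infty]
  intro n
  induction n generalizing H with
  | zero =>
    rw [Nat.cast_zero, contDiff_zero]
    exact continuous_iff_continuousAt.2 fun z =>
      (hasFDerivAt_intervalIntegral_of_contDiff (hH.of_le (by simp)) z).continuousAt
  | succ n ih =>
    have hcd : Continuous fun x : E × ℝ =>
        (fderiv ℝ H x).comp (ContinuousLinearMap.inl ℝ E ℝ) :=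
      (hH.continuous_fderiv (by simp)).clm_comp continuous_const
    rw [Nat.cast_succ, contDiff_succ_iff_fderiv_apply]
    have hF := hasFDerivAt_intervalIntegral_of_contDiff (hH.of_le (by simp) : ContDiff ℝ 1 H)
    refine ⟨fun z => (hF z).differentiableAt, by simp, fun v => ?_⟩
    have heq : (fun z => fderiv ℝ (fun z => ∫ t in (0 : ℝ)..1, H (z, t)) z v) =
        fun z => ∫ t in (0 : ℝ)..1, fderiv ℝ H (z, t) (v, 0) := by
      ext z
      rw [(hF z).fderiv, ContinuousLinearMap.intervalIntegral_apply]
      · simp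
      · exact (hcd.comp (continuous_const.prodMk continuous_id)).intervalIntegrable _ _
    rw [heq]
    exact ih ((hH.fderiv_right (m := ∞) (by simp)).clm_apply contDiff_const)

/-- Hadamard's lemma with parameters. -/
theorem ContDiff.exists_eq_mul_of_eq_zero {f : E × ℝ → ℝ} (hf : ContDiff ℝ ∞ f)
    (h0 : ∀ z, f (z, 0) = 0) :
    ∃ g : E × ℝ → ℝ, ContDiff ℝ ∞ g ∧ (∀ z y, f (z, y) = y * g (z, y)) ∧
      ∀ z, g (z, 0) = fderiv ℝ f (z, 0) (0, 1) := by
  have hd : Differentiable ℝ f := hf.differentiable (by simp)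
  have hfd : ContDiff ℝ ∞ fun x => fderiv ℝ f x (0, 1) :=
    (hf.fderiv_right (m := ∞) (by simp)).clm_apply contDiff_const
  -- The quotient is the mean of the fibre derivative over the segment from 0 to y, by the
  -- fundamental theorem of calculus along t ↦ f (z, t y).
  refine ⟨fun x => ∫ t in (0 : ℝ)..1, fderiv ℝ f (x.1, t * x.2) (0, 1), ?_, ?_, ?_⟩
  · have : ContDiff ℝ ∞ fun q : (E × ℝ) × ℝ => fderiv ℝ f (q.1.1, q.2 * q.1.2) (0, 1) :=
      hfd.comp (by fun_prop : ContDiff ℝ ∞ fun q : (E × ℝ) × ℝ => (q.1.1, q.2 * q.1.2))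
    exact this.intervalIntegral_right
  · intro z y
    have hder : ∀ t ∈ Set.uIcc (0 : ℝ) 1, HasDerivAt (fun t => f (z, t * y))
        (y * fderiv ℝ f (z, t * y) (0, 1)) t := fun t _ => by
      have h1 := (hd (z, t * y)).hasFDerivAt.hasDerivAt_snd
      have h2 : HasDerivAt (fun t => f (z, t * y)) (fderiv ℝ f (z, t * y) (0, 1) * (1 * y)) t :=
        HasDerivAt.comp (h₂ := fun t => f (z, t)) t h1 ((hasDerivAt_id' t).mul_const y)
      exact h2.congr_deriv (by ring)
    have hint := intervalIntegral.integral_eq_sub_of_hasDerivAt hder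
      ((continuous_const.mul (hfd.continuous.comp (by fun_prop))).intervalIntegrable _ _)
    rw [intervalIntegral.integral_const_mul] at hint
    simpa [h0] using hint.symm
  · intro z
    simp

end Hadamard

/-! ### Morse lemma for families of convex functions -/

section MorseFamily

variable {V : Type*} [NormedAddCommGroup V] [NormedSpace ℝ V] [FiniteDimensional ℝ V]

/-- Morse lemma for a family of uniformly convex functions of one variable. -/
theorem exists_sq_of_uniformly_convex {F : V × ℝ → ℝ} (hF : ContDiff ℝ ∞ F)
    (hconv : ∀ x, 1 ≤ fderiv ℝ (fun x => fderiv ℝ F x (0, 1)) x (0, 1)) :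
    ∃ (s : V → ℝ) (Y : V × ℝ → ℝ), ContDiff ℝ ∞ s ∧ ContDiff ℝ ∞ Y ∧
      (∀ z, fderiv ℝ F (z, s z) (0, 1) = 0) ∧ (∀ x, 0 < fderiv ℝ Y x (0, 1)) ∧
      (∀ z, Function.Surjective fun y => Y (z, y)) ∧
      ∀ z y, F (z, y) = F (z, s z) + Y (z, y) ^ 2 := by
  have := FiniteDimensional.complete ℝ V
  set F' : V × ℝ → ℝ := fun x => fderiv ℝ F x (0, 1) with hF'
  have hF's : ContDiff ℝ ∞ F' := (hF.fderiv_right (m := ∞) (by simp)).clm_apply contDiff_const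
  have hFd : Differentiable ℝ F := hF.differentiable (by simp)
  have hF'd : Differentiable ℝ F' := hF's.differentiable (by simp)
  have hF1 : ∀ z y, HasDerivAt (fun t => F (z, t)) (F' (z, y)) y := fun z y =>
    (hFd (z, y)).hasFDerivAt.hasDerivAt_snd
  have hF2 : ∀ z y, HasDerivAt (fun t => F' (z, t)) (fderiv ℝ F' (z, y) (0, 1)) y := fun z y =>
    (hF'd (z, y)).hasFDerivAt.hasDerivAt_snd
  -- The fibre derivative `F'` has slope at least 1, so it is itself a fibred coordinate. Its zero
  -- `s z`, the fibrewise minimum of F, is therefore unique and smooth in z.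
  obtain ⟨Φ, hΦ, hΦs, hΦe⟩ := exists_equiv_triangular hF's
    (fun x => one_pos.trans_le (hconv x)) (surjective_of_le_fderiv hF'd one_pos hconv)
  set s : V → ℝ := fun z => (Φ.symm (z, 0)).2 with hs
  have hss : ContDiff ℝ ∞ s := contDiff_snd.comp (hΦs.comp (contDiff_id.prodMk contDiff_const))
  have hs0 : ∀ z, F' (z, s z) = 0 := fun z => by
    have h := Φ.apply_symm_apply (z, 0)
    rw [hΦe] at h
    have h1 : (Φ.symm (z, 0)).1 = z := congrArg Prod.fst h
    have h2 := congrArg Prod.snd h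
    have h3 : Φ.symm (z, 0) = (z, s z) := Prod.ext h1 rfl
    rw [h3] at h2
    exact h2
  have hmono : ∀ z, Monotone fun y => F' (z, y) - y := fun z => by
    have h : ∀ y, HasDerivAt (fun y => F' (z, y) - y) (fderiv ℝ F' (z, y) (0, 1) - 1) y :=
      fun y => (hF2 z y).fun_sub (hasDerivAt_id' y)
    refine monotone_of_deriv_nonneg (fun y => (h y).differentiableAt) fun y => ?_
    rw [(h y).deriv]
    linarith [hconv (z, y)]
  -- Quadratic growth away from the minimum; it bounds the quotient of F(z, y) − F(z, s z) by (y − s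
  -- z)² from below by 1/2, so that its square root is smooth.
  have hquad : ∀ z y, (y - s z) ^ 2 / 2 ≤ F (z, y) - F (z, s z) := fun z y => by
    have h : ∀ y, HasDerivAt (fun y => F (z, y) - (y - s z) ^ 2 / 2)
        (F' (z, y) - (y - s z)) y := fun y =>
      (((hF1 z y).fun_sub ((((hasDerivAt_id' y).sub_const (s z)).fun_pow 2).div_const 2)
        )).congr_deriv (by simp)
    have hcont : Continuous fun y => F (z, y) - (y - s z) ^ 2 / 2 :=
      continuous_iff_continuousAt.2 fun y => (h y).continuousAt
    have hz := hs0 z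
    rcases le_total (s z) y with hy | hy
    · have hm : MonotoneOn (fun y => F (z, y) - (y - s z) ^ 2 / 2) (Set.Ici (s z)) := by
        refine monotoneOn_of_deriv_nonneg (convex_Ici _) hcont.continuousOn
          (fun y _ => (h y).differentiableAt.differentiableWithinAt) fun y hy => ?_
        rw [interior_Ici] at hy
        rw [(h y).deriv]
        have := hmono z (le_of_lt hy)
        simp only at this
        linarith
      have := hm Set.self_mem_Ici hy hy
      simp only [sub_self] at this
      linarith
    · have hm : AntitoneOn (fun y => F (z, y) - (y - s z) ^ 2 / 2) (Set.Iic (s z)) := by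
        refine antitoneOn_of_deriv_nonpos (convex_Iic _) hcont.continuousOn
          (fun y _ => (h y).differentiableAt.differentiableWithinAt) fun y hy => ?_
        rw [interior_Iic] at hy
        rw [(h y).deriv]
        have := hmono z (le_of_lt hy)
        simp only at this
        linarith
      have := hm hy Set.self_mem_Iic hy
      simp only [sub_self] at this
      linarith
  -- division by `y ^ 2`
  set P : V × ℝ → ℝ := fun x => F (x.1, s x.1 + x.2) - F (x.1, s x.1) with hP
  have hPs : ContDiff ℝ ∞ P :=
    (hF.comp (contDiff_fst.prodMk ((hss.comp contDiff_fst).add contDiff_snd))).sub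
      (hF.comp (contDiff_fst.prodMk (hss.comp contDiff_fst)))
  obtain ⟨f₁, hf₁, hf₁e, hf₁0⟩ := hPs.exists_eq_mul_of_eq_zero (fun z => by simp [hP])
  obtain ⟨f₂, hf₂, hf₂e, -⟩ := hf₁.exists_eq_mul_of_eq_zero (fun z => by
    have h1 : HasDerivAt (fun t => P (z, t)) (fderiv ℝ P (z, 0) (0, 1)) 0 :=
      (hPs.differentiable (by simp) (z, 0)).hasFDerivAt.hasDerivAt_snd
    have h2 : HasDerivAt (fun t => P (z, t)) (F' (z, s z + 0)) 0 :=
      ((hF1 z (s z + 0)).comp_const_add (s z) 0).sub_const (F (z, s z))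
    rw [hf₁0, h1.unique h2, add_zero, hs0])
  have hPf : ∀ z y, P (z, y) = y ^ 2 * f₂ (z, y) := fun z y => by
    rw [hf₁e, hf₂e]; ring
  have hlow : ∀ z y, 1 / 2 ≤ f₂ (z, y) := fun z => by
    have hne : ∀ y ≠ 0, 1 / 2 ≤ f₂ (z, y) := fun y hy => by
      have h := hquad z (s z + y)
      have h2 : F (z, s z + y) - F (z, s z) = y ^ 2 * f₂ (z, y) := hPf z y
      rw [h2] at h
      have hy2 : 0 < y ^ 2 := by positivity
      have h3 : y ^ 2 * (1 / 2) ≤ y ^ 2 * f₂ (z, y) := by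
        calc y ^ 2 * (1 / 2) = (s z + y - s z) ^ 2 / 2 := by ring
          _ ≤ _ := h
      exact le_of_mul_le_mul_left h3 hy2
    have hcl : IsClosed {y | 1 / 2 ≤ f₂ (z, y)} :=
      isClosed_le continuous_const (hf₂.continuous.comp (continuous_const.prodMk continuous_id))
    have hden : Dense ({0}ᶜ : Set ℝ) := dense_compl_singleton 0
    have := hcl.closure_subset_iff.2 (fun y hy => hne y hy : ({0}ᶜ : Set ℝ) ⊆ _)
    rw [hden.closure_eq] at this
    exact fun y => this (Set.mem_univ y)
  set m : V × ℝ → ℝ := fun x => Real.sqrt (f₂ (x.1, x.2 - s x.1)) with hm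
  have hms : ContDiff ℝ ∞ m :=
    (hf₂.comp (contDiff_fst.prodMk (contDiff_snd.sub (hss.comp contDiff_fst)))).sqrt
      fun x => (one_half_pos.trans_le (hlow _ _)).ne'
  have hmlow : ∀ x, Real.sqrt (1 / 2) ≤ m x := fun x => Real.sqrt_le_sqrt (hlow _ _)
  have hhalf : 0 < Real.sqrt (1 / 2) := by positivity
  have hmpos : ∀ x, 0 < m x := fun x => hhalf.trans_le (hmlow x)
  set Y : V × ℝ → ℝ := fun x => (x.2 - s x.1) * m x with hY
  have hYs : ContDiff ℝ ∞ Y := (contDiff_snd.sub (hss.comp contDiff_fst)).mul hms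
  have hYe : ∀ z y, F (z, y) = F (z, s z) + Y (z, y) ^ 2 := fun z y => by
    have h := hPf z (y - s z)
    simp only [hP] at h
    rw [add_sub_cancel] at h
    have h2 : m (z, y) ^ 2 = f₂ (z, y - s z) :=
      Real.sq_sqrt (one_half_pos.le.trans (hlow z (y - s z)))
    simp only [hY]
    rw [mul_pow, h2, ← h]
    ring
  have hYder : ∀ z y, HasDerivAt (fun t => Y (z, t)) (fderiv ℝ Y (z, y) (0, 1)) y := fun z y =>
    (hYs.differentiable (by simp) (z, y)).hasFDerivAt.hasDerivAt_snd
  refine ⟨s, Y, hss, hYs, hs0, ?_, fun z => ?_, hYe⟩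
  · rintro ⟨z, y⟩
    -- Away from the minimum `Y` and `F'` have the same strict sign, so this identity forces a
    -- positive fibre derivative of `Y`; at the minimum that derivative is `m`.
    have hsq : 2 * Y (z, y) * fderiv ℝ Y (z, y) (0, 1) = F' (z, y) := by
      have h1 : HasDerivAt (fun t => F (z, s z) + Y (z, t) ^ 2)
          (2 * Y (z, y) * fderiv ℝ Y (z, y) (0, 1)) y :=
        (((hYder z y).fun_pow 2).const_add _).congr_deriv (by simp)
      have h2 := hF1 z y
      rw [show (fun t => F (z, t)) = fun t => F (z, s z) + Y (z, t) ^ 2 from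
        funext fun t => hYe z t] at h2
      exact h1.unique h2
    have hz := hs0 z
    rcases lt_trichotomy y (s z) with hy | hy | hy
    · have h1 := hmono z hy.le
      simp only at h1
      have h3 : Y (z, y) < 0 := mul_neg_of_neg_of_pos (sub_neg.2 hy) (hmpos _)
      nlinarith
    · subst hy
      have hmd := (hms.differentiable (by simp) (z, s z)).hasFDerivAt.hasDerivAt_snd
      have h1 : HasDerivAt (fun t => Y (z, t)) (m (z, s z)) (s z) :=
        (((hasDerivAt_id' (s z)).sub_const (s z)).fun_mul hmd).congr_deriv (by simp)
      rw [(hYder z (s z)).unique h1]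
      exact hmpos _
    · have h1 := hmono z hy.le
      simp only at h1
      have h3 : 0 < Y (z, y) := mul_pos (sub_pos.2 hy) (hmpos _)
      nlinarith
  · have hcont : Continuous fun y => Y (z, y) :=
      hYs.continuous.comp (continuous_const.prodMk continuous_id)
    refine hcont.surjective ?_ ?_
    · refine Filter.tendsto_atTop_mono' _ ?_ ((Filter.tendsto_atTop_add_const_right _ (-s z)
        Filter.tendsto_id).atTop_mul_const hhalf)
      filter_upwards [Filter.eventually_ge_atTop (s z)] with y hy
      exact mul_le_mul_of_nonneg_left (hmlow _) (by simpa using hy)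
    · refine Filter.tendsto_atBot_mono' _ ?_ ((Filter.tendsto_atBot_add_const_right _ (-s z)
        Filter.tendsto_id).atBot_mul_const hhalf)
      filter_upwards [Filter.eventually_le_atBot (s z)] with y hy
      exact mul_le_mul_of_nonpos_left (hmlow _) (by simpa using hy)

end MorseFamily

/-! ### Truncations and uniform smallness -/

section Cutoff

/-- Smooth bounded truncations of the identity of `ℝ` near `0` with uniformly bounded derivative. -/
theorem exists_truncation : ∃ C : ℝ, 0 < C ∧ ∀ δ : ℝ, 0 < δ → ∃ b : ℝ → ℝ, ContDiff ℝ ∞ b ∧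
    (∀ t, |t| ≤ δ → b t = t) ∧ (∀ t, |b t| ≤ 2 * δ) ∧ ∀ t, |deriv b t| ≤ C := by
  let φ : ContDiffBump (0 : ℝ) := ⟨1, 2, one_pos, one_lt_two⟩
  set b : ℝ → ℝ := fun t => t * φ t with hb
  have hbs : ContDiff ℝ ∞ b := contDiff_id.mul φ.contDiff
  have hsupp : HasCompactSupport b := φ.hasCompactSupport.mul_left
  obtain ⟨C, hC⟩ := hsupp.deriv.exists_bound_of_continuous (hbs.continuous_deriv (by simp))
  -- The rescaling t ↦ δ b(t/δ) does not change the bound on the derivative, so `C` does not depend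
  -- on δ.
  refine ⟨|C| + 1, by positivity, fun δ hδ => ⟨fun t => δ * b (δ⁻¹ * t), ?_, ?_, ?_, ?_⟩⟩
  · exact contDiff_const.mul (hbs.comp (contDiff_const.mul contDiff_id))
  · intro t ht
    have h1 : φ (δ⁻¹ * t) = 1 := φ.one_of_mem_closedBall (by
      rw [mem_closedBall_zero_iff, Real.norm_eq_abs, abs_mul, abs_of_pos (inv_pos.2 hδ)]
      rw [inv_mul_le_iff₀ hδ]
      simpa [show φ.rIn = 1 from rfl] using ht)
    simp only [hb, h1]
    field_simp
  · intro t
    have h1 : |b (δ⁻¹ * t)| ≤ 2 := by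
      rw [hb]
      simp only [abs_mul]
      by_cases h : δ⁻¹ * t ∈ Metric.ball (0 : ℝ) 2
      · rw [mem_ball_zero_iff, Real.norm_eq_abs, abs_mul] at h
        have h2 : |φ (δ⁻¹ * t)| ≤ 1 := by
          rw [abs_of_nonneg φ.nonneg]; exact φ.le_one
        calc _ ≤ 2 * 1 := mul_le_mul h.le h2 (abs_nonneg _) (by norm_num)
          _ = 2 := by norm_num
      · have h2 : φ (δ⁻¹ * t) = 0 := φ.zero_of_le_dist (by
          rw [Metric.mem_ball, not_lt] at h; exact h)
        rw [h2]; simp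
    rw [abs_mul, abs_of_pos hδ]
    nlinarith
  · intro t
    have h1 : HasDerivAt (fun t => δ * b (δ⁻¹ * t)) (deriv b (δ⁻¹ * t)) t := by
      have h2 := (hbs.differentiable (by simp) (δ⁻¹ * t)).hasDerivAt
      have h3 : HasDerivAt (fun t => b (δ⁻¹ * t)) (deriv b (δ⁻¹ * t) * (δ⁻¹ * 1)) t :=
        HasDerivAt.comp (h₂ := b) t h2 ((hasDerivAt_id' t).const_mul δ⁻¹)
      refine (h3.const_mul δ).congr_deriv ?_
      field_simp
    rw [h1.deriv]
    have := hC (δ⁻¹ * t)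
    rw [Real.norm_eq_abs] at this
    linarith [le_abs_self C]

variable {V F : Type*} [NormedAddCommGroup V] [NormedAddCommGroup F]

/-- A continuous function vanishing on `K × {0}` is uniformly small near it. -/
theorem IsCompact.exists_forall_norm_lt_of_eq_zero {K : Set V} (hK : IsCompact K)
    {q : V × ℝ → F} (hq : Continuous q) (h0 : ∀ z ∈ K, q (z, 0) = 0) {η : ℝ} (hη : 0 < η) :
    ∃ δ > 0, ∀ z ∈ K, ∀ τ, |τ| ≤ δ → ‖q (z, τ)‖ < η := by
  obtain ⟨u, v, -, hv, hu, h0v, huv⟩ := generalized_tube_lemma hK (isCompact_singleton (x := (0 : ℝ)))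
    (isOpen_lt hq.norm continuous_const : IsOpen {x | ‖q x‖ < η}) (by
      rintro ⟨z, τ⟩ ⟨hz, hτ⟩
      rw [Set.mem_singleton_iff] at hτ
      simp only at hτ hz
      simp [hτ, h0 z hz, hη])
  obtain ⟨δ, hδ, hδv⟩ := Metric.nhds_basis_closedBall.mem_iff.1
    (hv.mem_nhds (h0v (Set.mem_singleton 0)))
  refine ⟨δ, hδ, fun z hz τ hτ => huv (Set.mk_mem_prod (hu hz) (hδv ?_))⟩
  simpa using hτ

end Cutoff

/-! ### Moving compact regular level sets -/

section LevelSets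

variable {V : Type*} [NormedAddCommGroup V] [InnerProductSpace ℝ V] [FiniteDimensional ℝ V]

/-- A compactly supported smooth vector field transverse to a compact regular level set. -/
theorem exists_transverse_field {D : V → ℝ} (hD : ContDiff ℝ ∞ D) (hK : IsCompact {z | D z = 0})
    (hreg : ∀ z, D z = 0 → fderiv ℝ D z ≠ 0) :
    ∃ (β : V → ℝ) (X : V → V), ContDiff ℝ ∞ β ∧ ContDiff ℝ ∞ X ∧ HasCompactSupport X ∧
      HasCompactSupport β ∧
      (∀ᶠ z in 𝓝ˢ {z | D z = 0}, β z = 1) ∧ ∀ z, 0 < 1 - β z + fderiv ℝ D z (X z) := by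
  have := FiniteDimensional.proper ℝ V
  obtain ⟨ρ, hρ⟩ := hK.isBounded.subset_ball 0
  have hDd : Continuous (fderiv ℝ D) := hD.continuous_fderiv (by simp)
  -- The cutoff `β` vanishes near the critical points of D. Hence where `β` = 1 the gradient is
  -- nonzero, and where `β` < 1 the term 1 − β is already positive.
  have hclosed : IsClosed ({z | fderiv ℝ D z = 0} ∪ (Metric.ball (0 : V) ρ)ᶜ) :=
    (isClosed_eq hDd continuous_const).union Metric.isOpen_ball.isClosed_compl
  obtain ⟨β, hβ0, hβ1, hβ⟩ := exists_contMDiffMap_zero_one_nhds_of_isClosed (n := (⊤ : ℕ∞)) 𝓘(ℝ, V)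
    hclosed hK.isClosed (by
      rw [Set.disjoint_left]
      rintro z (hz | hz) hz'
      · exact hreg z hz' hz
      · exact hz (hρ hz'))
  have hβs : ContDiff ℝ ∞ β := β.contMDiff.contDiff
  have hβc : HasCompactSupport β := by
    refine HasCompactSupport.intro (isCompact_closedBall (0 : V) ρ) fun z hz => ?_
    refine hβ0.self_of_nhdsSet z (Or.inr fun h => hz (Metric.ball_subset_closedBall h))
  let N : V → V := fun z => (InnerProductSpace.toDual ℝ V).symm (fderiv ℝ D z)
  have hN : ContDiff ℝ ∞ N :=
    (InnerProductSpace.toDual ℝ V).symm.contDiff.comp (hD.fderiv_right (m := ∞) (by simp))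
  have hDN : ∀ z, fderiv ℝ D z (N z) = ‖N z‖ ^ 2 := fun z => by
    rw [← InnerProductSpace.toDual_symm_apply, real_inner_self_eq_norm_sq]
  refine ⟨β, fun z => β z • N z, hβs, hβs.smul hN, hβc.smul_right, hβc, hβ1, fun z => ?_⟩
  rw [map_smul, smul_eq_mul, hDN]
  obtain ⟨h0, h1⟩ := hβ z
  rcases h1.lt_or_eq with h | h
  · have : 0 ≤ β z * ‖N z‖ ^ 2 := by positivity
    linarith
  · have hne : fderiv ℝ D z ≠ 0 := fun h' => by
      have := hβ0.self_of_nhdsSet z (Or.inl h')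
      linarith
    have : N z ≠ 0 := fun h' => hne (by simpa [N] using h')
    have : 0 < ‖N z‖ := norm_pos_iff.2 this
    rw [h]
    positivity

/-- Small changes of the value of a function near a compact regular level set are realized by
a smooth family of displacements. -/
theorem exists_displacement {D : V → ℝ} (hD : ContDiff ℝ ∞ D) (hK : IsCompact {z | D z = 0})
    (hreg : ∀ z, D z = 0 → fderiv ℝ D z ≠ 0) :
    ∃ (Ξ : V × ℝ → V) (K : Set V) (O : Set V) (δ : ℝ), ContDiff ℝ ∞ Ξ ∧ IsCompact K ∧
      (∀ z, Ξ (z, 0) = 0) ∧ (∀ z ∉ K, ∀ τ, Ξ (z, τ) = 0) ∧ IsOpen O ∧ {z | D z = 0} ⊆ O ∧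
      0 < δ ∧ ∀ z ∈ O, ∀ τ, |τ| ≤ δ → D (z + Ξ (z, τ)) = D z + τ := by
  have := FiniteDimensional.proper ℝ V
  have := FiniteDimensional.complete ℝ V
  obtain ⟨β, X, hβ, hX, hXc, hβc, hβ1, hpos⟩ := exists_transverse_field hD hK hreg
  obtain ⟨C, hC0, hC⟩ := exists_truncation
  set ℓ : V → ℝ := fun z => fderiv ℝ D z (X z) with hℓ
  have hDd : Differentiable ℝ D := hD.differentiable (by simp)
  have hℓs : ContDiff ℝ ∞ ℓ := (hD.fderiv_right (m := ∞) (by simp)).clm_apply hX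
  -- a positive lower bound
  obtain ⟨c, hc0, hc⟩ : ∃ c > 0, ∀ z, c ≤ 1 - β z + ℓ z := by
    have hcompact : IsCompact (tsupport X ∪ tsupport β) := hXc.isCompact.union hβc.isCompact
    rcases (tsupport X ∪ tsupport β).eq_empty_or_nonempty with he | hne
    · refine ⟨1, one_pos, fun z => ?_⟩
      have hz : z ∉ tsupport X ∪ tsupport β := by rw [he]; exact Set.notMem_empty z
      rw [Set.mem_union, not_or] at hz
      simp [hℓ, image_eq_zero_of_notMem_tsupport hz.1, image_eq_zero_of_notMem_tsupport hz.2]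
    · obtain ⟨z₀, -, hz₀⟩ := hcompact.exists_isMinOn hne
        (((continuous_const.sub hβ.continuous).add hℓs.continuous).continuousOn
          : ContinuousOn (fun z => 1 - β z + ℓ z) _)
      refine ⟨min 1 (1 - β z₀ + ℓ z₀), lt_min one_pos (hpos z₀), fun z => ?_⟩
      by_cases hz : z ∈ tsupport X ∪ tsupport β
      · exact (min_le_right _ _).trans (hz₀ hz)
      · rw [Set.mem_union, not_or] at hz
        refine (min_le_left _ _).trans ?_
        simp [hℓ, image_eq_zero_of_notMem_tsupport hz.1, image_eq_zero_of_notMem_tsupport hz.2]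
  obtain ⟨δ, hδ0, hδ⟩ := hXc.isCompact.exists_forall_norm_lt_of_eq_zero
    (q := fun x : V × ℝ => fderiv ℝ D (x.1 + x.2 • X x.1) (X x.1) - ℓ x.1)
    (by
      have h1 : Continuous (fderiv ℝ D) := hD.continuous_fderiv (by simp)
      have h2 := hX.continuous
      have h3 := hℓs.continuous
      exact ((h1.comp (by fun_prop)).clm_apply (by fun_prop)).sub (by fun_prop))
    (fun z _ => by simp [hℓ]) (η := c / 2 / C) (by positivity)
  obtain ⟨b, hbs, hbid, hb2, hbd⟩ := hC (δ / 2) (by positivity)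
  -- Where β = 1 and b t = t, this is D(z + tX) − D(z), so solving J = τ for t changes D by exactly
  -- τ. The term (1 − β)t and the truncation b make J invertible in t over every z and for all t.
  set J : V × ℝ → ℝ := fun x => (1 - β x.1 + ℓ x.1) * x.2 +
    (D (x.1 + b x.2 • X x.1) - D x.1 - ℓ x.1 * b x.2) with hJ
  have hJs : ContDiff ℝ ∞ J := by
    have h1 : ContDiff ℝ ∞ fun x : V × ℝ => D (x.1 + b x.2 • X x.1) :=
      hD.comp (contDiff_fst.add ((hbs.comp contDiff_snd).smul (hX.comp contDiff_fst)))
    have h2 : ContDiff ℝ ∞ fun x : V × ℝ => D x.1 := hD.comp contDiff_fst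
    have h3 : ContDiff ℝ ∞ fun x : V × ℝ => ℓ x.1 := hℓs.comp contDiff_fst
    have h4 : ContDiff ℝ ∞ fun x : V × ℝ => β x.1 := hβ.comp contDiff_fst
    have h5 : ContDiff ℝ ∞ fun x : V × ℝ => b x.2 := hbs.comp contDiff_snd
    exact (((contDiff_const.sub h4).add h3).mul contDiff_snd).add ((h1.sub h2).sub (h3.mul h5))
  have hJd : Differentiable ℝ J := hJs.differentiable (by simp)
  have hJ1 : ∀ x, c / 2 ≤ fderiv ℝ J x (0, 1) := by
    rintro ⟨z, t⟩
    have h1 : HasDerivAt (fun t => J (z, t)) ((1 - β z + ℓ z) +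
        (fderiv ℝ D (z + b t • X z) (X z) - ℓ z) * deriv b t) t := by
      have hb' := (hbs.differentiable (by simp) t).hasDerivAt
      have h2 : HasDerivAt (fun t => D (z + b t • X z))
          (fderiv ℝ D (z + b t • X z) (deriv b t • X z)) t :=
        (hDd (z + b t • X z)).hasFDerivAt.comp_hasDerivAt (f := fun t => z + b t • X z) t
          ((hb'.smul_const (X z)).const_add z)
      refine (((hasDerivAt_id' t).const_mul (1 - β z + ℓ z)).fun_add
        ((h2.sub_const (D z)).fun_sub (hb'.const_mul (ℓ z)))).congr_deriv ?_
      rw [map_smul, smul_eq_mul]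
      ring
    rw [((hJd (z, t)).hasFDerivAt.hasDerivAt_snd).unique h1]
    -- The truncation radius was chosen so that the first factor is at most c/(2C), while |b′| ≤ C
    -- uniformly; half of the lower bound c survives.
    have h3 : |(fderiv ℝ D (z + b t • X z) (X z) - ℓ z) * deriv b t| ≤ c / 2 := by
      by_cases hz : z ∈ tsupport X
      · have h4 := hδ z hz (b t) (by linarith [hb2 t])
        rw [Real.norm_eq_abs] at h4
        rw [abs_mul]
        calc _ ≤ c / 2 / C * C := mul_le_mul h4.le (hbd t) (abs_nonneg _) (by positivity)
          _ = c / 2 := by field_simp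
      · have : X z = 0 := image_eq_zero_of_notMem_tsupport hz
        simp only [hℓ, this, map_zero, sub_self, zero_mul, abs_zero]
        positivity
    have := hc z
    have := neg_abs_le ((fderiv ℝ D (z + b t • X z) (X z) - ℓ z) * deriv b t)
    linarith
  obtain ⟨Φ, -, hΦs, hΦe⟩ := exists_equiv_triangular hJs
    (fun x => (half_pos hc0).trans_le (hJ1 x)) (surjective_of_le_fderiv hJd (half_pos hc0) hJ1)
  set T : V × ℝ → ℝ := fun x => (Φ.symm x).2 with hT
  have hTs : ContDiff ℝ ∞ T := contDiff_snd.comp hΦs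
  have hΦT : ∀ z τ, Φ.symm (z, τ) = (z, T (z, τ)) ∧ J (z, T (z, τ)) = τ := fun z τ => by
    have h := Φ.apply_symm_apply (z, τ)
    rw [hΦe] at h
    have h1 : (Φ.symm (z, τ)).1 = z := congrArg Prod.fst h
    have h2 := congrArg Prod.snd h
    have h3 : Φ.symm (z, τ) = (z, T (z, τ)) := Prod.ext h1 rfl
    rw [h3] at h2
    exact ⟨h3, h2⟩
  have hb0 : b 0 = 0 := hbid 0 (by simpa using (half_pos hδ0).le)
  have hT0 : ∀ z, T (z, 0) = 0 := fun z => by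
    have h1 : Φ (z, 0) = (z, 0) := by rw [hΦe]; simp [hJ, hb0]
    have h2 : Φ.symm (z, 0) = (z, 0) := by rw [Equiv.symm_apply_eq, h1]
    simp [hT, h2]
  -- For |τ| ≤ `δ'` the solution T stays in the range where b is the identity, at least over the
  -- support of β.
  obtain ⟨δ', hδ'0, hδ'⟩ := hβc.isCompact.exists_forall_norm_lt_of_eq_zero hTs.continuous
    (fun z _ => hT0 z) (half_pos hδ0)
  refine ⟨fun x => b (T x) • X x.1, tsupport X, interior {z | β z = 1}, δ',
    (hbs.comp hTs).smul (hX.comp contDiff_fst), hXc.isCompact, fun z => by simp [hT0, hb0],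
    fun z hz τ => by simp [image_eq_zero_of_notMem_tsupport hz], isOpen_interior,
    subset_interior_iff_mem_nhdsSet.2 hβ1, hδ'0, fun z hz τ hτ => ?_⟩
  have hβz : β z = 1 := interior_subset (s := {z | β z = 1}) hz
  have h1 := hδ' z (subset_tsupport _ (by simp [hβz])) τ hτ
  rw [Real.norm_eq_abs] at h1
  have h2 := (hΦT z τ).2
  simp only [hJ, hβz, hbid _ h1.le] at h2 ⊢
  linarith

end LevelSets

section LevelSets

variable {V : Type*} [NormedAddCommGroup V] [InnerProductSpace ℝ V] [FiniteDimensional ℝ V]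

/-- A compact regular level set is carried to the corresponding level set of a `C¹`-small
perturbation of the function by a compactly supported diffeomorphism. -/
theorem exists_levelSet_equiv {D : V → ℝ} (hD : ContDiff ℝ ∞ D) (hK : IsCompact {z | D z = 0})
    (hreg : ∀ z, D z = 0 → fderiv ℝ D z ≠ 0) {B : Set V} (hB : IsCompact B) :
    ∃ ε > 0, ∀ R : V → ℝ, ContDiff ℝ ∞ R → (∀ z ∉ B, R z = 0) → (∀ z, |R z| ≤ ε) →
      (∀ z, ‖fderiv ℝ R z‖ ≤ ε) →
      ∃ (κ : V ≃ V) (ρ : V → ℝ), ContDiff ℝ ∞ κ ∧ ContDiff ℝ ∞ κ.symm ∧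
        (∃ C, IsCompact C ∧ ∀ z ∉ C, κ z = z) ∧ ContDiff ℝ ∞ ρ ∧ (∀ z, 0 < ρ z) ∧
        ∀ z, D z + R z = ρ z * D (κ z) := by
  have := FiniteDimensional.complete ℝ V
  obtain ⟨Ξ, K, O, δ, hΞ, hKc, hΞ0, hΞK, hO, hDO, hδ, hΞD⟩ := exists_displacement hD hK hreg
  have hΞd : Differentiable ℝ Ξ := hΞ.differentiable (by simp)
  have hΞc : Continuous (fderiv ℝ Ξ) := hΞ.continuous_fderiv (by simp)
  obtain ⟨δ₁, hδ₁, hq₁⟩ := hKc.exists_forall_norm_lt_of_eq_zero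
    (q := fun x => (fderiv ℝ Ξ x).comp (ContinuousLinearMap.inl ℝ V ℝ))
    (hΞc.clm_comp continuous_const) (fun z _ => by
      have h1 : HasFDerivAt (fun z => Ξ (z, 0))
          ((fderiv ℝ Ξ (z, 0)).comp (ContinuousLinearMap.inl ℝ V ℝ)) z :=
        (hΞd (z, 0)).hasFDerivAt.comp z ((hasFDerivAt_id z).prodMk (hasFDerivAt_const 0 z))
      have h2 : HasFDerivAt (fun z => Ξ (z, 0)) (0 : V →L[ℝ] V) z := by
        simp only [hΞ0]; exact hasFDerivAt_const 0 z
      exact h1.unique h2) (η := 1 / 4) (by norm_num)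
  obtain ⟨M, hM⟩ := (hKc.prod (isCompact_Icc (a := (-1 : ℝ)) (b := 1))
    ).exists_bound_of_continuousOn (f := fun x =>
      (fderiv ℝ Ξ x).comp (ContinuousLinearMap.inr ℝ V ℝ))
      (hΞc.clm_comp continuous_const).continuousOn
  have hC₂ : IsCompact ((B ∪ K) \ O) := (hB.union hKc).diff hO
  -- Off `O` the function D is bounded away from 0 on the relevant compact set. Perturbations below
  -- η then cannot change its sign.
  obtain ⟨η, hη, hηD⟩ : ∃ η > 0, ∀ z ∈ (B ∪ K) \ O, η ≤ |D z| := by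
    rcases ((B ∪ K) \ O).eq_empty_or_nonempty with he | hne
    · exact ⟨1, one_pos, fun z hz => by rw [he] at hz; exact hz.elim⟩
    · obtain ⟨z₀, hz₀, hmin⟩ := hC₂.exists_isMinOn hne (hD.continuous.abs.continuousOn)
      exact ⟨|D z₀|, abs_pos.2 fun h => hz₀.2 (hDO h), fun z hz => hmin hz⟩
  obtain ⟨δ₂, hδ₂, hq₂⟩ := hC₂.exists_forall_norm_lt_of_eq_zero
    (q := fun x : V × ℝ => D (x.1 + Ξ x) - D x.1)
    (by have := hD.continuous; have := hΞ.continuous; fun_prop) (fun z _ => by simp [hΞ0]) hη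
  -- Bounds δ, δ₁, δ₂ keep R where the displacement estimates hold, η/2 preserves signs off `O`, and
  -- 1 keeps R in the range of the bound M. The last bound, with δ₁, makes the displacement's
  -- differential at most 1/4 + 1/4.
  refine ⟨min (min δ δ₁) (min δ₂ (min (η / 2) (min 1 (1 / (4 * (|M| + 1)))))),
    by positivity, fun R hR hRB hR1 hR2 => ?_⟩
  have hle : ∀ z, |R z| ≤ δ ∧ |R z| ≤ δ₁ ∧ |R z| ≤ δ₂ ∧ |R z| ≤ η / 2 ∧ |R z| ≤ 1 := fun z => by
    have := hR1 z
    simp only [le_min_iff] at this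
    tauto
  have hle' : ∀ z, ‖fderiv ℝ R z‖ ≤ 1 / (4 * (|M| + 1)) := fun z => by
    have := hR2 z
    simp only [le_min_iff] at this
    tauto
  have hRd : Differentiable ℝ R := hR.differentiable (by simp)
  set e : V → V := fun z => Ξ (z, R z) with he
  have hes : ContDiff ℝ ∞ e := hΞ.comp (contDiff_id.prodMk hR)
  have hed : ∀ z, ‖fderiv ℝ e z‖ ≤ 1 / 2 := fun z => by
    by_cases hz : z ∈ K
    · have h1 : HasFDerivAt e ((fderiv ℝ Ξ (z, R z)).comp
          ((ContinuousLinearMap.id ℝ V).prod (fderiv ℝ R z))) z :=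
        (hΞd (z, R z)).hasFDerivAt.comp z ((hasFDerivAt_id z).prodMk (hRd z).hasFDerivAt)
      have h2 : (fderiv ℝ Ξ (z, R z)).comp
          ((ContinuousLinearMap.id ℝ V).prod (fderiv ℝ R z)) =
          (fderiv ℝ Ξ (z, R z)).comp (ContinuousLinearMap.inl ℝ V ℝ) +
          ((fderiv ℝ Ξ (z, R z)).comp (ContinuousLinearMap.inr ℝ V ℝ)).comp (fderiv ℝ R z) := by
        ext v
        simp [← map_add]
      rw [h1.fderiv, h2]
      have h3 := hq₁ z hz (R z) (hle z).2.1
      have h4 := hM (z, R z) ⟨hz, abs_le.1 (hle z).2.2.2.2⟩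
      have h5 : ‖((fderiv ℝ Ξ (z, R z)).comp (ContinuousLinearMap.inr ℝ V ℝ)).comp
          (fderiv ℝ R z)‖ ≤ (|M| + 1) * (1 / (4 * (|M| + 1))) :=
        (ContinuousLinearMap.opNorm_comp_le _ _).trans (mul_le_mul
          (h4.trans (by linarith [le_abs_self M])) (hle' z) (norm_nonneg _) (by positivity))
      have h6 : (|M| + 1) * (1 / (4 * (|M| + 1))) = 1 / 4 := by field_simp
      exact (norm_add_le _ _).trans (by linarith)
    · have h1 : e =ᶠ[𝓝 z] fun _ => 0 := by
        filter_upwards [hKc.isClosed.isOpen_compl.mem_nhds hz] with w hw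
        exact hΞK w hw _
      rw [h1.fderiv_eq]
      simp
  obtain ⟨κ, hκ, hκs, hκe⟩ := exists_equiv_add_of_fderiv_le hes hed
  have hin : ∀ z ∈ O, D (κ z) = D z + R z := fun z hz => by
    rw [hκe]; exact hΞD z hz _ (hle z).1
  -- Here D + R and D ∘ κ both have the sign of D, so their quotient can serve as the positive
  -- factor ρ. On `O` they agree and ρ = 1, including where both vanish.
  have hout : ∀ z ∉ O, 0 < (D z + R z) / D (κ z) := fun z hz => by
    by_cases hzB : z ∈ B ∪ K
    · have h1 := hq₂ z ⟨hzB, hz⟩ (R z) (hle z).2.2.1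
      have h2 := hηD z ⟨hzB, hz⟩
      have h3 := (hle z).2.2.2.1
      rw [hκe]
      change ‖D (z + e z) - D z‖ < η at h1
      rw [Real.norm_eq_abs, abs_lt] at h1
      rw [abs_le] at h3
      rcases le_abs'.1 h2 with h4 | h4
      · exact div_pos_of_neg_of_neg (by linarith) (by linarith)
      · exact div_pos (by linarith) (by linarith)
    · rw [Set.mem_union, not_or] at hzB
      have hDz : D z ≠ 0 := fun h => hz (hDO h)
      rw [hκe, he]
      simp only
      rw [hΞK z hzB.2, hRB z hzB.1, add_zero, add_zero, div_self hDz]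
      exact one_pos
  have hin' : ∀ z ∈ O, (if D (κ z) = 0 then 1 else (D z + R z) / D (κ z)) = 1 := fun z hz => by
    split_ifs with h
    · rfl
    · rw [← hin z hz, div_self h]
  refine ⟨κ, fun z => if D (κ z) = 0 then 1 else (D z + R z) / D (κ z), hκ, hκs,
    ⟨K, hKc, fun z hz => ?_⟩, ?_, fun z => ?_, fun z => ?_⟩
  · rw [hκe, he]
    simp only
    rw [hΞK z hz, add_zero]
  · rw [contDiff_iff_contDiffAt]
    intro z
    by_cases hz : z ∈ O
    · refine (contDiffAt_const (c := (1 : ℝ))).congr_of_eventuallyEq ?_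
      filter_upwards [hO.mem_nhds hz] with w hw
      exact hin' w hw
    · have hne : D (κ z) ≠ 0 := fun h => by
        have := hout z hz
        rw [h, div_zero] at this
        exact this.false
      refine (((hD.add hR).contDiffAt).div (hD.comp hκ).contDiffAt hne).congr_of_eventuallyEq ?_
      filter_upwards [(hD.comp hκ).continuous.continuousAt.eventually_ne hne] with w hw
      exact if_neg hw
  · by_cases hz : z ∈ O
    · exact one_pos.trans_eq (hin' z hz).symm
    · simp only
      split_ifs
      · exact one_pos
      · exact hout z hz
  · simp only
    split_ifs with h
    · by_cases hz : z ∈ O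
      · rw [← hin z hz, one_mul]
      · have := hout z hz
        rw [h, div_zero] at this
        exact this.false.elim
    · field_simp

end LevelSets

/-! ### Effect of a small horizontal displacement on D -/

section PerturbedEquation

variable {V : Type*} [NormedAddCommGroup V] [NormedSpace ℝ V] [FiniteDimensional ℝ V]

/-- A `C²`-small displacement of the first variable, supported in a ball, is a diffeomorphism
which changes the function `D` of the first variable by a small function. -/
theorem exists_equiv_displacement {D : V → ℝ} (hD : ContDiff ℝ ∞ D) (r : ℝ) {ε' : ℝ}
    (hε' : 0 < ε') :
    ∃ ε > 0, ∀ e : V × ℝ → V, ContDiff ℝ ∞ e → (∀ x ∉ Metric.closedBall (0 : V × ℝ) r, e x = 0) →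
      (∀ x, ‖e x‖ ≤ ε) → (∀ x, ‖fderiv ℝ e x‖ ≤ ε) → (∀ x, ‖fderiv ℝ (fderiv ℝ e) x‖ ≤ ε) →
      ∃ (Ψ : V × ℝ ≃ V × ℝ) (R : V × ℝ → ℝ), ContDiff ℝ ∞ Ψ ∧ ContDiff ℝ ∞ Ψ.symm ∧
        (∀ x, Ψ x = (x.1 + e x, x.2)) ∧ ContDiff ℝ ∞ R ∧
        (∀ x ∉ Metric.closedBall (0 : V × ℝ) r, R x = 0) ∧ (∀ x, |R x| ≤ ε') ∧
        (∀ x, ‖fderiv ℝ R x‖ ≤ ε') ∧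
        (∀ x, |fderiv ℝ (fun x => fderiv ℝ R x (0, 1)) x (0, 1)| ≤ ε') ∧
        ∀ x, D (Ψ.symm x).1 = D x.1 - R x := by
  have := FiniteDimensional.proper ℝ V
  have := FiniteDimensional.complete ℝ V
  have hDd : Differentiable ℝ D := hD.differentiable (by simp)
  have hD' : ContDiff ℝ ∞ (fderiv ℝ D) := hD.fderiv_right (m := ∞) (by simp)
  have hD'd : Differentiable ℝ (fderiv ℝ D) := hD'.differentiable (by simp)
  obtain ⟨M₁, hM₁⟩ := (isCompact_closedBall (0 : V) r).exists_bound_of_continuousOn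
    hD'.continuous.continuousOn
  obtain ⟨M₂, hM₂⟩ := (isCompact_closedBall (0 : V) r).exists_bound_of_continuousOn
    (hD'.continuous_fderiv (by simp)).continuousOn
  obtain ⟨M, hM0, hMa, hMb⟩ : ∃ M : ℝ, 0 < M ∧ (∀ z ∈ Metric.closedBall (0 : V) r,
      ‖fderiv ℝ D z‖ ≤ M) ∧ ∀ z ∈ Metric.closedBall (0 : V) r,
      ‖fderiv ℝ (fderiv ℝ D) z‖ ≤ M :=
    ⟨|M₁| + |M₂| + 1, by positivity,
      fun z hz => (hM₁ z hz).trans (by linarith [le_abs_self M₁, abs_nonneg M₂]),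
      fun z hz => (hM₂ z hz).trans (by linarith [le_abs_self M₂, abs_nonneg M₁])⟩
  -- The bound 1/2 makes the displacement invertible. The estimates below come to Mε for R, 3Mε for
  -- its differential and 10Mε for its second vertical derivative, all at most 12Mε.
  refine ⟨min (1 / 2) (ε' / (12 * M)), by positivity, fun e he heb he0 he1 he2 => ?_⟩
  set ε := min (1 / 2) (ε' / (12 * M)) with hε
  have hεpos : 0 < ε := by positivity
  have hεhalf : ε ≤ 1 / 2 := min_le_left _ _
  have hεM : 12 * M * ε ≤ ε' := by
    have : ε ≤ ε' / (12 * M) := min_le_right _ _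
    rw [le_div_iff₀ (by positivity)] at this
    linarith
  -- the displacement as a map of `V × ℝ`
  set ι : V →L[ℝ] V × ℝ := ContinuousLinearMap.inl ℝ V ℝ with hι
  have hιn : ∀ v, ‖ι v‖ = ‖v‖ := fun v => by simp [hι, Prod.norm_def]
  set g : V × ℝ → V × ℝ := fun x => ι (e x) with hg
  have hed : Differentiable ℝ e := he.differentiable (by simp)
  have hgs : ContDiff ℝ ∞ g := ι.contDiff.comp he
  have hgd : ∀ x, fderiv ℝ g x = ι.comp (fderiv ℝ e x) := fun x =>
    (ι.hasFDerivAt.comp x (hed x).hasFDerivAt).fderiv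
  have hg1 : ∀ x v, ‖fderiv ℝ g x v‖ ≤ ε * ‖v‖ := fun x v => by
    rw [hgd, ContinuousLinearMap.comp_apply, hιn]
    exact (fderiv ℝ e x).le_of_opNorm_le (he1 x) v
  have hg1' : ∀ x, ‖fderiv ℝ g x‖ ≤ ε := fun x =>
    ContinuousLinearMap.opNorm_le_bound _ hεpos.le (hg1 x)
  obtain ⟨Ψ, hΨ, hΨs, hΨe⟩ := exists_equiv_add_of_fderiv_le hgs fun x => (hg1' x).trans hεhalf
  have hΘ : ∀ x, Ψ.symm x + g (Ψ.symm x) = x := fun x => by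
    rw [← hΨe, Equiv.apply_symm_apply]
  set Θ := Ψ.symm with hΘdef
  have hΘd : Differentiable ℝ Θ := hΨs.differentiable (by simp)
  have hgdd : Differentiable ℝ g := hgs.differentiable (by simp)
  -- Differentiates Θ + g ∘ Θ = id; the bounds on the differential of the inverse Θ all come from
  -- this identity.
  have hA : ∀ x v, fderiv ℝ Θ x v + fderiv ℝ g (Θ x) (fderiv ℝ Θ x v) = v := fun x v => by
    have h1 : HasFDerivAt (fun x => Θ x + g (Θ x))
        (fderiv ℝ Θ x + (fderiv ℝ g (Θ x)).comp (fderiv ℝ Θ x)) x :=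
      (hΘd x).hasFDerivAt.fun_add ((hgdd (Θ x)).hasFDerivAt.comp x (hΘd x).hasFDerivAt)
    rw [funext hΘ] at h1
    have h2 := h1.unique (hasFDerivAt_id x)
    simpa using congrArg (fun L : V × ℝ →L[ℝ] V × ℝ => L v) h2
  have hA2 : ∀ x v, ‖fderiv ℝ Θ x v‖ ≤ 2 * ‖v‖ := fun x v => by
    have h1 := hA x v
    have h2 := hg1 (Θ x) (fderiv ℝ Θ x v)
    have h3 : ‖fderiv ℝ Θ x v‖ ≤ ‖v‖ + ‖fderiv ℝ g (Θ x) (fderiv ℝ Θ x v)‖ := by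
      calc ‖fderiv ℝ Θ x v‖ = ‖v - fderiv ℝ g (Θ x) (fderiv ℝ Θ x v)‖ := by
            exact congrArg norm (eq_sub_of_add_eq h1)
        _ ≤ _ := norm_sub_le _ _
    nlinarith [norm_nonneg (fderiv ℝ Θ x v)]
  have hA1 : ∀ x v, ‖v - fderiv ℝ Θ x v‖ ≤ 2 * ε * ‖v‖ := fun x v => by
    have h1 : v - fderiv ℝ Θ x v = fderiv ℝ g (Θ x) (fderiv ℝ Θ x v) :=
      sub_eq_of_eq_add' (hA x v).symm
    rw [h1]
    have := hg1 (Θ x) (fderiv ℝ Θ x v)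
    have := hA2 x v
    nlinarith
  have hΘball : ∀ x ∈ Metric.closedBall (0 : V × ℝ) r, Θ x ∈ Metric.closedBall (0 : V × ℝ) r :=
    fun x hx => by
      by_contra h
      have h1 := hΘ x
      simp only [hg, heb _ h, map_zero, add_zero] at h1
      rw [h1] at h
      exact h hx
  have hΘout : ∀ x ∉ Metric.closedBall (0 : V × ℝ) r, Θ x = x := fun x hx => by
    rw [hΘdef, Equiv.symm_apply_eq, hΨe]
    simp [hg, heb x hx]
  have hfst : ∀ x ∈ Metric.closedBall (0 : V × ℝ) r, x.1 ∈ Metric.closedBall (0 : V) r :=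
    fun x hx => by
      rw [mem_closedBall_zero_iff] at hx ⊢
      exact (norm_fst_le x).trans hx
  have hdist : ∀ x, ‖x.1 - (Θ x).1‖ ≤ ε := fun x => by
    have h1 : x - Θ x = g (Θ x) := sub_eq_of_eq_add' (hΘ x).symm
    have h2 : ‖x - Θ x‖ ≤ ε := by rw [h1, hg]; simp only; rw [hιn]; exact he0 _
    exact (norm_fst_le (x - Θ x)).trans h2
  set R : V × ℝ → ℝ := fun x => D x.1 - D (Θ x).1 with hR
  have hRs : ContDiff ℝ ∞ R :=
    (hD.comp contDiff_fst).sub (hD.comp (contDiff_fst.comp hΨs))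
  have hRd : Differentiable ℝ R := hRs.differentiable (by simp)
  have hRout : ∀ x ∉ Metric.closedBall (0 : V × ℝ) r, R x = 0 := fun x hx => by
    simp [hR, hΘout x hx]
  have hRout' : ∀ x ∉ Metric.closedBall (0 : V × ℝ) r, R =ᶠ[𝓝 x] fun _ => 0 := fun x hx => by
    filter_upwards [Metric.isClosed_closedBall.isOpen_compl.mem_nhds hx] with w hw
    exact hRout w hw
  have hRf : ∀ x v, fderiv ℝ R x v =
      fderiv ℝ D x.1 v.1 - fderiv ℝ D (Θ x).1 (fderiv ℝ Θ x v).1 := fun x v => by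
    have h1 : HasFDerivAt R ((fderiv ℝ D x.1).comp (ContinuousLinearMap.fst ℝ V ℝ) -
        (fderiv ℝ D (Θ x).1).comp ((ContinuousLinearMap.fst ℝ V ℝ).comp (fderiv ℝ Θ x))) x :=
      ((hDd x.1).hasFDerivAt.comp x hasFDerivAt_fst).fun_sub
        ((hDd (Θ x).1).hasFDerivAt.comp x (hasFDerivAt_fst.comp x (hΘd x).hasFDerivAt))
    rw [h1.fderiv]
    rfl
  refine ⟨Ψ, R, hΨ, hΨs, fun x => ?_, hRs, hRout, fun x => ?_, fun x => ?_, fun x => ?_,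
    fun x => ?_⟩
  · rw [hΨe]
    ext <;> simp [hg, hι]
  · by_cases hx : x ∈ Metric.closedBall (0 : V × ℝ) r
    · have h1 := (convex_closedBall (0 : V) r).norm_image_sub_le_of_norm_fderiv_le
        (fun z _ => hDd z) hMa (hfst _ (hΘball x hx)) (hfst x hx)
      have h2 := hdist x
      rw [Real.norm_eq_abs] at h1
      change |R x| ≤ _ at h1
      nlinarith
    · rw [hRout x hx, abs_zero]; exact hε'.le
  · by_cases hx : x ∈ Metric.closedBall (0 : V × ℝ) r
    · refine ContinuousLinearMap.opNorm_le_bound _ hε'.le fun v => ?_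
      have h1 := (convex_closedBall (0 : V) r).norm_image_sub_le_of_norm_fderiv_le
        (fun z _ => hD'd z) hMb (hfst _ (hΘball x hx)) (hfst x hx)
      have h2 : fderiv ℝ R x v = (fderiv ℝ D x.1 - fderiv ℝ D (Θ x).1) v.1 +
          fderiv ℝ D (Θ x).1 (v - fderiv ℝ Θ x v).1 := by
        rw [hRf]
        simp
      have h3 : ‖(fderiv ℝ D x.1 - fderiv ℝ D (Θ x).1) v.1‖ ≤ M * ε * ‖v‖ :=
        (ContinuousLinearMap.le_opNorm _ _).trans (mul_le_mul
          (h1.trans (mul_le_mul_of_nonneg_left (hdist x) hM0.le)) (norm_fst_le v)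
          (norm_nonneg _) (by positivity))
      have h4 : ‖fderiv ℝ D (Θ x).1 (v - fderiv ℝ Θ x v).1‖ ≤ M * (2 * ε * ‖v‖) :=
        (ContinuousLinearMap.le_opNorm _ _).trans (mul_le_mul
          (hMa _ (hfst _ (hΘball x hx))) ((norm_fst_le _).trans (hA1 x v))
          (norm_nonneg _) hM0.le)
      rw [h2]
      refine (norm_add_le _ _).trans ?_
      have h5 : 0 ≤ M * ε * ‖v‖ := by positivity
      have h6 : 12 * M * ε * ‖v‖ ≤ ε' * ‖v‖ := mul_le_mul_of_nonneg_right hεM (norm_nonneg v)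
      linarith
    · rw [(hRout' x hx).fderiv_eq]
      simpa using hε'.le
  · by_cases hx : x ∈ Metric.closedBall (0 : V × ℝ) r
    · obtain ⟨z, t⟩ := x
      set w : V × ℝ := (0, 1) with hw
      have hwn : ‖w‖ = 1 := by simp [hw, Prod.norm_def]
      have hline : ∀ t, HasDerivAt (fun t : ℝ => ((z, t) : V × ℝ)) w t := fun t =>
        (hasDerivAt_const t z).prodMk (hasDerivAt_id t)
      have hΘ' : ContDiff ℝ ∞ fun x => fderiv ℝ Θ x w :=
        (hΨs.fderiv_right (m := ∞) (by simp)).clm_apply contDiff_const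
      set a : ℝ → V × ℝ := fun t => fderiv ℝ Θ (z, t) w with ha
      set a₂ : V × ℝ := fderiv ℝ (fun x => fderiv ℝ Θ x w) (z, t) w with ha₂
      have hγ : ∀ t, HasDerivAt (fun t => Θ (z, t)) (a t) t := fun t =>
        (hΘd (z, t)).hasFDerivAt.comp_hasDerivAt t (hline t)
      have hader : HasDerivAt a a₂ t :=
        (hΘ'.differentiable (by simp) (z, t)).hasFDerivAt.comp_hasDerivAt t (hline t)
      have hedd : Differentiable ℝ (fderiv ℝ e) :=
        (he.fderiv_right (m := ∞) (by simp)).differentiable (by simp)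
      have hrel : ∀ t, a t + ι (fderiv ℝ e (Θ (z, t)) (a t)) = w := fun t => by
        have := hA (z, t) w
        rwa [hgd] at this
      -- The same identity differentiated a second time in the vertical direction. It bounds ‖a₂‖ by
      -- 4ε + ε‖a₂‖, hence by 8ε since ε ≤ 1/2.
      have hrel2 : a₂ + ι (fderiv ℝ (fderiv ℝ e) (Θ (z, t)) (a t) (a t) +
          fderiv ℝ e (Θ (z, t)) a₂) = 0 := by
        have h1 : HasDerivAt (fun t => fderiv ℝ e (Θ (z, t)))
            (fderiv ℝ (fderiv ℝ e) (Θ (z, t)) (a t)) t :=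
          (hedd (Θ (z, t))).hasFDerivAt.comp_hasDerivAt t (hγ t)
        have h2 := hader.fun_add (ι.hasFDerivAt.comp_hasDerivAt t (h1.clm_apply hader))
        have h3 : (fun t => a t + (ι ∘ fun t => fderiv ℝ e (Θ (z, t)) (a t)) t) = fun _ => w :=
          funext hrel
        rw [h3] at h2
        exact h2.unique (hasDerivAt_const t w)
      have han : ‖a t‖ ≤ 2 := by simpa [hwn] using hA2 (z, t) w
      -- The vertical vector has no V-component, so that of its image under the differential of Θ is
      -- of order ε.
      have han' : ‖(a t).1‖ ≤ 2 * ε := by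
        have h1 := hA1 (z, t) w
        rw [hwn, mul_one] at h1
        have h2 := (norm_fst_le (w - a t)).trans h1
        simpa [hw] using h2
      have ha₂n : ‖a₂‖ ≤ 8 * ε := by
        have h1 : ‖a₂‖ = ‖ι (fderiv ℝ (fderiv ℝ e) (Θ (z, t)) (a t) (a t) +
          fderiv ℝ e (Θ (z, t)) a₂)‖ := by
          rw [eq_neg_of_add_eq_zero_left hrel2, norm_neg]
          rw [← eq_neg_of_add_eq_zero_left hrel2]
        rw [hιn] at h1
        have h2 : ‖fderiv ℝ (fderiv ℝ e) (Θ (z, t)) (a t) (a t)‖ ≤ ε * 2 * 2 :=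
          (ContinuousLinearMap.le_opNorm₂ _ _ _).trans (mul_le_mul
            (mul_le_mul (he2 _) han (norm_nonneg _) hεpos.le) han (norm_nonneg _) (by positivity))
        have h3 : ‖fderiv ℝ e (Θ (z, t)) a₂‖ ≤ ε * ‖a₂‖ :=
          (fderiv ℝ e _).le_of_opNorm_le (he1 _) _
        have h4 := norm_add_le (fderiv ℝ (fderiv ℝ e) (Θ (z, t)) (a t) (a t))
          (fderiv ℝ e (Θ (z, t)) a₂)
        nlinarith [norm_nonneg a₂]
      have hRder : HasDerivAt (fun t => fderiv ℝ R (z, t) w)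
          (-(fderiv ℝ (fderiv ℝ D) (Θ (z, t)).1 (a t).1 (a t).1 +
            fderiv ℝ D (Θ (z, t)).1 a₂.1)) t := by
        have h0 : (fun t => fderiv ℝ R (z, t) w) =
            fun t => -(fderiv ℝ D (Θ (z, t)).1 (a t).1) := by
          ext t
          rw [hRf]
          simp [hw, ha]
        rw [h0]
        have hγ1 : HasDerivAt (fun t => (Θ (z, t)).1) (a t).1 t :=
          (ContinuousLinearMap.fst ℝ V ℝ).hasFDerivAt.comp_hasDerivAt t (hγ t)
        have ha1 : HasDerivAt (fun t => (a t).1) a₂.1 t :=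
          (ContinuousLinearMap.fst ℝ V ℝ).hasFDerivAt.comp_hasDerivAt t hader
        have h1 : HasDerivAt (fun t => fderiv ℝ D (Θ (z, t)).1)
            (fderiv ℝ (fderiv ℝ D) (Θ (z, t)).1 (a t).1) t :=
          (hD'd (Θ (z, t)).1).hasFDerivAt.comp_hasDerivAt t hγ1
        exact (h1.clm_apply ha1).fun_neg
      have hR' : Differentiable ℝ fun x => fderiv ℝ R x w :=
        ((hRs.fderiv_right (m := ∞) (by simp)).clm_apply contDiff_const).differentiable
          (by simp)
      rw [((hR' (z, t)).hasFDerivAt.comp_hasDerivAt t (hline t)).unique hRder, abs_neg,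
        ← Real.norm_eq_abs]
      have hb := hfst _ (hΘball _ hx)
      have h1 : ‖fderiv ℝ (fderiv ℝ D) (Θ (z, t)).1 (a t).1 (a t).1‖ ≤
          M * (2 * ε) * (2 * ε) :=
        (ContinuousLinearMap.le_opNorm₂ _ _ _).trans (mul_le_mul
          (mul_le_mul (hMb _ hb) han' (norm_nonneg _) hM0.le) han' (norm_nonneg _) (by positivity))
      have h2 : ‖fderiv ℝ D (Θ (z, t)).1 a₂.1‖ ≤ M * (8 * ε) :=
        (ContinuousLinearMap.le_opNorm _ _).trans (mul_le_mul (hMa _ hb)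
          ((norm_fst_le _).trans ha₂n) (norm_nonneg _) hM0.le)
      refine (norm_add_le _ _).trans ?_
      have h3 : M * (2 * ε) * (2 * ε) ≤ 2 * (M * ε) := by
        have : 0 ≤ M * ε := by positivity
        nlinarith
      have : 0 ≤ M * ε := by positivity
      linarith
    · have h1 : (fun x => fderiv ℝ R x (0, 1)) =ᶠ[𝓝 x] fun _ => 0 := by
        filter_upwards [(hRout' x hx).eventuallyEq_nhds] with y hy
        rw [hy.fderiv_eq]
        simp
      rw [h1.fderiv_eq]
      simpa using hε'.le
  · simp [hR, hΘdef]

end PerturbedEquation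

/-! ### Comparing the perturbed double with the original one -/

section FibredDiffeomorphism

variable {V : Type*} [NormedAddCommGroup V] [InnerProductSpace ℝ V] [FiniteDimensional ℝ V]

set_option maxSynthPendingDepth 10 in
/-- A `C²`-small perturbation `x ↦ (x.1 + e x, x.2)` moves the double `y ^ 2 = D z` of a compact
domain with smooth boundary to a surface that is equivalent to it over a diffeomorphism of `V`. -/
theorem exists_fibred_equiv {D : V → ℝ} (hD : ContDiff ℝ ∞ D) (hK : IsCompact {z | D z = 0})
    (hreg : ∀ z, D z = 0 → fderiv ℝ D z ≠ 0) (r : ℝ) :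
    ∃ ε > 0, ∀ e : V × ℝ → V, ContDiff ℝ ∞ e → (∀ x ∉ Metric.closedBall (0 : V × ℝ) r, e x = 0) →
      (∀ x, ‖e x‖ ≤ ε) → (∀ x, ‖fderiv ℝ e x‖ ≤ ε) → (∀ x, ‖fderiv ℝ (fderiv ℝ e) x‖ ≤ ε) →
      ∃ (Ψ Λ : V × ℝ ≃ V × ℝ) (κ : V ≃ V), ContDiff ℝ ∞ Ψ ∧ ContDiff ℝ ∞ Ψ.symm ∧
        ContDiff ℝ ∞ Λ ∧ ContDiff ℝ ∞ Λ.symm ∧ ContDiff ℝ ∞ κ ∧ ContDiff ℝ ∞ κ.symm ∧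
        (∀ x, Ψ x = (x.1 + e x, x.2)) ∧ (∃ C, IsCompact C ∧ ∀ z ∉ C, κ z = z) ∧
        (∀ x, (Λ x).1 = κ x.1) ∧ ∀ x, x.2 ^ 2 = D (Ψ.symm x).1 ↔ (Λ x).2 ^ 2 = D (Λ x).1 := by
  have := FiniteDimensional.proper ℝ V
  have := FiniteDimensional.complete ℝ V
  obtain ⟨ε₁, hε₁, hκ⟩ := exists_levelSet_equiv hD hK hreg (isCompact_closedBall (0 : V) r)
  -- The bound 1 leaves the second vertical derivative 2 + R_yy at least 1; the bound ε₁/2 makes the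
  -- R₁ below admissible for the level-set lemma.
  obtain ⟨ε, hε, h⟩ := exists_equiv_displacement hD r (ε' := min 1 (ε₁ / 2)) (by positivity)
  refine ⟨ε, hε, fun e he heb he0 he1 he2 => ?_⟩
  obtain ⟨Ψ, R, hΨ, hΨs, hΨe, hR, hRb, hR0, hR1, hR2, hRD⟩ := h e he heb he0 he1 he2
  set ε' := min 1 (ε₁ / 2) with hε'
  have hε'1 : ε' ≤ 1 := min_le_left _ _
  have hε'2 : ε' ≤ ε₁ / 2 := min_le_right _ _
  have hDd : Differentiable ℝ D := hD.differentiable (by simp)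
  have hRd : Differentiable ℝ R := hR.differentiable (by simp)
  set F : V × ℝ → ℝ := fun x => x.2 ^ 2 - D x.1 + R x with hF
  have hFs : ContDiff ℝ ∞ F := ((contDiff_snd.pow 2).sub (hD.comp contDiff_fst)).add hR
  have hFd : Differentiable ℝ F := hFs.differentiable (by simp)
  have hFf : ∀ (x v : V × ℝ),
      fderiv ℝ F x v = 2 * x.2 * v.2 - fderiv ℝ D x.1 v.1 + fderiv ℝ R x v := fun x v => by
    have h1 : HasFDerivAt F (((2 : ℕ) * x.2 ^ (2 - 1)) • ContinuousLinearMap.snd ℝ V ℝ -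
        (fderiv ℝ D x.1).comp (ContinuousLinearMap.fst ℝ V ℝ) + fderiv ℝ R x) x :=
      ((((hasDerivAt_pow 2 x.2).comp_hasFDerivAt x (hasFDerivAt_snd)).fun_sub
        ((hDd x.1).hasFDerivAt.comp x hasFDerivAt_fst)).fun_add (hRd x).hasFDerivAt)
    rw [h1.fderiv]
    simp
  have hRw : Differentiable ℝ fun x => fderiv ℝ R x (0, 1) :=
    ((hR.fderiv_right (m := ∞) (by simp)).clm_apply contDiff_const).differentiable (by simp)
  have hconv : ∀ x, 1 ≤ fderiv ℝ (fun x => fderiv ℝ F x (0, 1)) x (0, 1) := fun x => by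
    have h0 : (fun x => fderiv ℝ F x (0, 1)) = fun x : V × ℝ => 2 * x.2 + fderiv ℝ R x (0, 1) := by
      ext x
      rw [hFf]
      simp
    have h1 : HasFDerivAt (fun x : V × ℝ => 2 * x.2 + fderiv ℝ R x (0, 1))
        ((2 : ℝ) • ContinuousLinearMap.snd ℝ V ℝ +
          fderiv ℝ (fun x => fderiv ℝ R x (0, 1)) x) x :=
      (hasFDerivAt_snd.const_mul 2).fun_add (hRw x).hasFDerivAt
    rw [h0, h1.fderiv]
    have h2 := (abs_le.1 (hR2 x)).1
    simp only [add_apply, smul_apply, ContinuousLinearMap.coe_snd', smul_eq_mul]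
    linarith
  obtain ⟨s, Y, hs, hY, hs0, hYpos, hYsurj, hYe⟩ := exists_sq_of_uniformly_convex hFs hconv
  have hsd : Differentiable ℝ s := hs.differentiable (by simp)
  have hYd : Differentiable ℝ Y := hY.differentiable (by simp)
  have hsR : ∀ z, 2 * s z = - fderiv ℝ R (z, s z) (0, 1) := fun z => by
    have h1 := hs0 z
    rw [hFf] at h1
    simp at h1
    linarith
  have hnorm1 : ‖((0, 1) : V × ℝ)‖ = 1 := by simp [Prod.norm_def]
  have hsb : ∀ z, |2 * s z| ≤ ε' := fun z => by
    rw [hsR, abs_neg, ← Real.norm_eq_abs]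
    calc _ ≤ ‖fderiv ℝ R (z, s z)‖ * ‖((0, 1) : V × ℝ)‖ := ContinuousLinearMap.le_opNorm _ _
      _ ≤ ε' := by rw [hnorm1, mul_one]; exact hR1 _
  -- The critical value of F is −(D + R₁), so the zero set of F is Y² = D + R₁.
  set R₁ : V → ℝ := fun z => -F (z, s z) - D z with hR₁
  have hR₁s : ContDiff ℝ ∞ R₁ := ((hFs.comp (contDiff_id.prodMk hs)).neg).sub hD
  have hR₁e : ∀ z, R₁ z = -(s z ^ 2 + R (z, s z)) := fun z => by
    simp only [hR₁, hF]; ring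
  obtain ⟨κ, ρ, hκs, hκss, hκC, hρ, hρpos, hκD⟩ := hκ R₁ hR₁s
    (fun z hz => by
      have hout : ∀ y, (z, y) ∉ Metric.closedBall (0 : V × ℝ) r := fun y hy => by
        rw [mem_closedBall_zero_iff] at hy hz
        exact hz ((norm_fst_le (z, y)).trans hy)
      have h1 : R =ᶠ[𝓝 (z, s z)] fun _ => 0 := by
        filter_upwards [Metric.isClosed_closedBall.isOpen_compl.mem_nhds (hout (s z))] with w hw
        exact hRb w hw
      have h2 := hsR z
      rw [h1.fderiv_eq] at h2
      have h3 : s z = 0 := by simpa using h2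
      rw [hR₁e, hRb _ (hout _), h3]
      simp)
    (fun z => by
      rw [hR₁e, abs_neg]
      have h1 := abs_le.1 (hsb z)
      have h2 := abs_le.1 (hR0 (z, s z))
      rw [abs_le]
      constructor <;> nlinarith)
    (fun z => by
      have h1 : HasFDerivAt R₁ (-((fderiv ℝ F (z, s z)).comp
          ((ContinuousLinearMap.id ℝ V).prod (fderiv ℝ s z))) - fderiv ℝ D z) z :=
        (HasFDerivAt.fun_neg (HasFDerivAt.comp (g := F) z (hFd (z, s z)).hasFDerivAt
          ((hasFDerivAt_id z).prodMk (hsd z).hasFDerivAt))).fun_sub (hDd z).hasFDerivAt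
      rw [h1.fderiv]
      refine ContinuousLinearMap.opNorm_le_bound _ hε₁.le fun v => ?_
      -- Envelope argument: the vertical derivative of F vanishes at `s z`, so the derivative of `s`
      -- drops out and only a first-order bound on R is needed.
      have h2 : fderiv ℝ F (z, s z) (v, fderiv ℝ s z v) =
          -fderiv ℝ D z v + fderiv ℝ R (z, s z) (v, 0) := by
        have h3 : ((v, fderiv ℝ s z v) : V × ℝ) = (v, 0) + fderiv ℝ s z v • (0, 1) := by simp
        rw [h3, map_add, map_smul, hs0, hFf]
        simp
      have h4 : (-((fderiv ℝ F (z, s z)).comp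
          ((ContinuousLinearMap.id ℝ V).prod (fderiv ℝ s z))) - fderiv ℝ D z) v =
          -fderiv ℝ R (z, s z) (v, 0) := by
        simp [h2]
      rw [h4, norm_neg]
      have h5 : ‖((v, 0) : V × ℝ)‖ = ‖v‖ := by simp [Prod.norm_def]
      have h6 := (fderiv ℝ R (z, s z)).le_of_opNorm_le (hR1 _) (v, 0)
      rw [h5] at h6
      exact h6.trans (mul_le_mul_of_nonneg_right (by linarith) (norm_nonneg v)))
  -- the normalised second coordinate
  have hρs : ContDiff ℝ ∞ fun z => (Real.sqrt (ρ z))⁻¹ :=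
    (hρ.sqrt fun z => (hρpos z).ne').inv fun z => (Real.sqrt_pos.2 (hρpos z)).ne'
  have hρ0 : ∀ z, 0 < (Real.sqrt (ρ z))⁻¹ := fun z => inv_pos.2 (Real.sqrt_pos.2 (hρpos z))
  -- Dividing by √ρ turns Y² = ρ · (D ∘ κ) into Y₁² = D ∘ κ.
  set Y₁ : V × ℝ → ℝ := fun x => (Real.sqrt (ρ x.1))⁻¹ * Y x with hY₁
  have hY₁s : ContDiff ℝ ∞ Y₁ := (hρs.comp contDiff_fst).mul hY
  obtain ⟨Φ, hΦ, hΦs, hΦe⟩ := exists_equiv_triangular hY₁s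
    (fun x => by
      obtain ⟨z, y⟩ := x
      have h1 := (hY₁s.differentiable (by simp) (z, y)).hasFDerivAt.hasDerivAt_snd
      have h2 : HasDerivAt (fun t => Y₁ (z, t))
          ((Real.sqrt (ρ z))⁻¹ * fderiv ℝ Y (z, y) (0, 1)) y :=
        ((hYd (z, y)).hasFDerivAt.hasDerivAt_snd).const_mul (Real.sqrt (ρ z))⁻¹
      rw [h1.unique h2]
      exact mul_pos (hρ0 z) (hYpos _))
    (fun z y => by
      obtain ⟨y', hy'⟩ := hYsurj z (y / (Real.sqrt (ρ z))⁻¹)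
      refine ⟨y', ?_⟩
      simp only at hy'
      simp only [hY₁, hy']
      exact mul_div_cancel₀ _ (hρ0 z).ne')
  refine ⟨Ψ, Φ.trans (κ.prodCongr (Equiv.refl ℝ)), κ, hΨ, hΨs, ?_, ?_, hκs, hκss, hΨe, hκC,
    fun x => ?_, fun x => ?_⟩
  · exact ((hκs.comp contDiff_fst).prodMk contDiff_snd).comp hΦ
  · exact hΦs.comp ((hκss.comp contDiff_fst).prodMk contDiff_snd)
  · simp [hΦe]
  · obtain ⟨z, y⟩ := x
    have h1 : Φ.trans (κ.prodCongr (Equiv.refl ℝ)) (z, y) = (κ z, Y₁ (z, y)) := by simp [hΦe]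
    rw [h1, hRD]
    have h2 := hYe z y
    have h3 := hκD z
    have h4 : Y₁ (z, y) ^ 2 * ρ z = Y (z, y) ^ 2 := by
      simp only [hY₁]
      rw [mul_pow, inv_pow, Real.sq_sqrt (hρpos z).le]
      field_simp [(hρpos z).ne']
    have h5 : -F (z, s z) = ρ z * D (κ z) := by rw [← h3]; simp only [hR₁]; ring
    have h6 : F (z, y) = y ^ 2 - D z + R (z, y) := rfl
    have h7 : y ^ 2 - (D z - R (z, y)) = ρ z * (Y₁ (z, y) ^ 2 - D (κ z)) := by linarith
    simp only
    rw [← sub_eq_zero, h7, mul_eq_zero, or_iff_right (hρpos z).ne', sub_eq_zero]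

end FibredDiffeomorphism

/-! ### From the C^∞ topology to estimates on a normed space -/

section SmallInCharts

variable {E H E' H' E₁ : Type*}
  [NormedAddCommGroup E] [NormedSpace ℝ E] [TopologicalSpace H]
  [NormedAddCommGroup E'] [NormedSpace ℝ E'] [TopologicalSpace H']
  [NormedAddCommGroup E₁] [NormedSpace ℝ E₁]
  {I : ModelWithCorners ℝ E H} {I' : ModelWithCorners ℝ E' H'} [I.Boundaryless]
  {M N : Type*} [TopologicalSpace M] [ChartedSpace H M] [TopologicalSpace N] [ChartedSpace H' N]

theorem IsOpen.exists_bound_iteratedFDeriv {W L : Set E₁} (hW : IsOpen W) (hL : IsCompact L)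
    (hLW : L ⊆ W) {h : E₁ → E} (hh : ContDiffOn ℝ ∞ h W) (n : ℕ) :
    ∃ C ≥ 1, ∀ x ∈ L, ∀ k ≤ n, ‖iteratedFDeriv ℝ k h x‖ ≤ C := by
  have hb : ∀ k : ℕ, ∃ C, ∀ x ∈ L, ‖iteratedFDeriv ℝ k h x‖ ≤ C := fun k => by
    refine hL.exists_bound_of_continuousOn (ContinuousOn.congr ?_ fun x hx =>
      (iteratedFDerivWithin_of_isOpen (𝕜 := ℝ) (f := h) k hW (hLW hx)).symm)
    exact (hh.continuousOn_iteratedFDerivWithin (mod_cast le_top) hW.uniqueDiffOn).mono hLW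
  choose C hC using hb
  refine ⟨1 + ∑ k ∈ Finset.range (n + 1), |C k|, ?_, fun x hx k hk => ?_⟩
  · have : 0 ≤ ∑ k ∈ Finset.range (n + 1), |C k| := Finset.sum_nonneg fun _ _ => abs_nonneg _
    linarith
  · have h1 : |C k| ≤ ∑ k ∈ Finset.range (n + 1), |C k| :=
      Finset.single_le_sum (f := fun k => |C k|) (fun _ _ => abs_nonneg _)
        (Finset.mem_range.2 (by omega))
    linarith [hC k x hx, le_abs_self (C k)]

/-- Closeness in a pair of charts implies closeness after composition with a smooth map from a
normed space to the source manifold. -/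
theorem exists_bound_of_mem_smoothMapNbhd (f : C^∞⟮I, M; I', N⟯)
    {φ : OpenPartialHomeomorph M H} {ψ : OpenPartialHomeomorph N H'}
    (hφ : φ ∈ IsManifold.maximalAtlas I ∞ M) (hψ : ψ ∈ IsManifold.maximalAtlas I' ∞ N)
    {K : Set M} (hKφ : K ⊆ φ.source) (hfψ : ∀ p, f p ∈ ψ.source)
    {r : E₁ → M} {W L : Set E₁} (hW : IsOpen W) (hr : ContMDiffOn 𝓘(ℝ, E₁) I ∞ r W)
    (hL : IsCompact L) (hLW : L ⊆ W) (hrL : ∀ x ∈ L, r x ∈ K) (n : ℕ) {ε : ℝ} (hε : 0 < ε) :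
    ∃ δ > 0, ∀ g ∈ smoothMapNbhd I I' f φ ψ K n δ, ∀ x ∈ L, ∀ k ≤ n,
      ‖iteratedFDeriv ℝ k (fun x => ψ.extend I' (g (r x)) - ψ.extend I' (f (r x))) x‖ ≤ ε := by
  set W' : Set E₁ := W ∩ r ⁻¹' φ.source with hW'
  have hW'o : IsOpen W' := hr.continuousOn.isOpen_inter_preimage hW φ.open_source
  have hLW' : L ⊆ W' := fun x hx => ⟨hLW hx, hKφ (hrL x hx)⟩
  set h : E₁ → E := fun x => φ.extend I (r x) with hh
  have hhs : ContDiffOn ℝ ∞ h W' := by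
    rw [← contMDiffOn_iff_contDiffOn]
    exact (φ.contMDiffOn_extend hφ).comp (hr.mono Set.inter_subset_left) fun x hx => hx.2
  obtain ⟨C, hC1, hC⟩ := hW'o.exists_bound_iteratedFDeriv hL hLW' hhs n
  -- This cancels the constant n! Cⁿ in the bound for the derivatives of a composition; C ≥ 1 lets
  -- one exponent serve all orders up to n.
  refine ⟨ε / (n.factorial * C ^ n), by positivity, fun g hg x hx k hk => ?_⟩
  set δ := ε / (n.factorial * C ^ n) with hδ
  have hδ0 : 0 < δ := by positivity
  -- the maps read in the charts
  have hsymm : ContMDiffOn 𝓘(ℝ, E) I ∞ (φ.extend I).symm (φ.extend I).target := by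
    rw [φ.extend_target']
    exact contMDiffOn_extend_symm hφ
  have hto : IsOpen (φ.extend I).target := φ.isOpen_extend_target
  have hread : ∀ g : C^∞⟮I, M; I', N⟯, IsOpen ((φ.extend I).target ∩
      (fun q => g ((φ.extend I).symm q)) ⁻¹' ψ.source) ∧
      ContDiffOn ℝ ∞ (ψ.extend I' ∘ g ∘ (φ.extend I).symm) ((φ.extend I).target ∩
        (fun q => g ((φ.extend I).symm q)) ⁻¹' ψ.source) := fun g => by
    have h1 : ContMDiffOn 𝓘(ℝ, E) I' ∞ (fun q => g ((φ.extend I).symm q))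
        (φ.extend I).target := g.contMDiff.comp_contMDiffOn hsymm
    refine ⟨h1.continuousOn.isOpen_inter_preimage hto ψ.open_source, ?_⟩
    rw [← contMDiffOn_iff_contDiffOn]
    exact (ψ.contMDiffOn_extend hψ).comp (h1.mono Set.inter_subset_left) fun q hq => hq.2
  set t : Set E := (φ.extend I).target ∩ (fun q => g ((φ.extend I).symm q)) ⁻¹' ψ.source with ht
  have hto' : IsOpen t := (hread g).1
  have hgt := (hread g).2
  have hft : ContDiffOn ℝ ∞ (ψ.extend I' ∘ f ∘ (φ.extend I).symm) t :=
    (hread f).2.mono fun q hq => ⟨hq.1, hfψ _⟩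
  set s : Set E₁ := W' ∩ (fun x => g (r x)) ⁻¹' ψ.source with hs
  have hso : IsOpen s :=
    (g.contMDiff.continuous.comp_continuousOn (hr.continuousOn.mono Set.inter_subset_left)
      ).isOpen_inter_preimage hW'o ψ.open_source
  have hleft : ∀ x ∈ W', (φ.extend I).symm (h x) = r x := fun x hx =>
    φ.extend_left_inv hx.2
  have hst : Set.MapsTo h s t := fun x hx => by
    refine ⟨(φ.extend I).map_source (by rw [φ.extend_source]; exact hx.1.2), ?_⟩
    simp only [Set.mem_preimage]
    rw [hleft x hx.1]
    exact hx.2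
  have hxs : x ∈ s := ⟨hLW' hx, hg.1 (hrL x hx)⟩
  set Δ : E → E' := ψ.extend I' ∘ g ∘ (φ.extend I).symm - ψ.extend I' ∘ f ∘ (φ.extend I).symm
    with hΔ
  have hΔt : ContDiffOn ℝ ∞ Δ t := hgt.sub hft
  have heq : (fun x => ψ.extend I' (g (r x)) - ψ.extend I' (f (r x))) =ᶠ[𝓝 x] Δ ∘ h := by
    filter_upwards [hW'o.mem_nhds hxs.1] with y hy
    simp only [hΔ, Function.comp_apply, Pi.sub_apply]
    rw [hleft y hy]
  rw [(heq.iteratedFDeriv ℝ k).eq_of_nhds, ← iteratedFDerivWithin_of_isOpen k hso hxs]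
  have hbound := norm_iteratedFDerivWithin_comp_le hΔt (hhs.mono Set.inter_subset_left)
    (n := k) (mod_cast le_top) hto'.uniqueDiffOn hso.uniqueDiffOn hst hxs (C := δ) (D := C)
    (fun i hi => by
      rw [iteratedFDerivWithin_of_isOpen i hto' (hst hxs)]
      have h1 := hg.2 i (hi.trans hk) (r x) (hrL x hx)
      rw [hΔ, iteratedFDeriv_sub_apply
        (((hgt.contDiffAt (hto'.mem_nhds (hst hxs)))).of_le (mod_cast le_top))
        (((hft.contDiffAt (hto'.mem_nhds (hst hxs)))).of_le (mod_cast le_top))]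
      exact h1.le)
    (fun i hi hik => by
      rw [iteratedFDerivWithin_of_isOpen i hso hxs]
      exact (hC x hx i (hik.trans hk)).trans (le_self_pow₀ hC1 (by omega)))
  refine hbound.trans ?_
  have h1 : (k.factorial : ℝ) ≤ n.factorial := by exact_mod_cast Nat.factorial_le hk
  have h2 : C ^ k ≤ C ^ n := pow_le_pow_right₀ hC1 hk
  calc (k.factorial : ℝ) * δ * C ^ k ≤ n.factorial * δ * C ^ n :=
        mul_le_mul (mul_le_mul_of_nonneg_right h1 hδ0.le) h2 (by positivity) (by positivity)
    _ = ε := by rw [hδ]; field_simp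

variable [IsManifold I ∞ M] [CompactSpace M] [T2Space M] [LocallyCompactSpace M]

/-- Maps in a suitable `C^∞`-neighbourhood of `f` take values in a chart domain which contains the
image of `f`, and are as close to `f` as wanted in this chart. -/
theorem exists_isOpen_forall_bound (f : C^∞⟮I, M; I', N⟯) {ψ : OpenPartialHomeomorph N H'}
    (hψ : ψ ∈ IsManifold.maximalAtlas I' ∞ N) (hfψ : ∀ p, f p ∈ ψ.source)
    {r : E₁ → M} {W L : Set E₁} (hW : IsOpen W) (hr : ContMDiffOn 𝓘(ℝ, E₁) I ∞ r W)
    (hL : IsCompact L) (hLW : L ⊆ W) (n : ℕ) {ε : ℝ} (hε : 0 < ε) :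
    ∃ U : Set C^∞⟮I, M; I', N⟯, IsOpen[smoothMapTopology I I'] U ∧ f ∈ U ∧
      ∀ g ∈ U, (∀ p, g p ∈ ψ.source) ∧ ∀ x ∈ L, ∀ k ≤ n,
        ‖iteratedFDeriv ℝ k (fun x => ψ.extend I' (g (r x)) - ψ.extend I' (f (r x))) x‖ ≤ ε := by
  -- Finitely many compact neighbourhoods inside chart domains cover M, so a finite intersection of
  -- basic open sets controls g everywhere.
  have hK : ∀ p : M, ∃ K : Set M, K ∈ 𝓝 p ∧ IsCompact K ∧ K ⊆ (chartAt H p).source := fun p => by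
    obtain ⟨K, hK1, hK2, hK3⟩ := local_compact_nhds
      ((chartAt H p).open_source.mem_nhds (mem_chart_source H p))
    exact ⟨K, hK1, hK3, hK2⟩
  choose K hKn hKc hKs using hK
  obtain ⟨T, hT⟩ := CompactSpace.elim_nhds_subcover K hKn
  have hcover : ∀ q : M, ∃ p ∈ T, q ∈ K p := fun q => by
    have : q ∈ ⋃ p ∈ T, K p := by rw [hT]; trivial
    simpa using this
  have hδ : ∀ p : M, ∃ δ > 0, ∀ g ∈ smoothMapNbhd I I' f (chartAt H p) ψ (K p) n δ,
      ∀ x ∈ L ∩ r ⁻¹' K p, ∀ k ≤ n,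
      ‖iteratedFDeriv ℝ k (fun x => ψ.extend I' (g (r x)) - ψ.extend I' (f (r x))) x‖ ≤ ε :=
    fun p => exists_bound_of_mem_smoothMapNbhd f (IsManifold.chart_mem_maximalAtlas p) hψ (hKs p)
      hfψ hW hr
      (hL.of_isClosed_subset ((hr.continuousOn.mono hLW).preimage_isClosed_of_isClosed
        hL.isClosed (hKc p).isClosed) Set.inter_subset_left)
      (Set.inter_subset_left.trans hLW) (fun x hx => hx.2) n hε
  choose δ hδ0 hδ using hδ
  let B : M → Set C^∞⟮I, M; I', N⟯ := fun p =>
    smoothMapNbhd I I' f (chartAt H p) ψ (K p) n (δ p)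
  refine ⟨⋂ p ∈ T, B p, ?_, ?_, fun g hg => ⟨fun q => ?_, fun x hx k hk => ?_⟩⟩
  · let := smoothMapTopology I I' (M := M) (N := N)
    refine isOpen_biInter_finset fun p _ => TopologicalSpace.isOpen_generateFrom_of_mem
      ⟨f, chartAt H p, ψ, K p, n, δ p, IsManifold.chart_mem_maximalAtlas p, hψ, hKc p, hKs p,
        fun q _ => hfψ q, hδ0 p, rfl⟩
  · rw [Set.mem_iInter₂]
    intro p _
    exact ⟨fun q _ => hfψ q, fun k _ q _ => by rw [sub_self, norm_zero]; exact hδ0 p⟩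
  · rw [Set.mem_iInter₂] at hg
    obtain ⟨p, hp, hq⟩ := hcover q
    exact (hg p hp).1 hq
  · rw [Set.mem_iInter₂] at hg
    obtain ⟨p, hp, hq⟩ := hcover (r x)
    exact hδ p g (hg p hp) x ⟨hx, hq⟩ k hk

/-- Cut off by a bump function `χ`, the difference of `f` and a map close to it is a small
function on the normed space. -/
theorem exists_isOpen_forall_cutoff_bound (f : C^∞⟮I, M; I', N⟯) {ψ : OpenPartialHomeomorph N H'}
    (hψ : ψ ∈ IsManifold.maximalAtlas I' ∞ N) (hfψ : ∀ p, f p ∈ ψ.source)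
    {r : E₁ → M} {W : Set E₁} (hW : IsOpen W) (hr : ContMDiffOn 𝓘(ℝ, E₁) I ∞ r W)
    {χ : E₁ → ℝ} (hχ : ContDiff ℝ ∞ χ) (hχc : HasCompactSupport χ) (hχW : tsupport χ ⊆ W)
    (n : ℕ) {ε : ℝ} (hε : 0 < ε) :
    ∃ U : Set C^∞⟮I, M; I', N⟯, IsOpen[smoothMapTopology I I'] U ∧ f ∈ U ∧
      ∀ g ∈ U, (∀ p, g p ∈ ψ.source) ∧
        ContDiff ℝ ∞ (fun x => χ x • (ψ.extend I' (g (r x)) - ψ.extend I' (f (r x)))) ∧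
        ∀ x, ∀ k ≤ n, ‖iteratedFDeriv ℝ k
          (fun x => χ x • (ψ.extend I' (g (r x)) - ψ.extend I' (f (r x)))) x‖ ≤ ε := by
  obtain ⟨C, hC1, hC⟩ := isOpen_univ.exists_bound_iteratedFDeriv hχc.isCompact
    (Set.subset_univ (tsupport χ)) hχ.contDiffOn n
  -- The factor 2ⁿ is the sum of the binomial coefficients in Leibniz's rule, and C bounds the
  -- derivatives of the cutoff.
  obtain ⟨U, hU, hfU, hUg⟩ := exists_isOpen_forall_bound f hψ hfψ hW hr hχc.isCompact hχW n
    (ε := ε / (2 ^ n * C)) (by positivity)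
  refine ⟨U, hU, hfU, fun g hg => ?_⟩
  obtain ⟨hgψ, hgb⟩ := hUg g hg
  set δ := ε / (2 ^ n * C) with hδ
  have hδ0 : 0 < δ := by positivity
  have hsm : ∀ g : C^∞⟮I, M; I', N⟯, (∀ p, g p ∈ ψ.source) →
      ContDiffOn ℝ ∞ (fun x => ψ.extend I' (g (r x))) W := fun g hg => by
    rw [← contMDiffOn_iff_contDiffOn]
    exact (ψ.contMDiffOn_extend hψ).comp (g.contMDiff.comp_contMDiffOn hr) fun x _ => hg _
  have hΔ : ContDiffOn ℝ ∞ (fun x => ψ.extend I' (g (r x)) - ψ.extend I' (f (r x))) W :=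
    (hsm g hgψ).sub (hsm f hfψ)
  set Δ : E₁ → E' := fun x => ψ.extend I' (g (r x)) - ψ.extend I' (f (r x)) with hΔdef
  have hzero : ∀ x ∉ tsupport χ, (fun x => χ x • Δ x) =ᶠ[𝓝 x] fun _ => 0 := fun x hx => by
    filter_upwards [(isClosed_tsupport χ).isOpen_compl.mem_nhds hx] with y hy
    rw [image_eq_zero_of_notMem_tsupport hy, zero_smul]
  refine ⟨hgψ, ?_, fun x k hk => ?_⟩
  · rw [contDiff_iff_contDiffAt]
    intro x
    by_cases hx : x ∈ tsupport χ
    · exact hχ.contDiffAt.smul (hΔ.contDiffAt (hW.mem_nhds (hχW hx)))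
    · exact contDiffAt_const.congr_of_eventuallyEq (hzero x hx)
  · by_cases hx : x ∈ tsupport χ
    · rw [← iteratedFDerivWithin_of_isOpen k hW (hχW hx)]
      refine (norm_iteratedFDerivWithin_smul_le hχ.contDiffOn hΔ hW.uniqueDiffOn (hχW hx)
        (n := k) (mod_cast le_top)).trans ?_
      calc _ ≤ ∑ i ∈ Finset.range (k + 1), (k.choose i : ℝ) * C * δ := by
            refine Finset.sum_le_sum fun i hi => ?_
            have hik : i ≤ k := Nat.lt_succ_iff.1 (Finset.mem_range.1 hi)
            rw [iteratedFDerivWithin_of_isOpen i hW (hχW hx),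
              iteratedFDerivWithin_of_isOpen (k - i) hW (hχW hx)]
            exact mul_le_mul (mul_le_mul_of_nonneg_left (hC x hx i (hik.trans hk))
              (Nat.cast_nonneg _)) (hgb x hx (k - i) (by omega)) (norm_nonneg _) (by positivity)
        _ = 2 ^ k * C * δ := by
            rw [← Finset.sum_mul, ← Finset.sum_mul]
            congr 2
            exact_mod_cast Nat.sum_range_choose k
        _ ≤ 2 ^ n * C * δ := by
            have : (2 : ℝ) ^ k ≤ 2 ^ n := pow_le_pow_right₀ one_le_two hk
            gcongr
        _ = ε := by rw [hδ]; field_simp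
    · rw [((hzero x hx).iteratedFDeriv ℝ k).eq_of_nhds]
      rcases k with _ | k
      · simpa using hε.le
      · rw [iteratedFDeriv_const_of_ne (by omega)]
        simpa using hε.le

end SmallInCharts

noncomputable section

/-! ### Normalisation to the unit circle -/

/-- The direction of a complex number, as a point of the circle. -/
def Complex.direction (z : ℂ) : Circle := Circle.exp z.arg

theorem Complex.norm_mul_direction (z : ℂ) : (‖z‖ : ℂ) * z.direction = z := by
  rw [direction, Circle.coe_exp]
  exact Complex.norm_mul_exp_arg_mul_I z

theorem Complex.direction_mul_pos (t : Circle) {s : ℝ} (hs : 0 < s) :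
    ((t : ℂ) * s).direction = t := by
  rw [direction, mul_comm, Complex.arg_real_mul _ hs, Circle.exp_arg]

theorem Complex.direction_mul {z w : ℂ} (hz : z ≠ 0) (hw : w ≠ 0) :
    (z * w).direction = z.direction * w.direction := by
  ext
  have h1 := Complex.norm_mul_direction z
  have h2 := Complex.norm_mul_direction w
  have h3 := Complex.norm_mul_direction (z * w)
  have hzn : (‖z‖ : ℂ) ≠ 0 := by simpa using hz
  have hwn : (‖w‖ : ℂ) ≠ 0 := by simpa using hw
  rw [norm_mul, Complex.ofReal_mul] at h3
  rw [Circle.coe_mul]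
  apply mul_left_cancel₀ (mul_ne_zero hzn hwn)
  rw [h3]
  linear_combination -w * h1 - (‖z‖ : ℂ) * z.direction * h2

/-- The argument jumps along the negative axis. Multiplicativity of the direction reduces to w/z
near 1, where the principal logarithm is smooth. -/
theorem Complex.contMDiffAt_direction {z : ℂ} (hz : z ≠ 0) :
    ContMDiffAt 𝓘(ℝ, ℂ) (𝓡 1) ∞ Complex.direction z := by
  have h1 : ContMDiffAt 𝓘(ℝ, ℂ) (𝓡 1) ∞
      (fun w : ℂ => z.direction * Circle.exp (Complex.log (w / z)).im) z := by
    refine contMDiffAt_const.mul (contMDiff_circleExp.contMDiffAt.comp z ?_)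
    refine ContDiffAt.contMDiffAt ?_
    have h2 : ContDiffAt ℝ ∞ Complex.log (z / z) := by
      rw [div_self hz]
      exact (Complex.contDiffAt_log Complex.one_mem_slitPlane).restrict_scalars ℝ
    have h3 : ContDiffAt ℝ ∞ (fun w : ℂ => Complex.log (w / z)) z :=
      ContDiffAt.comp (g := Complex.log) (f := fun w : ℂ => w / z) z h2 (contDiffAt_id.div_const z)
    exact Complex.imCLM.contDiff.contDiffAt.comp z h3
  refine h1.congr_of_eventuallyEq ?_
  filter_upwards [isOpen_ne.mem_nhds hz] with w hw
  have h3 : w = z * (w / z) := by field_simp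
  conv_lhs => rw [h3]
  rw [Complex.direction_mul hz (div_ne_zero hw hz), Complex.log_im]
  rfl

/-! ### The torus as the double h² = D(z) in ℂ × ℝ -/

namespace FoldedTorus

variable (a b c : ℝ)

/-- The auxiliary function `ab + c z̄`. -/
def pole (z : ℂ) : ℂ := a * b + c * (starRingEnd ℂ) z

/-- The auxiliary function `(|z|² + c² - a² - b²) / 2`. -/
def power (z : ℂ) : ℝ := (Complex.normSq z + c ^ 2 - a ^ 2 - b ^ 2) / 2

/-- The function whose nonnegativity set is the image of the torus. -/
def disc (z : ℂ) : ℝ := Complex.normSq (pole a b c z) - power a b c z ^ 2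

/-- The map `(u, u / v) ↦ c u + a v + b u v` of the torus to the plane. -/
def plane (p : Circle × Circle) : ℂ :=
  c * (p.1 : ℂ) + a * ((p.1 / p.2 : Circle) : ℂ) + b * (p.1 : ℂ) * ((p.1 / p.2 : Circle) : ℂ)

/-- The height function, which together with `plane` embeds the torus into `ℂ × ℝ`. -/
def height (p : Circle × Circle) : ℝ := ((p.1 : ℂ) * pole a b c (plane a b c p)).im

/-- The map `(plane, height)` from the torus to `ℂ × ℝ`. -/
def embed (p : Circle × Circle) : ℂ × ℝ := (plane a b c p, height a b c p)

/-- A positive multiple of the first coordinate of the retraction. -/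
def preFst (x : ℂ × ℝ) : ℂ :=
  (power a b c x.1 + x.2 * Complex.I) * (starRingEnd ℂ) (pole a b c x.1)

/-- A positive multiple of the quotient of the coordinates of the retraction. -/
def preSnd (x : ℂ × ℝ) : ℂ :=
  (x.1 - c * ((preFst a b c x).direction : ℂ)) *
    (starRingEnd ℂ) (a + b * ((preFst a b c x).direction : ℂ))

/-- The retraction of a neighbourhood of the embedded torus. -/
def retract (x : ℂ × ℝ) : Circle × Circle :=
  ((preFst a b c x).direction, (preFst a b c x).direction / (preSnd a b c x).direction)

/-- The domain on which the retraction is smooth. -/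
def retractDomain : Set (ℂ × ℝ) := {x | preFst a b c x ≠ 0} ∩ {x | preSnd a b c x ≠ 0}

theorem disc_eq (z : ℂ) : disc a b c z =
    (a * b + c * z.re) ^ 2 + (c * z.im) ^ 2 -
      ((z.re ^ 2 + z.im ^ 2 + c ^ 2 - a ^ 2 - b ^ 2) / 2) ^ 2 := by
  simp only [disc, pole, power, Complex.normSq_apply]
  simp
  ring

theorem contDiff_disc : ContDiff ℝ ∞ (disc a b c) := by
  have hre : ContDiff ℝ ∞ fun z : ℂ => z.re := Complex.reCLM.contDiff
  have him : ContDiff ℝ ∞ fun z : ℂ => z.im := Complex.imCLM.contDiff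
  rw [show disc a b c = _ from funext (disc_eq a b c)]
  fun_prop

/-- A rearrangement of |z − cu|² = |v(a + bu)|² for unimodular u, v. -/
theorem re_mul_pole (p : Circle × Circle) :
    ((p.1 : ℂ) * pole a b c (plane a b c p)).re = power a b c (plane a b c p) := by
  set u := p.1
  set v := p.1 / p.2 with hv
  have hp : plane a b c p = c * (u : ℂ) + a * (v : ℂ) + b * (u : ℂ) * (v : ℂ) := rfl
  have hu : (u : ℂ).re ^ 2 + (u : ℂ).im ^ 2 = 1 := by
    have := Circle.normSq_coe u
    rw [Complex.normSq_apply] at this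
    linarith
  have hvv : (v : ℂ).re ^ 2 + (v : ℂ).im ^ 2 = 1 := by
    have := Circle.normSq_coe v
    rw [Complex.normSq_apply] at this
    linarith
  simp only [hp, pole, power, Complex.normSq_apply]
  clear_value u v
  simp
  generalize (u : ℂ).re = x at *
  generalize (u : ℂ).im = y at *
  generalize (v : ℂ).re = s at *
  generalize (v : ℂ).im = t at *
  have hx : x ^ 2 = 1 - y ^ 2 := by linarith
  have hs : s ^ 2 = 1 - t ^ 2 := by linarith
  linear_combination (c ^ 2 / 2 - b ^ 2 / 2 * (s ^ 2 + t ^ 2)) * hu -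
    (a ^ 2 / 2 + a * b * x + b ^ 2 / 2) * hvv

theorem height_sq (p : Circle × Circle) :
    height a b c p ^ 2 = disc a b c (plane a b c p) := by
  have h1 : Complex.normSq ((p.1 : ℂ) * pole a b c (plane a b c p)) =
      Complex.normSq (pole a b c (plane a b c p)) := by
    rw [Complex.normSq_mul, Circle.normSq_coe, one_mul]
  rw [Complex.normSq_apply, re_mul_pole] at h1
  rw [disc, ← h1, height]
  ring

variable {a b c}

/-- The side-lengths are positive and pairwise distinct. -/
def Admissible (a b c : ℝ) : Prop := 0 < a ∧ 0 < b ∧ 0 < c ∧ a ≠ b ∧ b ≠ c ∧ a ≠ c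

theorem sq_ne_sq {x y : ℝ} (hx : 0 < x) (hy : 0 < y) (h : x ≠ y) : x ^ 2 - y ^ 2 ≠ 0 := by
  have : x ^ 2 - y ^ 2 = (x - y) * (x + y) := by ring
  rw [this]
  exact mul_ne_zero (sub_ne_zero.2 h) (by positivity)

/-- If P = 0 then z = −ab/c, and there 2c²K = (c² − a²)(c² − b²). So D = −K² < 0 at the zero of P,
which therefore stays off the image of the torus. -/
theorem Admissible.power_ne_zero (h : Admissible a b c) {z : ℂ} (hz : pole a b c z = 0) :
    power a b c z ≠ 0 := by
  obtain ⟨ha, hb, hc, hab, hbc, hac⟩ := h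
  intro h0
  have h1 : Complex.normSq (pole a b c z) = 0 := by rw [hz, map_zero]
  simp only [pole, power, Complex.normSq_apply] at h0 h1
  simp at h1
  have hre : a * b + c * z.re = 0 := by nlinarith [mul_self_nonneg (a * b + c * z.re), mul_self_nonneg (c * z.im)]
  have him : c * z.im = 0 := by nlinarith [mul_self_nonneg (a * b + c * z.re), mul_self_nonneg (c * z.im)]
  have him' : z.im = 0 := (mul_eq_zero.1 him).resolve_left hc.ne'
  rw [him'] at h0
  have h2 : (c ^ 2 - a ^ 2) * (c ^ 2 - b ^ 2) = 0 := by
    linear_combination 2 * c ^ 2 * h0 + (a * b - c * z.re) * hre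
  exact mul_ne_zero (sq_ne_sq hc ha hac.symm) (sq_ne_sq hc hb hbc.symm) h2

/-- At a critical zero z = x + iy, the gradient gives c(ab + cx) = Kx and c²y = Ky. If y ≠ 0 then K
= c², forcing abc = 0. If y = 0 then ab + cx = ±K, and either K = 0, giving (c² − a²)(c² − b²) = 0,
or x = ±c, giving (a ± b)² = 0; all contradict distinctness. -/
theorem Admissible.fderiv_disc_ne_zero (h : Admissible a b c) {z : ℂ} (hz : disc a b c z = 0) :
    fderiv ℝ (disc a b c) z ≠ 0 := by
  obtain ⟨ha, hb, hc, hab, hbc, hac⟩ := h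
  intro h0
  set x := z.re with hx
  set y := z.im with hy
  set K := (x ^ 2 + y ^ 2 + c ^ 2 - a ^ 2 - b ^ 2) / 2 with hK
  have hd := ((contDiff_disc a b c).differentiable (by simp) z).hasFDerivAt
  rw [h0] at hd
  have hd' : ∀ v : ℂ, HasDerivAt (fun t : ℝ => disc a b c (z + t * v)) 0 0 := fun v => by
    have h2 : HasDerivAt (fun t : ℝ => z + t * v) v 0 := by
      simpa using ((Complex.ofRealCLM.hasDerivAt (x := (0 : ℝ))).mul_const v).const_add z
    have h1 : HasFDerivAt (disc a b c) (0 : ℂ →L[ℝ] ℝ) (z + ((0 : ℝ) : ℂ) * v) := by simpa using hd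
    exact h1.comp_hasDerivAt (0 : ℝ) h2
  have e1 : c * (a * b + c * x) = K * x := by
    have h1 : HasDerivAt (fun t : ℝ => disc a b c (z + t * 1))
        (2 * (a * b + c * x) * c - 2 * K * x) 0 := by
      have : (fun t : ℝ => disc a b c (z + t * 1)) = fun t => (a * b + c * (x + t)) ^ 2 +
          (c * y) ^ 2 - (((x + t) ^ 2 + y ^ 2 + c ^ 2 - a ^ 2 - b ^ 2) / 2) ^ 2 := by
        ext t; rw [disc_eq]; simp [hx, hy]
      rw [this]
      have hxt : HasDerivAt (fun t : ℝ => x + t) 1 0 := (hasDerivAt_id' 0).const_add x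
      refine ((((hxt.const_mul c).const_add (a * b)).fun_pow 2).add_const ((c * y) ^ 2)).fun_sub
        (((((((hxt.fun_pow 2).add_const (y ^ 2)).add_const (c ^ 2)).sub_const (a ^ 2)).sub_const
          (b ^ 2)).div_const 2).fun_pow 2) |>.congr_deriv ?_
      simp [hK]
    linarith [(hd' 1).unique h1]
  have e2 : c ^ 2 * y = K * y := by
    have h1 : HasDerivAt (fun t : ℝ => disc a b c (z + t * Complex.I))
        (2 * (c * y) * c - 2 * K * y) 0 := by
      have : (fun t : ℝ => disc a b c (z + t * Complex.I)) = fun t => (a * b + c * x) ^ 2 +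
          (c * (y + t)) ^ 2 - ((x ^ 2 + (y + t) ^ 2 + c ^ 2 - a ^ 2 - b ^ 2) / 2) ^ 2 := by
        ext t; rw [disc_eq]; simp [hx, hy]
      rw [this]
      have hyt : HasDerivAt (fun t : ℝ => y + t) 1 0 := (hasDerivAt_id' 0).const_add y
      refine (((hyt.const_mul c).fun_pow 2).const_add ((a * b + c * x) ^ 2)).fun_sub
        ((((((hyt.fun_pow 2).const_add (x ^ 2)).add_const (c ^ 2)).sub_const (a ^ 2)).sub_const
          (b ^ 2)).div_const 2 |>.fun_pow 2) |>.congr_deriv ?_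
      simp [hK]
    linarith [(hd' Complex.I).unique h1]
  rw [disc_eq, ← hx, ← hy, ← hK] at hz
  by_cases hy0 : y = 0
  · rw [hy0] at hz hK
    have h1 : (a * b + c * x - K) * (a * b + c * x + K) = 0 := by linear_combination hz
    rcases mul_eq_zero.1 h1 with h2 | h2
    · have h3 : K * (x - c) = 0 := by linear_combination -e1 + c * h2
      rcases mul_eq_zero.1 h3 with h4 | h4
      · have h5 : (c ^ 2 - a ^ 2) * (c ^ 2 - b ^ 2) = 0 := by
          linear_combination 2 * c ^ 2 * (h4 - hK) + (a * b - c * x) * (h2 + h4)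
        exact mul_ne_zero (sq_ne_sq hc ha hac.symm) (sq_ne_sq hc hb hbc.symm) h5
      · have h5 : (a + b) ^ 2 = 0 := by
          linear_combination 2 * h2 + 2 * hK + (x - c) * h4
        have : 0 < a + b := by positivity
        exact (pow_pos this 2).ne' h5
    · have h3 : K * (x + c) = 0 := by linear_combination -e1 + c * h2
      rcases mul_eq_zero.1 h3 with h4 | h4
      · have h5 : (c ^ 2 - a ^ 2) * (c ^ 2 - b ^ 2) = 0 := by
          linear_combination 2 * c ^ 2 * (h4 - hK) + (a * b - c * x) * (h2 - h4)
        exact mul_ne_zero (sq_ne_sq hc ha hac.symm) (sq_ne_sq hc hb hbc.symm) h5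
      · have h5 : (a - b) ^ 2 = 0 := by
          linear_combination -2 * h2 + 2 * hK + (x + c) * h4
        exact pow_ne_zero 2 (sub_ne_zero.2 hab) h5
  · have h1 : K = c ^ 2 := (mul_right_cancel₀ hy0 e2).symm
    rw [h1] at e1
    have h2 : a * b * c = 0 := by linear_combination e1
    exact (by positivity : a * b * c ≠ 0) h2

theorem normSq_add_mul_circle (u : Circle) :
    Complex.normSq (a + b * (u : ℂ)) = a ^ 2 + b ^ 2 + 2 * a * b * (u : ℂ).re := by
  have hu := Circle.normSq_coe u
  rw [Complex.normSq_apply] at hu ⊢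
  simp
  linear_combination b ^ 2 * hu

theorem normSq_sub_mul_circle (z : ℂ) (u : Circle) :
    Complex.normSq (z - c * (u : ℂ)) =
      Complex.normSq z + c ^ 2 - 2 * ((u : ℂ) * (c * (starRingEnd ℂ) z)).re := by
  have hu := Circle.normSq_coe u
  rw [Complex.normSq_apply] at hu
  rw [Complex.normSq_apply, Complex.normSq_apply]
  simp
  linear_combination c ^ 2 * hu

theorem Admissible.add_mul_circle_ne_zero (h : Admissible a b c) (u : Circle) :
    (a + b * (u : ℂ)) ≠ 0 := by
  obtain ⟨ha, hb, hc, hab, hbc, hac⟩ := h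
  intro h0
  have h1 : (a : ℂ) = -(b * (u : ℂ)) := eq_neg_of_add_eq_zero_left h0
  have h2 := congrArg norm h1
  simp [abs_of_pos ha, abs_of_pos hb, Circle.norm_coe] at h2
  exact hab h2

theorem Admissible.pole_ne_zero (h : Admissible a b c) {x : ℂ × ℝ}
    (hx : x.2 ^ 2 = disc a b c x.1) : pole a b c x.1 ≠ 0 := fun h0 => by
  have h1 := h.power_ne_zero h0
  rw [disc, h0, map_zero] at hx
  have : 0 < power a b c x.1 ^ 2 := by positivity
  nlinarith [sq_nonneg x.2]

/-- On the surface |K + ih| = |P|, so u = (K + ih)/P is unimodular and `preFst` equals u|P|². -/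
theorem Admissible.preFst_eq (h : Admissible a b c) {x : ℂ × ℝ}
    (hx : x.2 ^ 2 = disc a b c x.1) :
    preFst a b c x ≠ 0 ∧ ((preFst a b c x).direction : ℂ) * pole a b c x.1 =
      power a b c x.1 + x.2 * Complex.I := by
  have hp := h.pole_ne_zero hx
  have hn : Complex.normSq (power a b c x.1 + x.2 * Complex.I : ℂ) =
      Complex.normSq (pole a b c x.1) := by
    rw [Complex.normSq_add_mul_I, hx, disc]; ring
  have hnorm : ‖(power a b c x.1 + x.2 * Complex.I : ℂ)‖ = ‖pole a b c x.1‖ := by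
    rw [← sq_eq_sq₀ (norm_nonneg _) (norm_nonneg _), ← Complex.normSq_eq_norm_sq,
      ← Complex.normSq_eq_norm_sq, hn]
  have hne : preFst a b c x ≠ 0 := by
    refine mul_ne_zero (fun h0 => hp ?_) (by simpa using hp)
    rw [h0, norm_zero] at hnorm
    exact norm_eq_zero.1 hnorm.symm
  refine ⟨hne, ?_⟩
  have h1 := Complex.norm_mul_direction (preFst a b c x)
  have h2 : ‖preFst a b c x‖ = ‖pole a b c x.1‖ ^ 2 := by
    rw [preFst, norm_mul, hnorm, Complex.norm_conj, sq]
  rw [h2] at h1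
  have h3 : ((‖pole a b c x.1‖ ^ 2 : ℝ) : ℂ) =
      pole a b c x.1 * (starRingEnd ℂ) (pole a b c x.1) := by
    rw [Complex.mul_conj, Complex.normSq_eq_norm_sq]
  rw [h3] at h1
  have hc : (starRingEnd ℂ) (pole a b c x.1) ≠ 0 := by simpa using hp
  apply mul_right_cancel₀ hc
  rw [preFst] at h1 ⊢
  linear_combination h1

/-- Re(uP) = K says |z − cu| = |a + bu|, so v = (z − cu)/(a + bu) is unimodular and `preSnd` equals
v|a + bu|². -/
theorem Admissible.preSnd_eq (h : Admissible a b c) {x : ℂ × ℝ}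
    (hx : x.2 ^ 2 = disc a b c x.1) :
    preSnd a b c x ≠ 0 ∧ ((preSnd a b c x).direction : ℂ) *
      (a + b * ((preFst a b c x).direction : ℂ)) = x.1 - c * ((preFst a b c x).direction : ℂ) := by
  obtain ⟨-, hu⟩ := h.preFst_eq hx
  set u := (preFst a b c x).direction with hudef
  have hab := h.add_mul_circle_ne_zero u
  have hn : Complex.normSq (x.1 - c * (u : ℂ)) = Complex.normSq (a + b * (u : ℂ)) := by
    have h1 : ((u : ℂ) * pole a b c x.1).re = power a b c x.1 := by rw [hu]; simp
    rw [normSq_add_mul_circle, normSq_sub_mul_circle]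
    simp only [pole, power] at h1
    simp at h1 ⊢
    linarith
  have hnorm : ‖x.1 - c * (u : ℂ)‖ = ‖a + b * (u : ℂ)‖ := by
    rw [← sq_eq_sq₀ (norm_nonneg _) (norm_nonneg _), ← Complex.normSq_eq_norm_sq,
      ← Complex.normSq_eq_norm_sq, hn]
  have hpre : preSnd a b c x = (x.1 - c * (u : ℂ)) * (starRingEnd ℂ) (a + b * (u : ℂ)) := rfl
  have hconj : (starRingEnd ℂ) (a + b * (u : ℂ)) ≠ 0 := (map_ne_zero _).2 hab
  refine ⟨?_, ?_⟩
  · rw [hpre]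
    refine mul_ne_zero (fun h0 => hab ?_) hconj
    rw [h0, norm_zero] at hnorm
    exact norm_eq_zero.1 hnorm.symm
  · have h1 := Complex.norm_mul_direction (preSnd a b c x)
    have h2 : ‖preSnd a b c x‖ = ‖a + b * (u : ℂ)‖ ^ 2 := by
      rw [hpre, norm_mul, hnorm, Complex.norm_conj, sq]
    have h3 : ((‖a + b * (u : ℂ)‖ ^ 2 : ℝ) : ℂ) =
        (a + b * (u : ℂ)) * (starRingEnd ℂ) (a + b * (u : ℂ)) := by
      rw [Complex.mul_conj, Complex.normSq_eq_norm_sq]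
    rw [h2, h3] at h1
    apply mul_right_cancel₀ hconj
    rw [hpre] at h1 ⊢
    linear_combination h1

theorem Admissible.mem_retractDomain (h : Admissible a b c) {x : ℂ × ℝ}
    (hx : x.2 ^ 2 = disc a b c x.1) : x ∈ retractDomain a b c :=
  ⟨(h.preFst_eq hx).1, (h.preSnd_eq hx).1⟩

theorem Admissible.embed_retract (h : Admissible a b c) {x : ℂ × ℝ}
    (hx : x.2 ^ 2 = disc a b c x.1) : embed a b c (retract a b c x) = x := by
  obtain ⟨-, hu⟩ := h.preFst_eq hx
  obtain ⟨-, hv⟩ := h.preSnd_eq hx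
  have hpl : plane a b c (retract a b c x) = x.1 := by
    simp only [plane, retract, div_div_cancel]
    linear_combination hv
  refine Prod.ext hpl ?_
  change height a b c (retract a b c x) = x.2
  rw [height, hpl]
  change (((preFst a b c x).direction : ℂ) * pole a b c x.1).im = x.2
  rw [hu]
  simp

theorem Admissible.retract_embed (h : Admissible a b c) (p : Circle × Circle) :
    retract a b c (embed a b c p) = p := by
  have hx : (embed a b c p).2 ^ 2 = disc a b c (embed a b c p).1 := height_sq a b c p
  have hpole : pole a b c (plane a b c p) ≠ 0 := h.pole_ne_zero hx
  have h1 : (preFst a b c (embed a b c p)).direction = p.1 := by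
    have h2 : preFst a b c (embed a b c p) =
        (p.1 : ℂ) * (Complex.normSq (pole a b c (plane a b c p)) : ℝ) := by
      have h3 : (power a b c (plane a b c p) + height a b c p * Complex.I : ℂ) =
          (p.1 : ℂ) * pole a b c (plane a b c p) := by
        rw [← re_mul_pole, height, Complex.re_add_im]
      rw [preFst, embed]
      simp only
      rw [h3, mul_assoc, Complex.mul_conj]
    rw [h2]
    exact Complex.direction_mul_pos _ (Complex.normSq_pos.2 hpole)
  have h2 : (preSnd a b c (embed a b c p)).direction = p.1 / p.2 := by
    have h3 : preSnd a b c (embed a b c p) =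
        ((p.1 / p.2 : Circle) : ℂ) * (Complex.normSq (a + b * (p.1 : ℂ)) : ℝ) := by
      rw [preSnd, h1, ← Complex.mul_conj, ← mul_assoc]
      congr 1
      simp only [embed, plane]
      ring
    rw [h3]
    exact Complex.direction_mul_pos _ (Complex.normSq_pos.2 (h.add_mul_circle_ne_zero p.1))
  simp only [retract, h1, h2, div_div_cancel]

variable (a b c)

theorem contDiff_preFst : ContDiff ℝ ∞ (preFst a b c) := by
  have hconj : ContDiff ℝ ∞ fun z : ℂ => (starRingEnd ℂ) z := Complex.conjCLE.contDiff
  have hof : ContDiff ℝ ∞ fun t : ℝ => (t : ℂ) := Complex.ofRealCLM.contDiff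
  have hre : ContDiff ℝ ∞ fun z : ℂ => z.re := Complex.reCLM.contDiff
  have him : ContDiff ℝ ∞ fun z : ℂ => z.im := Complex.imCLM.contDiff
  unfold preFst pole power
  simp only [Complex.normSq_apply]
  fun_prop

theorem isOpen_preFst : IsOpen {x | preFst a b c x ≠ 0} :=
  isOpen_ne_fun (contDiff_preFst a b c).continuous continuous_const

theorem contMDiff_coe_circle : ContMDiff (𝓡 1) 𝓘(ℝ, ℂ) ∞ (fun x : Circle => (x : ℂ)) := by
  have := finrank_real_complex_fact'
  exact contMDiff_coe_sphere

theorem contMDiffAt_preFst_direction {x : ℂ × ℝ} (hx : preFst a b c x ≠ 0) :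
    ContMDiffAt 𝓘(ℝ, ℂ × ℝ) (𝓡 1) ∞ (fun x => (preFst a b c x).direction) x :=
  (Complex.contMDiffAt_direction hx).comp x (contDiff_preFst a b c).contMDiff.contMDiffAt

theorem contDiffAt_preSnd {x : ℂ × ℝ} (hx : preFst a b c x ≠ 0) :
    ContDiffAt ℝ ∞ (preSnd a b c) x := by
  have h1 : ContDiffAt ℝ ∞ (fun x => ((preFst a b c x).direction : ℂ)) x := by
    rw [← contMDiffAt_iff_contDiffAt]
    exact contMDiff_coe_circle.contMDiffAt.comp x (contMDiffAt_preFst_direction a b c hx)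
  have hconj : ContDiff ℝ ∞ fun z : ℂ => (starRingEnd ℂ) z := Complex.conjCLE.contDiff
  exact (contDiffAt_fst.sub (contDiffAt_const.mul h1)).mul
    (hconj.contDiffAt.comp x (contDiffAt_const.add (contDiffAt_const.mul h1)))

theorem isOpen_retractDomain : IsOpen (retractDomain a b c) :=
  ContinuousOn.isOpen_inter_preimage
    (fun _ hx => (contDiffAt_preSnd a b c hx).continuousAt.continuousWithinAt)
    (isOpen_preFst a b c) isOpen_ne

theorem contMDiffAt_retract {x : ℂ × ℝ} (hx : x ∈ retractDomain a b c) :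
    ContMDiffAt 𝓘(ℝ, ℂ × ℝ) ((𝓡 1).prod (𝓡 1)) ∞ (retract a b c) x := by
  have h1 := contMDiffAt_preFst_direction a b c hx.1
  have h2 : ContMDiffAt 𝓘(ℝ, ℂ × ℝ) (𝓡 1) ∞ (fun x => (preSnd a b c x).direction) x :=
    (Complex.contMDiffAt_direction hx.2).comp x (contDiffAt_preSnd a b c hx.1).contMDiffAt
  exact h1.prodMk (h1.div h2)

theorem contMDiff_plane : ContMDiff ((𝓡 1).prod (𝓡 1)) 𝓘(ℝ, ℂ) ∞ (plane a b c) := by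
  have hu : ContMDiff ((𝓡 1).prod (𝓡 1)) 𝓘(ℝ, ℂ) ∞ fun p : Circle × Circle => (p.1 : ℂ) :=
    contMDiff_coe_circle.comp contMDiff_fst
  have hv : ContMDiff ((𝓡 1).prod (𝓡 1)) 𝓘(ℝ, ℂ) ∞
      fun p : Circle × Circle => ((p.1 / p.2 : Circle) : ℂ) :=
    contMDiff_coe_circle.comp (contMDiff_fst.div contMDiff_snd)
  have hF : ContDiff ℝ ∞ fun q : ℂ × ℂ => c * q.1 + a * q.2 + b * q.1 * q.2 := by fun_prop
  exact hF.contMDiff.comp (hu.prodMk_space hv)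

theorem contMDiff_height : ContMDiff ((𝓡 1).prod (𝓡 1)) 𝓘(ℝ, ℝ) ∞ (height a b c) := by
  have hu : ContMDiff ((𝓡 1).prod (𝓡 1)) 𝓘(ℝ, ℂ) ∞ fun p : Circle × Circle => (p.1 : ℂ) :=
    contMDiff_coe_circle.comp contMDiff_fst
  have hF : ContDiff ℝ ∞ fun q : ℂ × ℂ => (q.1 * pole a b c q.2).im := by
    have hconj : ContDiff ℝ ∞ fun z : ℂ => (starRingEnd ℂ) z := Complex.conjCLE.contDiff
    have h : ContDiff ℝ ∞ fun q : ℂ × ℂ => q.1 * pole a b c q.2 := by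
      unfold pole
      fun_prop
    exact Complex.imCLM.contDiff.comp h
  exact hF.contMDiff.comp (hu.prodMk_space (contMDiff_plane a b c))

theorem contMDiff_embed : ContMDiff ((𝓡 1).prod (𝓡 1)) 𝓘(ℝ, ℂ × ℝ) ∞ (embed a b c) :=
  (contMDiff_plane a b c).prodMk_space (contMDiff_height a b c)

variable {a b c}

/-- Zeros of D are images of torus points of height 0, hence lie in the compact image of the torus.
-/
theorem Admissible.isCompact_disc_eq_zero (h : Admissible a b c) :
    IsCompact {z | disc a b c z = 0} := by
  refine (isCompact_range (contMDiff_plane a b c).continuous).of_isClosed_subset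
    (isClosed_eq (contDiff_disc a b c).continuous continuous_const) fun z hz => ?_
  have hx : ((z, 0) : ℂ × ℝ).2 ^ 2 = disc a b c ((z, 0) : ℂ × ℝ).1 := by
    rw [Set.mem_ofPred_eq] at hz
    simp [hz]
  exact ⟨retract a b c (z, 0), congrArg Prod.fst (h.embed_retract hx)⟩

end FoldedTorus

end

/-! ### The chart of the sphere centred at ∞ and omitting 1 -/

noncomputable section

namespace RiemannSphere

theorem affineChart_target : affineChart.target = Set.univ := by
  simp [affineChart]

theorem infinityChart_target : infinityChart.target = Set.univ := by
  simp [infinityChart, affineChart_target]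

theorem infinityChart_infty : infinityChart OnePoint.infty = 0 := by
  change affineChart (inversionFun OnePoint.infty) = 0
  rw [inversionFun_infty, affineChart_coe]

theorem mem_affineChart_source {x : OnePoint ℂ} :
    x ∈ affineChart.source ↔ x ≠ OnePoint.infty := by
  rw [affineChart_source, OnePoint.ne_infty_iff_exists]
  rfl

theorem mem_infinityChart_source {x : OnePoint ℂ} :
    x ∈ infinityChart.source ↔ x ≠ ((0 : ℂ) : OnePoint ℂ) := by
  have h : x ∈ infinityChart.source ↔ inversionFun x ∈ affineChart.source := by
    simp only [infinityChart, OpenPartialHomeomorph.trans_source,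
      Homeomorph.toOpenPartialHomeomorph_source, Set.univ_inter]
    rfl
  rw [h, mem_affineChart_source, not_iff_not]
  constructor
  · intro h
    rw [← inversionFun_involutive x, h, inversionFun_infty]
  · rintro rfl
    rw [inversionFun_coe, if_pos rfl]

theorem contMDiffOn_affineChart :
    ContMDiffOn 𝓘(ℝ, ℂ) 𝓘(ℝ, ℂ) ∞ affineChart affineChart.source :=
  contMDiffOn_of_mem_maximalAtlas (StructureGroupoid.subset_maximalAtlas _ (Or.inl rfl))

theorem contMDiffOn_infinityChart :
    ContMDiffOn 𝓘(ℝ, ℂ) 𝓘(ℝ, ℂ) ∞ infinityChart infinityChart.source :=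
  contMDiffOn_of_mem_maximalAtlas (StructureGroupoid.subset_maximalAtlas _ (Or.inr rfl))

theorem contMDiff_affineChart_symm : ContMDiff 𝓘(ℝ, ℂ) 𝓘(ℝ, ℂ) ∞ affineChart.symm := by
  rw [← contMDiffOn_univ, ← affineChart_target]
  exact contMDiffOn_symm_of_mem_maximalAtlas
    (StructureGroupoid.subset_maximalAtlas _ (Or.inl rfl))

theorem contMDiff_infinityChart_symm : ContMDiff 𝓘(ℝ, ℂ) 𝓘(ℝ, ℂ) ∞ infinityChart.symm := by
  rw [← contMDiffOn_univ, ← infinityChart_target]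
  exact contMDiffOn_symm_of_mem_maximalAtlas
    (StructureGroupoid.subset_maximalAtlas _ (Or.inr rfl))

/-- The translation `z ↦ z - 1` of the Riemann sphere. -/
def subOne : OnePoint ℂ ≃ₜ OnePoint ℂ := (Homeomorph.addRight (-1 : ℂ)).onePointCongr

theorem subOne_coe (z : ℂ) : subOne z = ((z - 1 : ℂ) : OnePoint ℂ) := by
  rw [sub_eq_add_neg]; rfl

theorem subOne_infty : subOne OnePoint.infty = OnePoint.infty := rfl

/-- The chart `z ↦ s / (z - 1)` of the Riemann sphere, defined off `1`. -/
def planeChart {s : ℂ} (hs : s ≠ 0) : OpenPartialHomeomorph (OnePoint ℂ) ℂ :=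
  (subOne.toOpenPartialHomeomorph.trans infinityChart).trans
    (Homeomorph.mulLeft₀ s hs).toOpenPartialHomeomorph

variable {s : ℂ} (hs : s ≠ 0)

theorem planeChart_apply (x : OnePoint ℂ) :
    planeChart hs x = s * infinityChart (subOne x) := rfl

theorem planeChart_coe {z : ℂ} (hz : z ≠ 1) : planeChart hs (z : OnePoint ℂ) = s * (z - 1)⁻¹ := by
  rw [planeChart_apply, subOne_coe, infinityChart_coe (sub_ne_zero.2 hz)]

theorem planeChart_infty : planeChart hs OnePoint.infty = 0 := by
  rw [planeChart_apply, subOne_infty, infinityChart_infty, mul_zero]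

theorem mem_planeChart_source {x : OnePoint ℂ} :
    x ∈ (planeChart hs).source ↔ x ≠ ((1 : ℂ) : OnePoint ℂ) := by
  have h : x ∈ (planeChart hs).source ↔ subOne x ∈ infinityChart.source := by
    simp [planeChart]
  rw [h, mem_infinityChart_source]
  induction x using OnePoint.rec with
  | infty =>
    rw [subOne_infty]
    simp [OnePoint.infty_ne_coe]
  | coe z =>
    rw [subOne_coe]
    simp [sub_eq_zero]

theorem planeChart_target : (planeChart hs).target = Set.univ := by
  simp [planeChart, infinityChart_target]

/-- Near ∞, in the coordinate w = 1/z, the map s/(z − 1) reads s w/(1 − w), which is smooth at w =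
0. -/
theorem contMDiffOn_planeChart :
    ContMDiffOn 𝓘(ℝ, ℂ) 𝓘(ℝ, ℂ) ∞ (planeChart hs) (planeChart hs).source := by
  intro x hx
  rw [mem_planeChart_source] at hx
  refine ContMDiffAt.contMDiffWithinAt ?_
  by_cases hxi : x = OnePoint.infty
  · have hx0 : x ∈ infinityChart.source := mem_infinityChart_source.2 (by
      rw [hxi]; exact OnePoint.infty_ne_coe 0)
    have h1 : ContMDiffAt 𝓘(ℝ, ℂ) 𝓘(ℝ, ℂ) ∞ infinityChart x :=
      contMDiffOn_infinityChart.contMDiffAt (infinityChart.open_source.mem_nhds hx0)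
    have h2 : ContDiffAt ℝ ∞ (fun w : ℂ => s * (w / (1 - w))) (infinityChart x) := by
      have hne : 1 - infinityChart x ≠ 0 := by
        rw [hxi, infinityChart_infty]
        simp
      simp only [div_eq_mul_inv]
      fun_prop (disch := exact hne)
    refine (h2.contMDiffAt.comp x h1).congr_of_eventuallyEq ?_
    filter_upwards [infinityChart.open_source.mem_nhds hx0,
      isOpen_ne.mem_nhds hx] with y hy hy1
    induction y using OnePoint.rec with
    | infty => simp [planeChart_infty, infinityChart_infty]
    | coe z =>
      have hz0 : z ≠ 0 := by
        rintro rfl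
        exact mem_infinityChart_source.1 hy rfl
      have hz1 : z ≠ 1 := by
        rintro rfl
        exact hy1 rfl
      simp only [Function.comp_apply]
      rw [planeChart_coe hs hz1, infinityChart_coe hz0]
      have := sub_ne_zero.2 hz1
      congr 1
      field_simp
  · have hx0 : x ∈ affineChart.source := mem_affineChart_source.2 hxi
    have h1 : ContMDiffAt 𝓘(ℝ, ℂ) 𝓘(ℝ, ℂ) ∞ affineChart x :=
      contMDiffOn_affineChart.contMDiffAt (affineChart.open_source.mem_nhds hx0)
    have h2 : ContDiffAt ℝ ∞ (fun z : ℂ => s * (z - 1)⁻¹) (affineChart x) := by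
      have hne : affineChart x - 1 ≠ 0 := by
        induction x using OnePoint.rec with
        | infty => exact (hxi rfl).elim
        | coe z =>
          rw [affineChart_coe]
          exact sub_ne_zero.2 fun h => hx (by rw [h])
      fun_prop (disch := exact hne)
    refine (h2.contMDiffAt.comp x h1).congr_of_eventuallyEq ?_
    filter_upwards [affineChart.open_source.mem_nhds hx0,
      isOpen_ne.mem_nhds hx] with y hy hy1
    induction y using OnePoint.rec with
    | infty => exact (mem_affineChart_source.1 hy rfl).elim
    | coe z =>
      simp only [Function.comp_apply]
      rw [planeChart_coe hs (fun h => hy1 (by rw [h])), affineChart_coe]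

theorem planeChart_symm_eq_of_apply {x : OnePoint ℂ} (hx : x ≠ ((1 : ℂ) : OnePoint ℂ)) {w : ℂ}
    (h : planeChart hs x = w) : (planeChart hs).symm w = x := by
  rw [← h]
  exact (planeChart hs).left_inv ((mem_planeChart_source hs).2 hx)

theorem contMDiff_planeChart_symm : ContMDiff 𝓘(ℝ, ℂ) 𝓘(ℝ, ℂ) ∞ (planeChart hs).symm := by
  intro w
  by_cases hw : w = 0
  · have hne : w + s ≠ 0 := by rwa [hw, zero_add]
    have h2 : ContDiffAt ℝ ∞ (fun w : ℂ => w / (w + s)) w := by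
      simp only [div_eq_mul_inv]
      fun_prop (disch := exact hne)
    refine ((contMDiff_infinityChart_symm.contMDiffAt).comp w h2.contMDiffAt).congr_of_eventuallyEq ?_
    filter_upwards [(continuous_id.add continuous_const).continuousAt.eventually_ne hne] with v hv
    simp only [Function.comp_apply]
    have hv' : v + s ≠ 0 := hv
    by_cases hv0 : v = 0
    · rw [hv0, zero_div, infinityChart_symm_zero]
      exact planeChart_symm_eq_of_apply hs (OnePoint.infty_ne_coe 1) (planeChart_infty hs)
    · have h1 : (v / (v + s))⁻¹ = 1 + s / v := by field_simp
      rw [infinityChart_symm (div_ne_zero hv0 hv'), h1]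
      have hne1 : 1 + s / v ≠ 1 := by
        rw [Ne, add_eq_left]
        exact div_ne_zero hs hv0
      refine planeChart_symm_eq_of_apply hs (fun h => hne1 (OnePoint.coe_injective h)) ?_
      rw [planeChart_coe hs hne1, add_sub_cancel_left, inv_div, mul_div_cancel₀ _ hs]
  · have h2 : ContDiffAt ℝ ∞ (fun w : ℂ => 1 + s / w) w := by
      simp only [div_eq_mul_inv]
      fun_prop (disch := exact hw)
    refine ((contMDiff_affineChart_symm.contMDiffAt).comp w h2.contMDiffAt).congr_of_eventuallyEq ?_
    filter_upwards [isOpen_ne.mem_nhds hw] with v hv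
    have hv0 : v ≠ 0 := hv
    have hne1 : 1 + s / v ≠ 1 := by
      rw [Ne, add_eq_left]
      exact div_ne_zero hs hv0
    simp only [Function.comp_apply, affineChart_symm]
    refine planeChart_symm_eq_of_apply hs (fun h => hne1 (OnePoint.coe_injective h)) ?_
    rw [planeChart_coe hs hne1, add_sub_cancel_left, inv_div, mul_div_cancel₀ _ hs]

theorem planeChart_mem_maximalAtlas :
    planeChart hs ∈ IsManifold.maximalAtlas 𝓘(ℝ, ℂ) ∞ (OnePoint ℂ) :=
  (planeChart hs).mem_maximalAtlas_of_contMDiffOn (contMDiffOn_planeChart hs)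
    (contMDiff_planeChart_symm hs).contMDiffOn

end RiemannSphere

/-! ### The cross-ratio as the folding map, and absence of cusps -/

namespace RobotArm

variable (A : RobotArm)

theorem IsGeneric.admissible {A : RobotArm} (h : A.IsGeneric) :
    FoldedTorus.Admissible (A.1 0) (A.1 1) (A.1 2) :=
  ⟨A.2 0, A.2 1, A.2 2, h.1, h.2.1, h.2.2.1⟩

/-- The scaling factor of the chart in which the cross-ratio map is the folding of a torus. -/
def scale : ℂ := A.1 0 * A.1 2 / A.1 1

theorem scale_ne_zero : A.scale ≠ 0 := by
  have h (i) : (A.1 i : ℂ) ≠ 0 := Complex.ofReal_ne_zero.2 (A.2 i).ne'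
  exact div_ne_zero (mul_ne_zero (h 0) (h 2)) (h 1)

theorem torusCrossRatio_apply (p : Circle × Circle) :
    A.torusCrossRatio p = crossRatio 0 (A.1 0) (A.1 0 + A.1 1 * (p.1 : ℂ))
      (A.1 0 + A.1 1 * (p.1 : ℂ) + A.1 2 * (p.2 : ℂ)) := rfl

/-- The identity (a + bx)(w − a) − bxw = acy gives Cr − 1 = acy/(bxw), which is never 0; its scaled
inverse is xw/y. For w = 0 both sides are the origin of the chart, the image of ∞. -/
theorem planeChart_torusCrossRatio {A : RobotArm} (p : Circle × Circle) :
    A.torusCrossRatio p ≠ ((1 : ℂ) : OnePoint ℂ) ∧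
      RiemannSphere.planeChart A.scale_ne_zero (A.torusCrossRatio p) =
        FoldedTorus.plane (A.1 0) (A.1 1) (A.1 2) p := by
  have h (i) : (A.1 i : ℂ) ≠ 0 := Complex.ofReal_ne_zero.2 (A.2 i).ne'
  have h0 := h 0
  have h1 := h 1
  have h2 := h 2
  have hx := Circle.coe_ne_zero p.1
  have hy := Circle.coe_ne_zero p.2
  rw [torusCrossRatio_apply, crossRatio]
  generalize hw : (A.1 0 : ℂ) + A.1 1 * (p.1 : ℂ) + A.1 2 * (p.2 : ℂ) = w at *
  have hplane : FoldedTorus.plane (A.1 0) (A.1 1) (A.1 2) p = (p.1 : ℂ) / p.2 * w := by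
    rw [FoldedTorus.plane, Circle.coe_div, ← hw]
    field_simp
    ring
  rw [hplane]
  have hzq : (A.1 0 : ℂ) + A.1 1 * (p.1 : ℂ) - A.1 0 = A.1 1 * (p.1 : ℂ) := by ring
  rw [hzq, sub_zero, sub_zero]
  split_ifs with hc
  · have hw0 : w = 0 := (mul_eq_zero.1 hc).resolve_left (mul_ne_zero h1 hx)
    rw [RiemannSphere.planeChart_infty, hw0, mul_zero]
    exact ⟨OnePoint.infty_ne_coe 1, rfl⟩
  · have hw0 : w ≠ 0 := fun h' => hc (by rw [h', mul_zero])
    set z : ℂ := ((A.1 0 : ℂ) + A.1 1 * (p.1 : ℂ)) * (w - A.1 0) / (A.1 1 * (p.1 : ℂ) * w) with hz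
    have hz1 : z - 1 = A.1 0 * A.1 2 * p.2 / (A.1 1 * (p.1 : ℂ) * w) := by
      rw [hz, div_sub_one hc]
      congr 1
      rw [← hw]
      ring
    have hne : z - 1 ≠ 0 := by
      rw [hz1]
      exact div_ne_zero (mul_ne_zero (mul_ne_zero h0 h2) hy) hc
    have hne' : z ≠ 1 := sub_ne_zero.1 hne
    refine ⟨fun h' => hne' (OnePoint.coe_injective h'), ?_⟩
    rw [RiemannSphere.planeChart_coe _ hne', hz1, scale]
    field_simp

theorem mem_planeChart_source (p : Circle × Circle) :
    A.torusCrossRatio p ∈ (RiemannSphere.planeChart A.scale_ne_zero).source :=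
  (RiemannSphere.mem_planeChart_source _).2 (planeChart_torusCrossRatio p).1

theorem torusCrossRatio_eq (p : Circle × Circle) :
    A.torusCrossRatio p = (RiemannSphere.planeChart A.scale_ne_zero).symm
      (FoldedTorus.plane (A.1 0) (A.1 1) (A.1 2) p) := by
  rw [← (planeChart_torusCrossRatio p).2,
    (RiemannSphere.planeChart A.scale_ne_zero).left_inv (A.mem_planeChart_source p)]

theorem contMDiff_torusCrossRatio :
    ContMDiff ((𝓡 1).prod (𝓡 1)) 𝓘(ℝ, ℂ) ∞ A.torusCrossRatio := by
  rw [show A.torusCrossRatio = _ from funext A.torusCrossRatio_eq]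
  exact (RiemannSphere.contMDiff_planeChart_symm _).comp (FoldedTorus.contMDiff_plane _ _ _)

theorem torusCrossRatio_eq_iff {p q : Circle × Circle} :
    A.torusCrossRatio p = A.torusCrossRatio q ↔
      FoldedTorus.plane (A.1 0) (A.1 1) (A.1 2) p = FoldedTorus.plane (A.1 0) (A.1 1) (A.1 2) q := by
  constructor
  · intro h
    rw [← (planeChart_torusCrossRatio p).2, h, (planeChart_torusCrossRatio q).2]
  · intro h
    rw [torusCrossRatio_eq, torusCrossRatio_eq, h]

/-- A generic cross-ratio map has at most two points in each fibre. -/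
theorem IsGeneric.fibre {A : RobotArm} (hA : A.IsGeneric) {p q r : Circle × Circle}
    (hpq : A.torusCrossRatio p = A.torusCrossRatio q)
    (hpr : A.torusCrossRatio p = A.torusCrossRatio r) : p = q ∨ p = r ∨ q = r := by
  rw [torusCrossRatio_eq_iff] at hpq hpr
  have hadm := hA.admissible
  set a := A.1 0
  set b := A.1 1
  set c := A.1 2
  have hinj : ∀ {p q : Circle × Circle}, FoldedTorus.plane a b c p = FoldedTorus.plane a b c q →
      FoldedTorus.height a b c p = FoldedTorus.height a b c q → p = q := fun {p q} h1 h2 => by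
    rw [← hadm.retract_embed p, ← hadm.retract_embed q, FoldedTorus.embed, FoldedTorus.embed, h1, h2]
  have e1 : FoldedTorus.height a b c p ^ 2 = FoldedTorus.height a b c q ^ 2 := by
    rw [FoldedTorus.height_sq, FoldedTorus.height_sq, hpq]
  have e2 : FoldedTorus.height a b c p ^ 2 = FoldedTorus.height a b c r ^ 2 := by
    rw [FoldedTorus.height_sq, FoldedTorus.height_sq, hpr]
  rcases sq_eq_sq_iff_eq_or_eq_neg.1 e1 with h1 | h1
  · exact Or.inl (hinj hpq h1)
  · rcases sq_eq_sq_iff_eq_or_eq_neg.1 e2 with h2 | h2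
    · exact Or.inr (Or.inl (hinj hpr h2))
    · exact Or.inr (Or.inr (hinj (hpq.symm.trans hpr) (neg_injective (h1.symm.trans h2))))

/-- In the cusp form (−t², 0) has the three preimages (−t², t), (−t², −t) and (−t², 0), and for
small t ≠ 0 all lie in the chart; but fibres have at most two points. -/
theorem IsGeneric.not_isCuspAt {A : RobotArm} (hA : A.IsGeneric) (p : Circle × Circle) :
    ¬ IsCuspAt ((𝓡 1).prod (𝓡 1)) 𝓘(ℝ, ℂ) A.torusCrossRatio p := by
  rintro ⟨φ, ψ, -, -, hp, hp0, -, -, hF⟩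
  have h0 : (0 : ℝ × ℝ) ∈ φ.target := hp0 ▸ φ.map_source hp
  have ev : ∀ g : ℝ → ℝ × ℝ, Continuous g → g 0 = 0 → ∀ᶠ t in 𝓝 0, g t ∈ φ.target :=
    fun g hg hg0 => hg.continuousAt.eventually_mem (φ.open_target.mem_nhds (by rwa [hg0]))
  have ev1 := ev (fun t => (-t ^ 2, t)) (by fun_prop) (by simp)
  have ev2 := ev (fun t => (-t ^ 2, -t)) (by fun_prop) (by simp)
  have ev3 := ev (fun t => (-t ^ 2, 0)) (by fun_prop) (by simp)
  obtain ⟨t, ⟨⟨h1, h2⟩, h3⟩, ht⟩ := (((ev1.and ev2).and ev3).filter_mono nhdsWithin_le_nhds |>.and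
    (self_mem_nhdsWithin (s := ({0}ᶜ : Set ℝ)))).exists
  have ht0 : t ≠ 0 := ht
  have key : ∀ v ∈ φ.target, v.2 ^ 3 + v.1 * v.2 = 0 →
      A.torusCrossRatio (φ.symm v) ∈ ψ.source ∧
        ψ (A.torusCrossRatio (φ.symm v)) = (v.1, 0) := fun v hv h => by
    have := hF _ (φ.map_target hv)
    rw [φ.right_inv hv] at this
    simp only [h] at this
    exact this
  have k1 := key _ h1 (by simp only; ring)
  have k2 := key _ h2 (by simp only; ring)
  have k3 := key _ h3 (by simp only; ring)
  have e1 := ψ.injOn k3.1 k1.1 (k3.2.trans k1.2.symm)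
  have e2 := ψ.injOn k3.1 k2.1 (k3.2.trans k2.2.symm)
  rcases hA.fibre e1 e2 with h | h | h
  · have := φ.symm.injOn h3 h1 h
    simp only [Prod.mk.injEq, true_and] at this
    exact ht0 this.symm
  · have := φ.symm.injOn h3 h2 h
    simp only [Prod.mk.injEq, true_and] at this
    exact ht0 (neg_eq_zero.1 this.symm)
  · have := φ.symm.injOn h1 h2 h
    simp only [Prod.mk.injEq, true_and] at this
    exact ht0 (by linarith)

end RobotArm

end

/-! ### Cutoffs, and diffeomorphisms extended from a chart -/

section CutOff

/-- A smooth function with compact support in a given open set, equal to `1` on a given compact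
set. -/
theorem IsCompact.exists_contDiff_eq_one {E : Type*} [NormedAddCommGroup E] [NormedSpace ℝ E]
    [FiniteDimensional ℝ E] {K W : Set E} (hK : IsCompact K) (hW : IsOpen W) (hKW : K ⊆ W) :
    ∃ χ : E → ℝ, ContDiff ℝ ∞ χ ∧ HasCompactSupport χ ∧ tsupport χ ⊆ W ∧ ∀ x ∈ K, χ x = 1 := by
  obtain ⟨L, hL, hKL, hLW⟩ := exists_compact_between hK hW hKW
  obtain ⟨χ, h1, h0, -⟩ := exists_contMDiffMap_one_nhds_of_subset_interior (n := (⊤ : ℕ∞))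
    𝓘(ℝ, E) hK.isClosed hKL
  have hs : tsupport χ ⊆ L := closure_minimal
    (fun x hx => by_contra fun h => hx (h0 x h)) hL.isClosed
  exact ⟨χ, χ.contMDiff.contDiff, hL.of_isClosed_subset (isClosed_tsupport _) hs, hs.trans hLW,
    fun x hx => h1.self_of_nhdsSet x hx⟩

end CutOff

section ChartExtension

variable {V N : Type*} [NormedAddCommGroup V] [TopologicalSpace N]

open Classical in
/-- The self-map of a manifold that agrees with `κ` in the chart `ψ`, and with the identity off the
domain of the chart. -/
noncomputable def OpenPartialHomeomorph.extendMap (ψ : OpenPartialHomeomorph N V) (κ : V → V)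
    (x : N) : N :=
  if x ∈ ψ.source then ψ.symm (κ (ψ x)) else x

theorem OpenPartialHomeomorph.extendMap_extendMap {ψ : OpenPartialHomeomorph N V}
    (hψ : ψ.target = Set.univ) {κ κ' : V → V} (h : ∀ z, κ' (κ z) = z) (x : N) :
    ψ.extendMap κ' (ψ.extendMap κ x) = x := by
  by_cases hx : x ∈ ψ.source
  · have h1 : κ (ψ x) ∈ ψ.target := hψ ▸ Set.mem_univ _
    rw [extendMap, extendMap, if_pos hx, if_pos (ψ.map_target h1), ψ.right_inv h1, h, ψ.left_inv hx]
  · rw [extendMap, extendMap, if_neg hx, if_neg hx]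

theorem OpenPartialHomeomorph.extendMap_symm {ψ : OpenPartialHomeomorph N V}
    (hψ : ψ.target = Set.univ) (κ : V → V) (z : V) :
    ψ.extendMap κ (ψ.symm z) = ψ.symm (κ z) := by
  have h1 : z ∈ ψ.target := hψ ▸ Set.mem_univ _
  rw [extendMap, if_pos (ψ.map_target h1), ψ.right_inv h1]

variable [NormedSpace ℝ V] [ChartedSpace V N]

theorem OpenPartialHomeomorph.contMDiff_extendMap [T2Space N]
    {ψ : OpenPartialHomeomorph N V} (hψ : ψ.target = Set.univ)
    (h1 : ContMDiffOn 𝓘(ℝ, V) 𝓘(ℝ, V) ∞ ψ ψ.source) (h2 : ContMDiff 𝓘(ℝ, V) 𝓘(ℝ, V) ∞ ψ.symm)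
    {κ : V → V} (hκ : ContDiff ℝ ∞ κ) {C : Set V} (hC : IsCompact C) (hκC : ∀ z ∉ C, κ z = z) :
    ContMDiff 𝓘(ℝ, V) 𝓘(ℝ, V) ∞ (ψ.extendMap κ) := by
  intro x
  by_cases hx : x ∈ ψ.source
  · have h3 := h1.contMDiffAt (ψ.open_source.mem_nhds hx)
    refine (h2.contMDiffAt.comp x (hκ.contMDiff.contMDiffAt.comp x h3)).congr_of_eventuallyEq ?_
    filter_upwards [ψ.open_source.mem_nhds hx] with y hy
    rw [extendMap, if_pos hy]
    rfl
  · have hcl : IsClosed (ψ.symm '' C) := (hC.image h2.continuous).isClosed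
    have hxC : x ∉ ψ.symm '' C := by
      rintro ⟨z, -, rfl⟩
      exact hx (ψ.map_target (hψ ▸ Set.mem_univ _))
    refine contMDiffAt_id.congr_of_eventuallyEq ?_
    filter_upwards [hcl.isOpen_compl.mem_nhds hxC] with y hy
    by_cases hy' : y ∈ ψ.source
    · rw [extendMap, if_pos hy', hκC _ fun h => hy ⟨_, h, ψ.left_inv hy'⟩, ψ.left_inv hy', id]
    · rw [extendMap, if_neg hy', id]

/-- A compactly supported diffeomorphism of the model space acts on the manifold through a chart
onto the model space. -/
theorem OpenPartialHomeomorph.exists_diffeomorph_extending [T2Space N]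
    {ψ : OpenPartialHomeomorph N V} (hψ : ψ.target = Set.univ)
    (h1 : ContMDiffOn 𝓘(ℝ, V) 𝓘(ℝ, V) ∞ ψ ψ.source) (h2 : ContMDiff 𝓘(ℝ, V) 𝓘(ℝ, V) ∞ ψ.symm)
    (κ : V ≃ V) (hκ : ContDiff ℝ ∞ κ) (hκ' : ContDiff ℝ ∞ κ.symm) {C : Set V} (hC : IsCompact C)
    (hκC : ∀ z ∉ C, κ z = z) :
    ∃ k : N ≃ₘ⟮𝓘(ℝ, V), 𝓘(ℝ, V)⟯ N, ∀ z, k.symm (ψ.symm z) = ψ.symm (κ.symm z) :=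
  ⟨{ toFun := ψ.extendMap κ
     invFun := ψ.extendMap κ.symm
     left_inv := ψ.extendMap_extendMap hψ κ.symm_apply_apply
     right_inv := ψ.extendMap_extendMap hψ κ.apply_symm_apply
     contMDiff_toFun := ψ.contMDiff_extendMap hψ h1 h2 hκ hC hκC
     contMDiff_invFun := ψ.contMDiff_extendMap hψ h1 h2 hκ' hC fun z hz =>
       κ.symm_apply_eq.2 (hκC z hz).symm },
    ψ.extendMap_symm hψ κ.symm⟩

end ChartExtension

/-! ### Ambient diffeomorphisms restricted to the torus -/

namespace FoldedTorus

variable {a b c : ℝ}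

theorem Admissible.mem_range_embed (h : Admissible a b c) {x : ℂ × ℝ} :
    x ∈ Set.range (embed a b c) ↔ x.2 ^ 2 = disc a b c x.1 :=
  ⟨by rintro ⟨p, rfl⟩; exact height_sq a b c p, fun hx => ⟨_, h.embed_retract hx⟩⟩

/-- A diffeomorphism of the ambient space that preserves the embedded torus restricts to a
diffeomorphism of the torus. -/
theorem Admissible.exists_diffeomorph (h : Admissible a b c) (Θ : ℂ × ℝ ≃ ℂ × ℝ)
    (hΘ : ContDiff ℝ ∞ Θ) (hΘ' : ContDiff ℝ ∞ Θ.symm)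
    (hS : ∀ x, (Θ x).2 ^ 2 = disc a b c (Θ x).1 ↔ x.2 ^ 2 = disc a b c x.1) :
    ∃ k : (Circle × Circle) ≃ₘ⟮(𝓡 1).prod (𝓡 1), (𝓡 1).prod (𝓡 1)⟯ (Circle × Circle),
      ∀ p, embed a b c (k p) = Θ (embed a b c p) := by
  have hsm : ∀ Φ : ℂ × ℝ → ℂ × ℝ, ContDiff ℝ ∞ Φ →
      (∀ x, x.2 ^ 2 = disc a b c x.1 → (Φ x).2 ^ 2 = disc a b c (Φ x).1) →
      ContMDiff ((𝓡 1).prod (𝓡 1)) ((𝓡 1).prod (𝓡 1)) ∞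
        (fun p => retract a b c (Φ (embed a b c p))) := fun Φ hΦ hS' p =>
    (contMDiffAt_retract a b c (h.mem_retractDomain (hS' _ (height_sq a b c p)))).comp p
      (hΦ.contMDiff.comp (contMDiff_embed a b c)).contMDiffAt
  have hS1 : ∀ x, x.2 ^ 2 = disc a b c x.1 → (Θ x).2 ^ 2 = disc a b c (Θ x).1 :=
    fun x => (hS x).2
  have hS2 : ∀ x, x.2 ^ 2 = disc a b c x.1 → (Θ.symm x).2 ^ 2 = disc a b c (Θ.symm x).1 :=
    fun x hx => (hS _).1 (by rwa [Θ.apply_symm_apply])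
  refine ⟨{ toFun := fun p => retract a b c (Θ (embed a b c p))
            invFun := fun p => retract a b c (Θ.symm (embed a b c p))
            left_inv := fun p => ?_
            right_inv := fun p => ?_
            contMDiff_toFun := hsm Θ hΘ hS1
            contMDiff_invFun := hsm Θ.symm hΘ' hS2 }, fun p => ?_⟩
  · simp only
    rw [h.embed_retract (hS1 _ (height_sq a b c p)), Θ.symm_apply_apply, h.retract_embed]
  · simp only
    rw [h.embed_retract (hS2 _ (height_sq a b c p)), Θ.apply_symm_apply, h.retract_embed]
  · exact h.embed_retract (hS1 _ (height_sq a b c p))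

end FoldedTorus

/-! ### Stability -/

namespace RobotArm

theorem IsGeneric.isStableMap {A : RobotArm} (hA : A.IsGeneric) :
    IsStableMap ((𝓡 1).prod (𝓡 1)) 𝓘(ℝ, ℂ) ⟨A.torusCrossRatio, A.contMDiff_torusCrossRatio⟩ := by
  have h := hA.admissible
  set a := A.1 0
  set b := A.1 1
  set c := A.1 2
  set ψ := RiemannSphere.planeChart A.scale_ne_zero with hψ
  set f : C^∞⟮(𝓡 1).prod (𝓡 1), Circle × Circle; 𝓘(ℝ, ℂ), OnePoint ℂ⟯ :=
    ⟨A.torusCrossRatio, A.contMDiff_torusCrossRatio⟩ with hf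
  have hfplane : ∀ p, ψ (f p) = FoldedTorus.plane a b c p := fun p => (planeChart_torusCrossRatio p).2
  obtain ⟨χ, hχ, hχc, hχW, hχ1⟩ := (isCompact_range
    (FoldedTorus.contMDiff_embed a b c).continuous).exists_contDiff_eq_one
      (FoldedTorus.isOpen_retractDomain a b c)
      (fun x hx => h.mem_retractDomain (h.mem_range_embed.1 hx))
  obtain ⟨r, hr⟩ := hχc.isCompact.isBounded.subset_closedBall 0
  obtain ⟨ε, hε, hfib⟩ := exists_fibred_equiv (FoldedTorus.contDiff_disc a b c)
    h.isCompact_disc_eq_zero (fun z hz => h.fderiv_disc_ne_zero hz) r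
  -- Closeness of derivatives up to order 2 is all that `exists_fibred_equiv` requires.
  obtain ⟨U, hU, hfU, hgU⟩ := exists_isOpen_forall_cutoff_bound f
    (RiemannSphere.planeChart_mem_maximalAtlas A.scale_ne_zero) A.mem_planeChart_source
    (FoldedTorus.isOpen_retractDomain a b c)
    (fun x hx => (FoldedTorus.contMDiffAt_retract a b c hx).contMDiffWithinAt) hχ hχc hχW 2 hε
  refine ⟨U, hU, hfU, fun g hg => ?_⟩
  obtain ⟨hgs, hes, heε⟩ := hgU g hg
  set e : ℂ × ℝ → ℂ := fun x => χ x • (ψ.extend 𝓘(ℝ, ℂ) (g (FoldedTorus.retract a b c x)) -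
    ψ.extend 𝓘(ℝ, ℂ) (f (FoldedTorus.retract a b c x))) with he
  -- On the embedded torus the cutoff is 1 and the retraction is the inverse of the embedding, so
  -- the first component of Ψ there is g read in the chart.
  have heS : ∀ p, e (FoldedTorus.embed a b c p) = ψ (g p) - FoldedTorus.plane a b c p := fun p => by
    simp only [he, hχ1 _ (Set.mem_range_self p), one_smul, h.retract_embed]
    rw [← hfplane]
    rfl
  obtain ⟨Ψ, Λ, κ, hΨ, hΨ', hΛ, hΛ', hκ, hκ', hΨe, ⟨C, hC, hκC⟩, hΛκ, hS⟩ := hfib e hes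
    (fun x hx => by
      simp only [he, image_eq_zero_of_notMem_tsupport fun h' => hx (hr h'), zero_smul])
    (fun x => by simpa using heε x 0 (by norm_num))
    (fun x => by simpa [norm_iteratedFDeriv_one] using heε x 1 (by norm_num))
    (fun x => by
      have := heε x 2 le_rfl
      rwa [← norm_iteratedFDeriv_fderiv, norm_iteratedFDeriv_one] at this)
  obtain ⟨k, hk⟩ := OpenPartialHomeomorph.exists_diffeomorph_extending
    (RiemannSphere.planeChart_target A.scale_ne_zero)
    (RiemannSphere.contMDiffOn_planeChart A.scale_ne_zero)
    (RiemannSphere.contMDiff_planeChart_symm A.scale_ne_zero) κ hκ hκ' hC hκC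
  have hΨ2 : ∀ x, (Ψ.symm x).2 = x.2 := fun x => by
    conv_rhs => rw [← Ψ.apply_symm_apply x, hΨe]
  -- The inverse of Λ ∘ Ψ preserves the torus, since Λ carries Ψ(S) to S. As Λ covers κ, the
  -- relation obtained is g ∘ l = κ⁻¹ ∘ f in the chart.
  obtain ⟨l, hl⟩ := h.exists_diffeomorph (Λ.symm.trans Ψ.symm) (hΨ'.comp hΛ') (hΛ.comp hΨ)
    (fun x => by
      rw [Equiv.trans_apply, hΨ2, hS, Λ.apply_symm_apply])
  refine ⟨l, k.symm, fun p => ?_⟩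
  have h1 : Ψ (FoldedTorus.embed a b c (l p)) = Λ.symm (FoldedTorus.embed a b c p) := by
    rw [hl, Equiv.trans_apply, Ψ.apply_symm_apply]
  have h2 : ψ (g (l p)) = κ.symm (FoldedTorus.plane a b c p) := by
    have h3 := congrArg Prod.fst h1
    rw [hΨe, heS] at h3
    have h4 : (FoldedTorus.embed a b c (l p)).1 = FoldedTorus.plane a b c (l p) := rfl
    rw [h4] at h3
    simp only [add_sub_cancel] at h3
    rw [h3, Equiv.eq_symm_apply, ← hΛκ, Λ.apply_symm_apply]
    rfl
  have h5 : f p = ψ.symm (FoldedTorus.plane a b c p) := A.torusCrossRatio_eq p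
  rw [h5, hk, ← h2, ψ.left_inv (hgs _)]

end RobotArm

/-! ### Local coordinates and surjective differentials -/

section LocalCoordinates

theorem Complex.exists_equiv_snd_eq {L : ℂ →L[ℝ] ℝ} (hL : L ≠ 0) :
    ∃ Φ : ℂ ≃L[ℝ] ℝ × ℝ, ∀ z, Φ z = (L (Complex.I * z), L z) := by
  set T : ℂ →ₗ[ℝ] ℝ × ℝ :=
    (L.toLinearMap ∘ₗ LinearMap.mulLeft ℝ Complex.I).prod L.toLinearMap with hT
  have hTz : ∀ z, T z = (L (Complex.I * z), L z) := fun z => rfl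
  have hinj : Function.Injective T := by
    rw [← LinearMap.ker_eq_bot, LinearMap.ker_eq_bot']
    intro z hz
    rw [hTz, Prod.mk_eq_zero] at hz
    by_contra hz0
    refine hL (ContinuousLinearMap.ext fun w => ?_)
    have hw : w = (w / z).re • z + (w / z).im • (Complex.I * z) := by
      rw [Complex.real_smul, Complex.real_smul, ← mul_assoc, ← add_mul, Complex.re_add_im,
        div_mul_cancel₀ _ hz0]
    rw [hw, map_add, map_smul, map_smul, hz.1, hz.2]
    simp
  have hrank : Module.finrank ℝ ℂ = Module.finrank ℝ (ℝ × ℝ) := by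
    rw [Complex.finrank_real_complex, Module.finrank_prod, Module.finrank_self]
  exact ⟨(LinearEquiv.ofInjectiveOfFinrankEq T hinj hrank).toContinuousLinearEquiv, hTz⟩

/-- A smooth function on the plane is a local coordinate near a regular point. -/
theorem ContDiff.exists_openPartialHomeomorph_snd_eq {D : ℂ → ℝ} (hD : ContDiff ℝ ∞ D) {z₀ : ℂ}
    (h₀ : D z₀ = 0) (h₁ : fderiv ℝ D z₀ ≠ 0) :
    ∃ Q : OpenPartialHomeomorph ℂ (ℝ × ℝ), z₀ ∈ Q.source ∧ Q z₀ = 0 ∧ (∀ z, (Q z).2 = D z) ∧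
      ContDiffOn ℝ ∞ Q Q.source ∧ ContDiffOn ℝ ∞ Q.symm Q.target := by
  obtain ⟨Φ, hΦ⟩ := Complex.exists_equiv_snd_eq h₁
  set F : ℂ → ℝ × ℝ := fun z => (fderiv ℝ D z₀ (Complex.I * (z - z₀)), D z) with hF
  have hFs : ContDiff ℝ ∞ F :=
    ((fderiv ℝ D z₀).contDiff.comp (contDiff_const.mul (contDiff_id.sub contDiff_const))).prodMk hD
  have hF' : HasFDerivAt F (Φ : ℂ →L[ℝ] ℝ × ℝ) z₀ := by
    have h1 : HasFDerivAt (fun z => fderiv ℝ D z₀ (Complex.I * (z - z₀)))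
        ((ContinuousLinearMap.fst ℝ ℝ ℝ).comp (Φ : ℂ →L[ℝ] ℝ × ℝ)) z₀ := by
      have h2 : (fun z => fderiv ℝ D z₀ (Complex.I * (z - z₀))) = fun z =>
          ((ContinuousLinearMap.fst ℝ ℝ ℝ).comp (Φ : ℂ →L[ℝ] ℝ × ℝ)) (z - z₀) := by
        ext z
        simp [hΦ]
      rw [h2]
      exact (ContinuousLinearMap.hasFDerivAt _).comp z₀ ((hasFDerivAt_id z₀).sub_const z₀)
    have h3 := h1.prodMk ((hD.differentiable (by simp)) z₀).hasFDerivAt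
    refine h3.congr_fderiv (ContinuousLinearMap.ext fun z => ?_)
    simp [hΦ]
  set Q₀ := hFs.contDiffAt.toOpenPartialHomeomorph F hF' (by simp) with hQ₀
  have hQF : ∀ z, Q₀ z = F z := fun z => rfl
  -- Restricting to the open set of points with invertible differential makes the inverse smooth on
  -- the whole target, not only at the image of z₀.
  set O : Set ℂ := {z | fderiv ℝ F z ∈ Set.range
    ((↑) : (ℂ ≃L[ℝ] ℝ × ℝ) → ℂ →L[ℝ] ℝ × ℝ)} with hO
  have hOo : IsOpen O :=
    (ContinuousLinearEquiv.isOpen (𝕜 := ℝ) (E := ℂ) (F := ℝ × ℝ)).preimage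
      (hFs.continuous_fderiv (by simp))
  refine ⟨Q₀.restrOpen O hOo, ?_, ?_, fun z => rfl, hFs.contDiffOn, fun y hy => ?_⟩
  · exact ⟨hFs.contDiffAt.mem_toOpenPartialHomeomorph_source hF' (by simp), Φ, hF'.fderiv.symm⟩
  · change F z₀ = 0
    simp [hF, h₀]
  · obtain ⟨-, Φ', hΦ'⟩ := (Q₀.restrOpen O hOo).map_target hy
    refine ((Q₀.restrOpen O hOo).contDiffAt_symm hy (f₀' := Φ') ?_ hFs.contDiffAt).contDiffWithinAt
    rw [hΦ']
    exact ((hFs.differentiable (by simp)) _).hasFDerivAt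

end LocalCoordinates

/-- A map with a local right inverse has surjective differential. -/
theorem surjective_mfderiv_of_eventually_eq {E H E' H' M N : Type*}
    [NormedAddCommGroup E] [NormedSpace ℝ E] [TopologicalSpace H]
    [NormedAddCommGroup E'] [NormedSpace ℝ E'] [TopologicalSpace H']
    {I : ModelWithCorners ℝ E H} {I' : ModelWithCorners ℝ E' H'}
    [TopologicalSpace M] [ChartedSpace H M] [TopologicalSpace N] [ChartedSpace H' N]
    {f : M → N} {σ : N → M} {p : M} (hf : MDifferentiableAt I I' f p)
    (hσ : MDifferentiableAt I' I σ (f p)) (hσp : σ (f p) = p) (h : ∀ᶠ x in 𝓝 (f p), f (σ x) = x) :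
    Function.Surjective (mfderiv I I' f p) := by
  have h1 : MDifferentiableAt I I' f (σ (f p)) := by rwa [hσp]
  have h2 := mfderiv_comp (f p) h1 hσ
  have h3 : mfderiv I' I' (f ∘ σ) (f p) = mfderiv I' I' id (f p) :=
    Filter.EventuallyEq.mfderiv_eq (by filter_upwards [h] with x hx using hx)
  rw [h3, mfderiv_id, hσp] at h2
  intro v
  exact ⟨mfderiv I' I σ (f p) v, (congrArg (fun T : E' →L[ℝ] E' => T v) h2).symm⟩

namespace FoldedTorus

variable {a b c : ℝ}

/-- Off the zero set of the height function, the projection to the plane has a local section. -/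
theorem Admissible.exists_section (h : Admissible a b c) {p : Circle × Circle}
    (hp : height a b c p ≠ 0) :
    ∃ σ : ℂ → Circle × Circle, ContMDiffAt 𝓘(ℝ, ℂ) ((𝓡 1).prod (𝓡 1)) ∞ σ (plane a b c p) ∧
      σ (plane a b c p) = p ∧ ∀ᶠ z in 𝓝 (plane a b c p), plane a b c (σ z) = z := by
  -- The sign `s` selects the sheet h = ±√D through p; off the fold curve it is a smooth graph over
  -- the plane.
  obtain ⟨s, hs, hps⟩ : ∃ s : ℝ, s ^ 2 = 1 ∧ height a b c p = s * |height a b c p| := by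
    rcases abs_choice (height a b c p) with h | h
    · exact ⟨1, by norm_num, by rw [h, one_mul]⟩
    · exact ⟨-1, by norm_num, by rw [h]; ring⟩
  have hd : 0 < disc a b c (plane a b c p) := by
    rw [← height_sq]
    positivity
  have hsq : s * Real.sqrt (disc a b c (plane a b c p)) = height a b c p := by
    rw [← height_sq, Real.sqrt_sq_eq_abs, ← hps]
  have hmem : ∀ z, 0 < disc a b c z → ((z, s * Real.sqrt (disc a b c z)) : ℂ × ℝ).2 ^ 2 =
      disc a b c ((z, s * Real.sqrt (disc a b c z)) : ℂ × ℝ).1 := fun z hz => by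
    simp only [mul_pow, hs, one_mul, Real.sq_sqrt hz.le]
  have hsm : ContDiffAt ℝ ∞ (fun z => ((z, s * Real.sqrt (disc a b c z)) : ℂ × ℝ))
      (plane a b c p) :=
    contDiffAt_id.prodMk (contDiffAt_const.mul
      ((contDiff_disc a b c).contDiffAt.sqrt hd.ne'))
  refine ⟨fun z => retract a b c (z, s * Real.sqrt (disc a b c z)),
    ContMDiffAt.comp (g := retract a b c) (plane a b c p)
      (contMDiffAt_retract a b c (h.mem_retractDomain (hmem _ hd))) hsm.contMDiffAt, ?_, ?_⟩
  · simp only [hsq]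
    exact h.retract_embed p
  · filter_upwards [(contDiff_disc a b c).continuous.continuousAt.eventually (lt_mem_nhds hd)]
      with z hz
    exact congrArg Prod.fst (h.embed_retract (hmem z hz))

/-- Coordinates on the torus in which the projection to the plane, read in the coordinates `Q`, is
a fold. -/
noncomputable def Admissible.foldChart (h : Admissible a b c) (Q : OpenPartialHomeomorph ℂ (ℝ × ℝ))
    (hQ : ∀ z, (Q z).2 = disc a b c z) :
    OpenPartialHomeomorph (Circle × Circle) (ℝ × ℝ) :=
  have hmem : ∀ v : ℝ × ℝ, (v.1, v.2 ^ 2) ∈ Q.target →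
      ((Q.symm (v.1, v.2 ^ 2), v.2) : ℂ × ℝ).2 ^ 2 =
        disc a b c ((Q.symm (v.1, v.2 ^ 2), v.2) : ℂ × ℝ).1 := fun v hv => by
    simp only [← hQ, Q.right_inv hv]
  have hQp : ∀ p, ((Q (plane a b c p)).1, height a b c p ^ 2) = Q (plane a b c p) := fun p => by
    rw [height_sq, ← hQ]
  have hsrc : IsOpen {p | plane a b c p ∈ Q.source} :=
    Q.open_source.preimage (contMDiff_plane a b c).continuous
  have htgt : IsOpen {v : ℝ × ℝ | (v.1, v.2 ^ 2) ∈ Q.target} :=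
    Q.open_target.preimage (by fun_prop)
  { toFun := fun p => ((Q (plane a b c p)).1, height a b c p)
    -- The second coordinate is the height itself, whose square is D, the second coordinate of Q; so
    -- (v₁, v₂) lies over the point with Q-coordinates (v₁, v₂²).
    invFun := fun v => retract a b c (Q.symm (v.1, v.2 ^ 2), v.2)
    source := {p | plane a b c p ∈ Q.source}
    target := {v | (v.1, v.2 ^ 2) ∈ Q.target}
    map_source' := fun p hp => by
      simp only [Set.mem_ofPred_eq, hQp]
      exact Q.map_source hp
    map_target' := fun v hv => by
      have := congrArg Prod.fst (h.embed_retract (hmem v hv))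
      change plane a b c _ ∈ Q.source
      rw [show plane a b c _ = _ from this]
      exact Q.map_target hv
    left_inv' := fun p hp => by
      simp only [hQp]
      rw [Q.left_inv hp]
      exact h.retract_embed p
    right_inv' := fun v hv => by
      have h1 := congrArg Prod.fst (h.embed_retract (hmem v hv))
      have h2 := congrArg Prod.snd (h.embed_retract (hmem v hv))
      refine Prod.ext ?_ h2
      simp only
      rw [show plane a b c _ = _ from h1]
      simp only
      rw [Q.right_inv hv]
    open_source := hsrc
    open_target := htgt
    continuousOn_toFun := by
      refine ContinuousOn.prodMk ?_ (contMDiff_height a b c).continuous.continuousOn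
      exact continuous_fst.comp_continuousOn (Q.continuousOn.comp
        (contMDiff_plane a b c).continuous.continuousOn fun p hp => hp)
    continuousOn_invFun := fun v hv => by
      refine ContinuousAt.comp_continuousWithinAt
        (g := retract a b c) (contMDiffAt_retract a b c (h.mem_retractDomain (hmem v hv))).continuousAt ?_
      refine ContinuousWithinAt.prodMk ?_ continuous_snd.continuousWithinAt
      have h1 : ContinuousOn (fun v : ℝ × ℝ => Q.symm (v.1, v.2 ^ 2))
          {v | (v.1, v.2 ^ 2) ∈ Q.target} :=
        Q.continuousOn_symm.comp (by fun_prop) fun v hv => hv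
      exact h1 v hv }

theorem Admissible.isSmoothPlaneChart_foldChart (h : Admissible a b c)
    (Q : OpenPartialHomeomorph ℂ (ℝ × ℝ)) (hQ : ∀ z, (Q z).2 = disc a b c z)
    (hQ1 : ContDiffOn ℝ ∞ Q Q.source) (hQ2 : ContDiffOn ℝ ∞ Q.symm Q.target) :
    IsSmoothPlaneChart ((𝓡 1).prod (𝓡 1)) (h.foldChart Q hQ) := by
  constructor
  · have h1 : ContMDiffOn ((𝓡 1).prod (𝓡 1)) 𝓘(ℝ, ℝ) ∞
        (fun p => (Q (plane a b c p)).1) (h.foldChart Q hQ).source :=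
      contDiff_fst.contMDiff.comp_contMDiffOn (hQ1.contMDiffOn.comp
        (contMDiff_plane a b c).contMDiffOn fun p hp => hp)
    exact h1.prodMk_space (contMDiff_height a b c).contMDiffOn
  · intro v hv
    have hmem : ((Q.symm (v.1, v.2 ^ 2), v.2) : ℂ × ℝ).2 ^ 2 =
        disc a b c ((Q.symm (v.1, v.2 ^ 2), v.2) : ℂ × ℝ).1 := by
      simp only [← hQ, Q.right_inv hv]
    have h1 : ContDiffOn ℝ ∞ (fun v : ℝ × ℝ => ((Q.symm (v.1, v.2 ^ 2), v.2) : ℂ × ℝ))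
        (h.foldChart Q hQ).target := by
      refine ContDiffOn.prodMk (hQ2.comp (ContDiff.contDiffOn (by fun_prop)) fun v hv => hv)
        contDiffOn_snd
    exact ContMDiffAt.comp_contMDiffWithinAt (g := retract a b c) v
      (contMDiffAt_retract a b c (h.mem_retractDomain hmem)) (h1.contMDiffOn v hv)

end FoldedTorus

/-! ### Folds, and genericity of side-lengths -/

namespace RobotArm

/-- Off height 0 a sheet of the square root gives a local section, which makes the differential
surjective. -/
theorem IsGeneric.height_eq_zero {A : RobotArm} (hA : A.IsGeneric) {p : Circle × Circle}
    (hp : IsSingularAt ((𝓡 1).prod (𝓡 1)) 𝓘(ℝ, ℂ) A.torusCrossRatio p) :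
    FoldedTorus.height (A.1 0) (A.1 1) (A.1 2) p = 0 := by
  by_contra hne
  obtain ⟨σ, hσ, hσp, hσz⟩ := hA.admissible.exists_section hne
  set ψ := RiemannSphere.planeChart A.scale_ne_zero with hψ
  have hf := (planeChart_torusCrossRatio (A := A) p).2
  have hmem := A.mem_planeChart_source p
  have hψs : ContMDiffAt 𝓘(ℝ, ℂ) 𝓘(ℝ, ℂ) ∞ ψ (A.torusCrossRatio p) :=
    (RiemannSphere.contMDiffOn_planeChart _).contMDiffAt (ψ.open_source.mem_nhds hmem)
  have hσ' : ContMDiffAt 𝓘(ℝ, ℂ) ((𝓡 1).prod (𝓡 1)) ∞ (σ ∘ ψ) (A.torusCrossRatio p) :=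
    ContMDiffAt.comp _ (by rwa [hf]) hψs
  refine hp (surjective_mfderiv_of_eventually_eq (σ := σ ∘ ψ)
    (A.contMDiff_torusCrossRatio.contMDiffAt.mdifferentiableAt (by simp))
    (hσ'.mdifferentiableAt (by simp)) (by rw [Function.comp_apply, hf, hσp]) ?_)
  have hev : ∀ᶠ x in 𝓝 (A.torusCrossRatio p), FoldedTorus.plane _ _ _ (σ (ψ x)) = ψ x :=
    hψs.continuousAt.eventually (by rwa [hf])
  filter_upwards [hev, ψ.open_source.mem_nhds hmem] with x hx hxs
  rw [Function.comp_apply, torusCrossRatio_eq, hx, ψ.left_inv hxs]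

theorem IsGeneric.isFoldAt {A : RobotArm} (hA : A.IsGeneric) {p : Circle × Circle}
    (hp : IsSingularAt ((𝓡 1).prod (𝓡 1)) 𝓘(ℝ, ℂ) A.torusCrossRatio p) :
    IsFoldAt ((𝓡 1).prod (𝓡 1)) 𝓘(ℝ, ℂ) A.torusCrossRatio p := by
  have h := hA.admissible
  have hh := hA.height_eq_zero hp
  have hd : FoldedTorus.disc (A.1 0) (A.1 1) (A.1 2) (FoldedTorus.plane (A.1 0) (A.1 1) (A.1 2) p)
      = 0 := by
    rw [← FoldedTorus.height_sq, hh]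
    norm_num
  obtain ⟨Q, hQs, hQ0, hQ, hQ1, hQ2⟩ :=
    (FoldedTorus.contDiff_disc (A.1 0) (A.1 1) (A.1 2)).exists_openPartialHomeomorph_snd_eq hd
      (h.fderiv_disc_ne_zero hd)
  set ψ := RiemannSphere.planeChart A.scale_ne_zero with hψ
  refine ⟨h.foldChart Q hQ, ψ.trans Q, h.isSmoothPlaneChart_foldChart Q hQ hQ1 hQ2, ⟨?_, ?_⟩, hQs,
    ?_, ⟨A.mem_planeChart_source p, ?_⟩, ?_, fun q hq => ⟨⟨A.mem_planeChart_source q, ?_⟩, ?_⟩⟩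
  · exact hQ1.contMDiffOn.comp
      ((RiemannSphere.contMDiffOn_planeChart A.scale_ne_zero).mono Set.inter_subset_left)
      fun x hx => hx.2
  · exact (RiemannSphere.contMDiff_planeChart_symm A.scale_ne_zero).comp_contMDiffOn
      (hQ2.contMDiffOn.mono Set.inter_subset_left)
  · refine Prod.ext ?_ hh
    change (Q _).1 = 0
    rw [hQ0]
    rfl
  · change ψ (A.torusCrossRatio p) ∈ Q.source
    rw [(planeChart_torusCrossRatio p).2]
    exact hQs
  · change Q (ψ (A.torusCrossRatio p)) = 0
    rw [(planeChart_torusCrossRatio p).2, hQ0]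
  · change ψ (A.torusCrossRatio q) ∈ Q.source
    rw [(planeChart_torusCrossRatio q).2]
    exact hq
  · change Q (ψ (A.torusCrossRatio q)) = _
    rw [(planeChart_torusCrossRatio q).2]
    refine Prod.ext rfl ?_
    rw [hQ, ← FoldedTorus.height_sq]
    rfl

theorem isOpen_isGeneric : IsOpen {A : RobotArm | A.IsGeneric} := by
  have hc : ∀ i : Fin 3, Continuous fun A : RobotArm => A.1 i :=
    fun i => (continuous_apply i).comp continuous_subtype_val
  exact (isOpen_ne_fun (hc 0) (hc 1)).inter <| (isOpen_ne_fun (hc 1) (hc 2)).inter <|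
    (isOpen_ne_fun (hc 0) (hc 2)).inter <| (isOpen_ne_fun (hc 0) ((hc 1).add (hc 2))).inter <|
    (isOpen_ne_fun (hc 1) ((hc 0).add (hc 2))).inter <| isOpen_ne_fun (hc 2) ((hc 0).add (hc 1))

theorem eventually_add_mul_ne_zero (s : ℝ) {t : ℝ} (ht : t ≠ 0) :
    ∀ᶠ x : ℝ in 𝓝[>] 0, s + t * x ≠ 0 := by
  by_cases hs : s = 0
  · filter_upwards [self_mem_nhdsWithin] with x hx
    rw [hs, zero_add]
    exact mul_ne_zero ht (ne_of_gt hx)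
  · have h : ContinuousAt (fun x : ℝ => s + t * x) 0 := by fun_prop
    exact (h.eventually_ne (by simpa using hs)).filter_mono nhdsWithin_le_nhds

/-- Along (a + t, b + 3t, c + 9t), t > 0, each of the six linear forms to be avoided is nonconstant,
hence nonzero for small t. The absolute value in `γ` keeps the lengths positive for every real t. -/
theorem dense_isGeneric : Dense {A : RobotArm | A.IsGeneric} := by
  intro A
  set γ : ℝ → RobotArm := fun t => ⟨![A.1 0 + |t|, A.1 1 + 3 * |t|, A.1 2 + 9 * |t|], fun i => by
    have h0 := A.2 0
    have h1 := A.2 1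
    have h2 := A.2 2
    fin_cases i
    · simp only [Fin.zero_eta, Matrix.cons_val_zero]; positivity
    · simp only [Fin.mk_one, Matrix.cons_val_one, Matrix.cons_val_zero]; positivity
    · simp only [Fin.reduceFinMk, Matrix.cons_val]; positivity⟩ with hγ
  have hγc : Continuous γ := by
    refine Continuous.subtype_mk (continuous_pi fun i => ?_) _
    fin_cases i
    · exact continuous_const.add continuous_abs
    · exact continuous_const.add (continuous_const.mul continuous_abs)
    · exact continuous_const.add (continuous_const.mul continuous_abs)
  have hγ0 : γ 0 = A := by
    ext i
    fin_cases i <;> simp [hγ]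
  have hlim : Filter.Tendsto γ (𝓝[>] 0) (𝓝 A) := by
    rw [← hγ0]
    exact (hγc.tendsto 0).mono_left nhdsWithin_le_nhds
  refine mem_closure_of_tendsto hlim ?_
  filter_upwards [self_mem_nhdsWithin,
    eventually_add_mul_ne_zero (A.1 0 - A.1 1) (t := -2) (by norm_num),
    eventually_add_mul_ne_zero (A.1 1 - A.1 2) (t := -6) (by norm_num),
    eventually_add_mul_ne_zero (A.1 0 - A.1 2) (t := -8) (by norm_num),
    eventually_add_mul_ne_zero (A.1 0 - (A.1 1 + A.1 2)) (t := -11) (by norm_num),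
    eventually_add_mul_ne_zero (A.1 1 - (A.1 0 + A.1 2)) (t := -7) (by norm_num),
    eventually_add_mul_ne_zero (A.1 2 - (A.1 0 + A.1 1)) (t := 5) (by norm_num)]
    with t ht h1 h2 h3 h4 h5 h6
  have ht' : |t| = t := abs_of_pos ht
  have e0 : (γ t).1 0 = A.1 0 + t := by simp [hγ, ht']
  have e1 : (γ t).1 1 = A.1 1 + 3 * t := by simp [hγ, ht']
  have e2 : (γ t).1 2 = A.1 2 + 9 * t := by simp [hγ, ht']
  rw [IsGeneric, e0, e1, e2]
  exact ⟨fun h => h1 (by linarith), fun h => h2 (by linarith), fun h => h3 (by linarith),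
    fun h => h4 (by linarith), fun h => h5 (by linarith), fun h => h6 (by linarith)⟩

end RobotArm

theorem mainTheorem4 :
    (IsOpen {A : RobotArm | A.IsGeneric} ∧ Dense {A : RobotArm | A.IsGeneric}) ∧
    ∀ A : RobotArm, A.IsGeneric →
      (∃ hf : ContMDiff ((𝓡 1).prod (𝓡 1)) 𝓘(ℝ, ℂ) ∞ A.torusCrossRatio,
        IsStableMap ((𝓡 1).prod (𝓡 1)) 𝓘(ℝ, ℂ) ⟨A.torusCrossRatio, hf⟩) ∧
      (∀ p : Circle × Circle, IsSingularAt ((𝓡 1).prod (𝓡 1)) 𝓘(ℝ, ℂ) A.torusCrossRatio p →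
        IsFoldAt ((𝓡 1).prod (𝓡 1)) 𝓘(ℝ, ℂ) A.torusCrossRatio p) ∧
      (∀ p : Circle × Circle, ¬ IsCuspAt ((𝓡 1).prod (𝓡 1)) 𝓘(ℝ, ℂ) A.torusCrossRatio p) :=
  ⟨⟨RobotArm.isOpen_isGeneric, RobotArm.dense_isGeneric⟩, fun A hA =>
    ⟨⟨A.contMDiff_torusCrossRatio, hA.isStableMap⟩, fun _ hp => hA.isFoldAt hp,
      hA.not_isCuspAt⟩⟩
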